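/- Let $S$ be a locally Noetherian scheme, let $n,\delta\ge 0$ be integers, and let $\mathscr{A}$ be a sheaf of commutative $\mathscr{O}_S$-algebras which is locally free of rank $n$ as an $\mathscr{O}_S$-module. For an $S$-scheme $f:T\to S$ write $\mathscr{A}_T=f^*\mathscr{A}$. Consider the following two functors on the category of locally Noetherian $S$-schemes, both with pullback of subsheaves as transition maps: - $\mathrm{Gr}(n-\delta,\mathscr{A})$ sends $T$ to the set of quasi-coherent $\mathscr{O}_T$-submodules $\mathscr{E}\subseteq\mathscr{A}_T$ such that $\mathscr{A}_T/\mathscr{E}$ is locally free of rank $n-(n-\delta)=\delta$ (the Grassmannian); - $F^\delta_{\mathscr{A}}$ sends $T$ to the set of quasi-coherent $\mathscr{O}_T$-subalgebras $\mathscr{B}\subseteq\mathscr{A}_T$ such that $\mathscr{A}_T/\mathscr{B}$ is locally free of rank $\delta$ (families of subalgebras of corank $\delta$). Then $\mathrm{Gr}(n-\delta,\mathscr{A})$ is representable by a locally Noetherian $S$-scheme, and for every locally Noetherian $S$-scheme $G$ representing it, the functor $F^\delta_{\mathscr{A}}$ is represented by a closed subscheme $\mathrm{Ter}^\delta(\mathscr{A})\hookrightarrow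 G$, in such a way that the closed immersion corresponds to the inclusion $F^\delta_{\mathscr{A}}\subseteq\mathrm{Gr}(n-\delta,\mathscr{A})$. This closed subscheme is cut out by multiplicative closure and by containing $1$: an $S$-morphism $T\to G$ from a locally Noetherian $S$-scheme $T$, corresponding to $\mathscr{E}\subseteq\mathscr{A}_T$, factors through $\mathrm{Ter}^\delta(\mathscr{A})$ if and only if $\mathscr{E}$ is closed under multiplication and contains the unit section of $\mathscr{A}_T$. -/

import Mathlib

open CategoryTheory TopologicalSpace Opposite AlgebraicGeometry
open scoped TensorProduct

universe u

noncomputable section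

namespace AlgebraicGeometry

/-- A sheaf of (commutative, unital) `𝒪_X`-algebras on a scheme `X`: a sheaf of commutative rings
`𝒜` on `X` with a morphism of sheaves of rings `𝒪_X ⟶ 𝒜`. -/
structure AlgebraSheaf (X : Scheme.{u}) where
  /-- the underlying sheaf of rings -/
  sheaf : TopCat.Sheaf CommRingCat.{u} X
  /-- the structure morphism -/
  str : X.presheaf ⟶ sheaf.presheaf

/-- Restriction of functions along `V ≤ U`. -/
def ores {X : Scheme.{u}} {U V : X.Opens} (h : V ≤ U) : Γ(X, U) →+* Γ(X, V) :=
  (X.presheaf.map (homOfLE h).op).hom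

/-- The germ at `x` of a function. -/
def ogerm {X : Scheme.{u}} (U : X.Opens) (x : X) (hx : x ∈ U) : Γ(X, U) →+* X.presheaf.stalk x :=
  (X.presheaf.germ U x hx).hom

theorem ogerm_ores {X : Scheme.{u}} {U V : X.Opens} (h : V ≤ U) (x : X) (hx : x ∈ V)
    (c : Γ(X, U)) : ogerm V x hx (ores h c) = ogerm U x (h hx) c :=
  TopCat.Presheaf.germ_res_apply X.presheaf (homOfLE h) x hx c

theorem ores_ores {X : Scheme.{u}} {U V W : X.Opens} (h : V ≤ U) (h' : W ≤ V) (c : Γ(X, U)) :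
    ores h' (ores h c) = ores (h'.trans h) c := by
  simp only [ores, ← CommRingCat.comp_apply, ← Functor.map_comp]
  rfl

theorem ores_self {X : Scheme.{u}} {U : X.Opens} (h : U ≤ U) (c : Γ(X, U)) :
    ores h c = c := by
  simp [ores]

theorem ogerm_ext {X : Scheme.{u}} {U : X.Opens} (c c' : Γ(X, U))
    (h : ∀ x (hx : x ∈ U), ogerm U x hx c = ogerm U x hx c') : c = c' :=
  TopCat.Presheaf.section_ext X.sheaf U c c' h

theorem exists_ogerm_eq {X : Scheme.{u}} (x : X) (c : X.presheaf.stalk x) :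
    ∃ (U : X.Opens) (hx : x ∈ U) (s : Γ(X, U)), ogerm U x hx s = c := by
  obtain ⟨U, hx, s, hs⟩ := TopCat.Presheaf.exists_germ_eq X.presheaf c
  exact ⟨U, hx, s, hs⟩

/-- A family of germs that locally comes from functions comes from a function. -/
theorem exists_of_local_germs {X : Scheme.{u}} (V : X.Opens)
    (γ : ∀ x, x ∈ V → X.presheaf.stalk x)
    (hloc : ∀ x ∈ V, ∃ (W : X.Opens) (hW : W ≤ V) (_ : x ∈ W) (c : Γ(X, W)),
      ∀ (y : X) (hy : y ∈ W), ogerm W y hy c = γ y (hW hy)) :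
    ∃ c : Γ(X, V), ∀ (x : X) (hx : x ∈ V), ogerm V x hx c = γ x hx := by
  choose W hW hxW c hc using hloc
  let U : V → X.Opens := fun x => W x.1 x.2
  obtain ⟨s, hs, -⟩ := TopCat.Sheaf.existsUnique_gluing' X.sheaf U V
    (fun x => homOfLE (hW x.1 x.2))
    (fun x hx => Opens.mem_iSup.2 ⟨⟨x, hx⟩, hxW x hx⟩) (fun x => c x.1 x.2) (by
      intro x y
      refine ogerm_ext (X := X) (U := U x ⊓ U y) _ _ fun z hz => ?_
      refine (ogerm_ores (X := X) (inf_le_left : U x ⊓ U y ≤ U x) z hz (c x.1 x.2)).trans ?_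
      refine Eq.trans ?_
        (ogerm_ores (X := X) (inf_le_right : U x ⊓ U y ≤ U y) z hz (c y.1 y.2)).symm
      exact (hc x.1 x.2 z hz.1).trans (hc y.1 y.2 z hz.2).symm)
  refine ⟨s, fun x hx => ?_⟩
  have h1 : ores (hW x hx) s = c x hx := hs ⟨x, hx⟩
  rw [← ogerm_ores (hW x hx) x (hxW x hx) s, h1, hc]

/-- The pullback of functions along `g : T ⟶ T'`, for `V ≤ g⁻¹ W`. -/
def opull {T T' : Scheme.{u}} (g : T ⟶ T') {W : T'.Opens} {V : T.Opens} (h : V ≤ g ⁻¹ᵁ W) :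
    Γ(T', W) →+* Γ(T, V) :=
  (g.appLE W V h).hom

theorem mem_of_le_preimage {T T' : Scheme.{u}} {g : T ⟶ T'} {W : T'.Opens} {V : T.Opens}
    (h : V ≤ g ⁻¹ᵁ W) {t : T} (ht : t ∈ V) : g t ∈ W := h ht

theorem ogerm_opull {T T' : Scheme.{u}} (g : T ⟶ T') {W : T'.Opens} {V : T.Opens}
    (h : V ≤ g ⁻¹ᵁ W) (t : T) (ht : t ∈ V) (c : Γ(T', W)) :
    ogerm V t ht (opull g h c) = (g.stalkMap t).hom (ogerm W (g t) (mem_of_le_preimage h ht) c) := by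
  have h1 : opull g h c = ores h ((g.app W).hom c) := rfl
  rw [h1, ogerm_ores]
  exact (Scheme.Hom.germ_stalkMap_apply g W t (h ht) c).symm

theorem opull_ores {T T' : Scheme.{u}} (g : T ⟶ T') {W W' : T'.Opens} {V : T.Opens}
    (h : V ≤ g ⁻¹ᵁ W) (hW : W ≤ W') (h' : V ≤ g ⁻¹ᵁ W') (c : Γ(T', W')) :
    opull g h (ores hW c) = opull g h' c := by
  refine ogerm_ext _ _ fun t ht => ?_
  rw [ogerm_opull, ogerm_opull, ogerm_ores]

theorem ores_opull {T T' : Scheme.{u}} (g : T ⟶ T') {W : T'.Opens} {V V' : T.Opens}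
    (h : V ≤ g ⁻¹ᵁ W) (hV : V' ≤ V) (c : Γ(T', W)) :
    ores hV (opull g h c) = opull g (hV.trans h) c := by
  refine ogerm_ext _ _ fun t ht => ?_
  rw [ogerm_opull, ogerm_ores, ogerm_opull]

namespace AlgebraSheaf

section Basic

variable {X : Scheme.{u}} (A : AlgebraSheaf X)

/-- The ring of sections `𝒜(U)`. -/
def Sec (U : X.Opens) : Type u := A.sheaf.presheaf.obj (op U)

instance (U : X.Opens) : CommRing (A.Sec U) :=
  inferInstanceAs (CommRing (A.sheaf.presheaf.obj (op U)))

instance (U : X.Opens) : Algebra Γ(X, U) (A.Sec U) :=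
  (A.str.app (op U)).hom.toAlgebra

/-- Restriction of sections along `V ≤ U`. -/
def res {U V : X.Opens} (h : V ≤ U) : A.Sec U →+* A.Sec V :=
  (A.sheaf.presheaf.map (homOfLE h).op).hom

/-- The stalk `𝒜_x`. -/
def Stalk (x : X) : Type u := A.sheaf.presheaf.stalk x

instance (x : X) : CommRing (A.Stalk x) :=
  inferInstanceAs (CommRing (A.sheaf.presheaf.stalk x))

instance (x : X) : Algebra (X.presheaf.stalk x) (A.Stalk x) :=
  ((TopCat.Presheaf.stalkFunctor CommRingCat.{u} x).map A.str).hom.toAlgebra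

/-- The germ at `x` of a section of `𝒜`. -/
def germ (U : X.Opens) (x : X) (hx : x ∈ U) : A.Sec U →+* A.Stalk x :=
  (A.sheaf.presheaf.germ U x hx).hom

theorem res_res {U V W : X.Opens} (h : V ≤ U) (h' : W ≤ V) (s : A.Sec U) :
    A.res h' (A.res h s) = A.res (h'.trans h) s := by
  change ((A.sheaf.presheaf.map _) ≫ (A.sheaf.presheaf.map _)).hom s = _
  rw [← Functor.map_comp]
  rfl

theorem res_self {U : X.Opens} (h : U ≤ U) (s : A.Sec U) : A.res h s = s := by
  have : (homOfLE h).op = 𝟙 (op U) := rfl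
  change (A.sheaf.presheaf.map _).hom s = s
  rw [this, CategoryTheory.Functor.map_id]
  rfl

theorem res_algebraMap {U V : X.Opens} (h : V ≤ U) (c : Γ(X, U)) :
    A.res h (algebraMap _ _ c) = algebraMap _ _ (ores h c) := by
  have := A.str.naturality (homOfLE h).op
  exact (congrArg (fun φ => φ.hom c) this).symm

theorem res_smul {U V : X.Opens} (h : V ≤ U) (c : Γ(X, U)) (s : A.Sec U) :
    A.res h (c • s) = ores h c • A.res h s := by
  rw [Algebra.smul_def, map_mul, res_algebraMap, ← Algebra.smul_def]

theorem germ_res {U V : X.Opens} (h : V ≤ U) (x : X) (hx : x ∈ V) (s : A.Sec U) :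
    A.germ V x hx (A.res h s) = A.germ U x (h hx) s :=
  TopCat.Presheaf.germ_res_apply A.sheaf.presheaf (homOfLE h) x hx s

theorem germ_smul {U : X.Opens} (x : X) (hx : x ∈ U) (c : Γ(X, U)) (s : A.Sec U) :
    A.germ U x hx (c • s) = ogerm U x hx c • A.germ U x hx s := by
  rw [Algebra.smul_def, map_mul, Algebra.smul_def]
  congr 1
  exact (TopCat.Presheaf.stalkFunctor_map_germ_apply (C := CommRingCat.{u}) U x hx A.str c).symm

theorem exists_germ_eq (x : X) (a : A.Stalk x) :
    ∃ (U : X.Opens) (hx : x ∈ U) (s : A.Sec U), A.germ U x hx s = a := by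
  obtain ⟨U, hx, s, hs⟩ := TopCat.Presheaf.exists_germ_eq A.sheaf.presheaf a
  exact ⟨U, hx, s, hs⟩

theorem exists_res_eq_of_germ_eq {U : X.Opens} (x : X) (hx : x ∈ U) (s s' : A.Sec U)
    (h : A.germ U x hx s = A.germ U x hx s') :
    ∃ (V : X.Opens) (hV : V ≤ U), x ∈ V ∧ A.res hV s = A.res hV s' := by
  obtain ⟨W, hW, i, i', h⟩ := TopCat.Presheaf.germ_eq A.sheaf.presheaf x hx hx s s' h
  exact ⟨W, i.le, hW, h⟩

/-- The sections `e 1, …, e n` of `𝒜` over `U` form a basis of `𝒜|_U`, that is, they define an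
isomorphism `𝒪_U^n ≅ 𝒜|_U` of sheaves of modules. -/
def IsBasisOn {n : ℕ} {U : X.Opens} (e : Fin n → A.Sec U) : Prop :=
  ∀ (V : X.Opens) (h : V ≤ U),
    Function.Bijective (fun c : Fin n → Γ(X, V) => ∑ i, c i • A.res h (e i))

/-- `𝒜` is locally free of rank `n` as an `𝒪_X`-module. -/
def IsLocallyFree (n : ℕ) : Prop :=
  ∀ x : X, ∃ U : X.Opens, x ∈ U ∧ ∃ e : Fin n → A.Sec U, A.IsBasisOn e

variable {A} in
theorem IsBasisOn.res {n : ℕ} {U : X.Opens} {e : Fin n → A.Sec U} (he : A.IsBasisOn e)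
    {V : X.Opens} (h : V ≤ U) : A.IsBasisOn (fun i => A.res h (e i)) := by
  intro W hW
  simp only [A.res_res]
  exact he W _

/-- A sheaf of `𝒪_X`-submodules of `𝒜`. -/
structure Submod where
  /-- the sections over `U` -/
  obj (U : X.Opens) : Submodule Γ(X, U) (A.Sec U)
  /-- stability under restriction -/
  res_mem {U V : X.Opens} (h : V ≤ U) {s : A.Sec U} : s ∈ obj U → A.res h s ∈ obj V
  /-- the sheaf condition -/
  of_locally {U : X.Opens} (s : A.Sec U) :
    (∀ x ∈ U, ∃ (V : X.Opens) (h : V ≤ U), x ∈ V ∧ A.res h s ∈ obj V) → s ∈ obj U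

variable {A}

theorem Submod.ext' {B B' : A.Submod} (h : ∀ U, B.obj U = B'.obj U) : B = B' := by
  cases B; cases B'
  congr
  exact funext h

/-- `ℬ` contains the unit section of `𝒜`. -/
def Submod.ContainsOne (B : A.Submod) : Prop := ∀ U : X.Opens, (1 : A.Sec U) ∈ B.obj U

/-- `ℬ` is closed under the multiplication of `𝒜`. -/
def Submod.MulClosed (B : A.Submod) : Prop :=
  ∀ (U : X.Opens) (s t : A.Sec U), s ∈ B.obj U → t ∈ B.obj U → s * t ∈ B.obj U

/-- `ℬ` is a sheaf of `𝒪_X`-subalgebras of `𝒜`. -/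
def Submod.IsSubalgebra (B : A.Submod) : Prop := B.ContainsOne ∧ B.MulClosed

/-- `ℬ` is quasi-coherent: every point has an affine open neighbourhood `U` on which `ℬ` is the
sheaf associated with the module `ℬ(U)`, that is, for every `g ∈ 𝒪(U)` the restriction
`ℬ(U) → ℬ(D(g))` is the localization at the powers of `g`. -/
def Submod.IsQuasicoherent (B : A.Submod) : Prop :=
  ∀ x : X, ∃ U : X.Opens, x ∈ U ∧ IsAffineOpen U ∧ ∀ g : Γ(X, U),
    (∀ s ∈ B.obj U, A.res (X.basicOpen_le g) s = 0 → ∃ k : ℕ, g ^ k • s = 0) ∧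
    (∀ s ∈ B.obj (X.basicOpen g), ∃ k : ℕ, ∃ s' ∈ B.obj U,
      A.res (X.basicOpen_le g) s' = ores (X.basicOpen_le g) g ^ k • s)

/-- The quotient sheaf `𝒜/ℬ` is locally free of rank `r`: locally there are sections
`e 1, …, e r` of `𝒜` over some `U` whose classes form a basis of `𝒜(V)/ℬ(V)` for every open
`V ≤ U`. (If `𝒜/ℬ` is free over a neighbourhood of `x`, then after shrinking it a basis lifts to
`𝒜`, and then the presheaf `V ↦ 𝒜(V)/ℬ(V)` is free and coincides with the sheaf `𝒜/ℬ` there.) -/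
def Submod.QuotientLocallyFree (B : A.Submod) (r : ℕ) : Prop :=
  ∀ x : X, ∃ U : X.Opens, x ∈ U ∧ ∃ e : Fin r → A.Sec U, ∀ (V : X.Opens) (h : V ≤ U),
    Function.Bijective (fun c : Fin r → Γ(X, V) => (B.obj V).mkQ (∑ i, c i • A.res h (e i)))

end Basic

section PullbackStalk

variable {S T : Scheme.{u}} (A : AlgebraSheaf S) (f : T ⟶ S)

/-- The homomorphism `𝒪_{S,f(t)} → 𝒪_{T,t}` as an algebra structure. -/
abbrev stalkAlgebra {S T : Scheme.{u}} (f : T ⟶ S) (t : T) :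
    Algebra (S.presheaf.stalk (f t)) (T.presheaf.stalk t) :=
  (f.stalkMap t).hom.toAlgebra

attribute [local instance] stalkAlgebra

/-- The stalk `(f^*𝒜)_t = 𝒪_{T,t} ⊗_{𝒪_{S,f(t)}} 𝒜_{f(t)}`. -/
def PullbackStalk (t : T) : Type u :=
  T.presheaf.stalk t ⊗[S.presheaf.stalk (f t)] A.Stalk (f t)

instance (t : T) : CommRing (A.PullbackStalk f t) :=
  inferInstanceAs (CommRing (T.presheaf.stalk t ⊗[S.presheaf.stalk (f t)] A.Stalk (f t)))

instance (t : T) : Algebra (T.presheaf.stalk t) (A.PullbackStalk f t) :=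
  inferInstanceAs (Algebra (T.presheaf.stalk t)
    (T.presheaf.stalk t ⊗[S.presheaf.stalk (f t)] A.Stalk (f t)))

/-- The pure tensor `c ⊗ a` in `𝒪_{T,t} ⊗ 𝒜_{f(t)}`. -/
def tmul (t : T) (c : T.presheaf.stalk t) (a : A.Stalk (f t)) : A.PullbackStalk f t :=
  c ⊗ₜ[S.presheaf.stalk (f t)] a

theorem tmul_mul (t : T) (c c' : T.presheaf.stalk t) (a a' : A.Stalk (f t)) :
    A.tmul f t c a * A.tmul f t c' a' = A.tmul f t (c * c') (a * a') :=
  Algebra.TensorProduct.tmul_mul_tmul c c' a a'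

theorem smul_tmul (t : T) (c c' : T.presheaf.stalk t) (a : A.Stalk (f t)) :
    c • A.tmul f t c' a = A.tmul f t (c * c') a :=
  rfl

theorem tmul_one (t : T) (c : T.presheaf.stalk t) :
    A.tmul f t c 1 = algebraMap _ _ c :=
  rfl

theorem one_eq_tmul (t : T) : (1 : A.PullbackStalk f t) = A.tmul f t 1 1 := rfl

theorem tmul_add (t : T) (c : T.presheaf.stalk t) (a a' : A.Stalk (f t)) :
    A.tmul f t c (a + a') = A.tmul f t c a + A.tmul f t c a' :=
  TensorProduct.tmul_add c a a'

theorem neg_tmul (t : T) (c : T.presheaf.stalk t) (a : A.Stalk (f t)) :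
    A.tmul f t (-c) a = - A.tmul f t c a :=
  TensorProduct.neg_tmul c a

theorem tmul_sum (t : T) (c : T.presheaf.stalk t) {ι : Type} [Fintype ι] (a : ι → A.Stalk (f t)) :
    A.tmul f t c (∑ i, a i) = ∑ i, A.tmul f t c (a i) :=
  TensorProduct.tmul_sum c _ a

theorem tmul_smul (t : T) (c : T.presheaf.stalk t) (r : S.presheaf.stalk (f t))
    (a : A.Stalk (f t)) :
    A.tmul f t c (r • a) = A.tmul f t ((f.stalkMap t).hom r * c) a :=
  (TensorProduct.smul_tmul r c a).symm

/-- A family of elements of the stalks `(f^*𝒜)_t`, `t ∈ V`, is a section of `f^*𝒜` over `V` if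
locally it is given by a finite sum `∑ c_k ⊗ a_k` with `c_k` sections of `𝒪_T` and `a_k` sections
of `𝒜`. This is the sheafification of `W ↦ 𝒪_T(W) ⊗_{f⁻¹𝒪_S(W)} f⁻¹𝒜(W)`. -/
def IsPullbackSection (V : T.Opens) (s : ∀ t : V, A.PullbackStalk f t.1) : Prop :=
  ∀ t ∈ V, ∃ (W : T.Opens) (hW : W ≤ V) (U : S.Opens) (hU : W ≤ f ⁻¹ᵁ U), t ∈ W ∧
    ∃ (ι : Type) (_ : Fintype ι) (c : ι → Γ(T, W)) (a : ι → A.Sec U),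
      ∀ (t' : T) (h : t' ∈ W), s ⟨t', hW h⟩ =
        ∑ k, A.tmul f t' (ogerm W t' h (c k)) (A.germ U (f t') (mem_of_le_preimage hU h) (a k))

/-- `IsPullbackSection` as a local predicate. -/
def pullbackPredicate : TopCat.LocalPredicate (X := T) (fun t : T => A.PullbackStalk f t) where
  pred {V} s := A.IsPullbackSection f V s
  res := by
    intro V' V i s hs t ht
    obtain ⟨W, hW, U, hU, htW, ι, _, c, a, h⟩ := hs t (i.le ht)
    refine ⟨W ⊓ V', inf_le_right, U, inf_le_left.trans hU, ⟨htW, ht⟩, ι, inferInstance,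
      fun k => ores inf_le_left (c k), a, ?_⟩
    intro t' h'
    refine (h t' h'.1).trans ?_
    simp only [ogerm_ores]
  locality := by
    intro V s hs t ht
    obtain ⟨V', ht', i, h⟩ := hs ⟨t, ht⟩
    obtain ⟨W, hW, U, hU, htW, ι, _, c, a, h⟩ := h t ht'
    exact ⟨W, hW.trans i.le, U, hU, htW, ι, inferInstance, c, a, h⟩

theorem isPullbackSection_algebraMap (V : T.Opens) (c : Γ(T, V)) :
    A.IsPullbackSection f V (fun t => algebraMap _ _ (ogerm V t.1 t.2 c)) := by
  intro t ht
  refine ⟨V, le_rfl, ⊤, le_top, ht, Unit, inferInstance, fun _ => c, fun _ => 1, ?_⟩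
  intro t' h
  simp only [map_one, tmul_one, Finset.univ_unique, Finset.sum_const, Finset.card_singleton,
    one_smul]

/-- The sections of `f^*𝒜` over `V` form a ring. -/
def pullbackSubring (V : T.Opens) : Subring (∀ t : V, A.PullbackStalk f t.1) where
  carrier := {s | A.IsPullbackSection f V s}
  mul_mem' := by
    intro s s' hs hs' t ht
    obtain ⟨W, hW, U, hU, htW, ι, _, c, a, h⟩ := hs t ht
    obtain ⟨W', hW', U', hU', htW', ι', _, c', a', h'⟩ := hs' t ht
    refine ⟨W ⊓ W', inf_le_left.trans hW, U ⊓ U', fun x hx => ⟨hU hx.1, hU' hx.2⟩, ⟨htW, htW'⟩,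
      ι × ι', inferInstance,
      fun k => ores inf_le_left (c k.1) * ores inf_le_right (c' k.2),
      fun k => A.res inf_le_left (a k.1) * A.res inf_le_right (a' k.2), ?_⟩
    intro t' h''
    rw [Pi.mul_apply, h t' h''.1, h' t' h''.2, Finset.sum_mul_sum, Fintype.sum_prod_type]
    simp only [map_mul, ogerm_ores, germ_res, tmul_mul]
  one_mem' := by
    have := A.isPullbackSection_algebraMap f V 1
    simp only [map_one] at this
    exact this
  add_mem' := by
    intro s s' hs hs' t ht
    obtain ⟨W, hW, U, hU, htW, ι, _, c, a, h⟩ := hs t ht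
    obtain ⟨W', hW', U', hU', htW', ι', _, c', a', h'⟩ := hs' t ht
    refine ⟨W ⊓ W', inf_le_left.trans hW, U ⊓ U', fun x hx => ⟨hU hx.1, hU' hx.2⟩, ⟨htW, htW'⟩,
      ι ⊕ ι', inferInstance,
      Sum.elim (fun k => ores inf_le_left (c k)) (fun k => ores inf_le_right (c' k)),
      Sum.elim (fun k => A.res inf_le_left (a k)) (fun k => A.res inf_le_right (a' k)), ?_⟩
    intro t' h''
    rw [Pi.add_apply, h t' h''.1, h' t' h''.2, Fintype.sum_sum_type]
    simp only [Sum.elim_inl, Sum.elim_inr, ogerm_ores, germ_res]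
  zero_mem' := by
    have := A.isPullbackSection_algebraMap f V 0
    simp only [map_zero] at this
    exact this
  neg_mem' := by
    intro s hs t ht
    obtain ⟨W, hW, U, hU, htW, ι, _, c, a, h⟩ := hs t ht
    refine ⟨W, hW, U, hU, htW, ι, inferInstance, fun k => - c k, a, ?_⟩
    intro t' h'
    rw [Pi.neg_apply, h t' h']
    simp only [map_neg, neg_tmul, Finset.sum_neg_distrib]

/-- The presheaf of rings underlying `f^*𝒜`. -/
def pullbackPresheaf : TopCat.Presheaf CommRingCat.{u} T where
  obj V := .of (A.pullbackSubring f V.unop)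
  map i := CommRingCat.ofHom
    { toFun := fun s => ⟨fun t => s.1 ⟨t.1, i.unop.le t.2⟩,
        (A.pullbackPredicate f).res i.unop s.1 s.2⟩
      map_one' := rfl
      map_mul' := fun _ _ => rfl
      map_zero' := rfl
      map_add' := fun _ _ => rfl }

theorem pullbackPresheaf_isSheaf : (A.pullbackPresheaf f).IsSheaf := by
  rw [TopCat.Presheaf.isSheaf_iff_isSheaf_comp (forget CommRingCat)]
  exact TopCat.subpresheafToTypes.isSheaf (A.pullbackPredicate f)

/-- The inverse image `f^*𝒜 = 𝒪_T ⊗_{f⁻¹𝒪_S} f⁻¹𝒜`, a sheaf of `𝒪_T`-algebras. -/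
def pullback : AlgebraSheaf T where
  sheaf := ⟨A.pullbackPresheaf f, A.pullbackPresheaf_isSheaf f⟩
  str :=
    { app V := CommRingCat.ofHom
        { toFun := fun c => ⟨fun t => algebraMap _ _ (ogerm V.unop t.1 t.2 c),
            A.isPullbackSection_algebraMap f V.unop c⟩
          map_one' := Subtype.ext <| funext fun t => by simp only [map_one]; rfl
          map_mul' := fun _ _ => Subtype.ext <| funext fun t => by simp only [map_mul]; rfl
          map_zero' := Subtype.ext <| funext fun t => by simp only [map_zero]; rfl
          map_add' := fun _ _ => Subtype.ext <| funext fun t => by simp only [map_add]; rfl }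
      naturality := by
        intro V V' i
        ext c
        refine Subtype.ext <| funext fun t => ?_
        exact congrArg (algebraMap (T.presheaf.stalk t.1) (A.PullbackStalk f t.1))
          (ogerm_ores i.unop.le t.1 t.2 c) }

variable {A f}

/-- The value at `t` of a section of `f^*𝒜`, in the stalk `𝒪_{T,t} ⊗ 𝒜_{f(t)}`. -/
def val {V : T.Opens} (t : T) (ht : t ∈ V) : (A.pullback f).Sec V →+* A.PullbackStalk f t :=
  (Pi.evalRingHom (fun t : V => A.PullbackStalk f t.1) ⟨t, ht⟩).comp (A.pullbackSubring f V).subtype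

theorem val_ext {V : T.Opens} {s s' : (A.pullback f).Sec V}
    (h : ∀ t (ht : t ∈ V), val t ht s = val t ht s') : s = s' :=
  Subtype.ext <| funext fun t => h t.1 t.2

theorem val_res {V V' : T.Opens} (h : V' ≤ V) (s : (A.pullback f).Sec V) (t : T) (ht : t ∈ V') :
    val t ht ((A.pullback f).res h s) = val t (h ht) s := rfl

theorem val_smul {V : T.Opens} (t : T) (ht : t ∈ V) (c : Γ(T, V)) (s : (A.pullback f).Sec V) :
    val t ht (c • s) = ogerm V t ht c • val t ht s := by
  rw [Algebra.smul_def, map_mul, Algebra.smul_def]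
  rfl

theorem exists_val {V : T.Opens} (s : (A.pullback f).Sec V) (t : T) (ht : t ∈ V) :
    ∃ (W : T.Opens) (hW : W ≤ V) (U : S.Opens) (hU : W ≤ f ⁻¹ᵁ U), t ∈ W ∧
    ∃ (ι : Type) (_ : Fintype ι) (c : ι → Γ(T, W)) (a : ι → A.Sec U),
      ∀ (t' : T) (h : t' ∈ W), val t' (hW h) s =
        ∑ k, A.tmul f t' (ogerm W t' h (c k)) (A.germ U (f t') (mem_of_le_preimage hU h) (a k)) :=
  s.2 t ht

variable (A f)

/-- The section `1 ⊗ a` of `f^*𝒜` over `V ≤ f⁻¹ U` defined by a section `a` of `𝒜` over `U`. -/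
def pullSec {U : S.Opens} {V : T.Opens} (h : V ≤ f ⁻¹ᵁ U) (a : A.Sec U) : (A.pullback f).Sec V :=
  ⟨fun t => A.tmul f t.1 1 (A.germ U (f t.1) (mem_of_le_preimage h t.2) a), by
    intro t ht
    refine ⟨V, le_rfl, U, h, ht, Unit, inferInstance, fun _ => 1, fun _ => a, ?_⟩
    intro t' h
    simp only [map_one, Finset.univ_unique, Finset.sum_const, Finset.card_singleton, one_smul]⟩

theorem val_pullSec {U : S.Opens} {V : T.Opens} (h : V ≤ f ⁻¹ᵁ U) (a : A.Sec U) (t : T)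
    (ht : t ∈ V) : val t ht (A.pullSec f h a) = A.tmul f t 1 (A.germ U (f t) (mem_of_le_preimage h ht) a) := rfl

/-- A basis of `𝒜` over `U` gives bases of the stalks. -/
theorem stalk_bijective {n : ℕ} {U : S.Opens} {e : Fin n → A.Sec U} (he : A.IsBasisOn e)
    (x : S) (hx : x ∈ U) :
    Function.Bijective
      (fun c : Fin n → S.presheaf.stalk x => ∑ i, c i • A.germ U x hx (e i)) := by
  constructor
  · intro c c' hcc
    choose V hV s hs using fun i => exists_ogerm_eq x (c i)
    choose V' hV' s' hs' using fun i => exists_ogerm_eq x (c' i)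
    let W : S.Opens := U ⊓ ((Finset.univ.inf V) ⊓ (Finset.univ.inf V'))
    have hW : ∀ i, W ≤ V i := fun i =>
      inf_le_right.trans (inf_le_left.trans (Finset.inf_le (Finset.mem_univ i)))
    have hW' : ∀ i, W ≤ V' i := fun i =>
      inf_le_right.trans (inf_le_right.trans (Finset.inf_le (Finset.mem_univ i)))
    have hWU : W ≤ U := inf_le_left
    have mem_inf : ∀ F : Fin n → S.Opens, (∀ i, x ∈ F i) → x ∈ Finset.univ.inf F := by
      intro F hF
      rw [← SetLike.mem_coe, TopologicalSpace.Opens.coe_finset_inf]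
      simpa using hF
    have hxW : x ∈ W := ⟨hx, mem_inf V hV, mem_inf V' hV'⟩
    have key : A.germ W x hxW (∑ i, ores (hW i) (s i) • A.res hWU (e i)) =
        A.germ W x hxW (∑ i, ores (hW' i) (s' i) • A.res hWU (e i)) := by
      simp only [map_sum, germ_smul, germ_res, ogerm_ores, hs, hs']
      exact hcc
    obtain ⟨W', hW'W, hxW', h⟩ := A.exists_res_eq_of_germ_eq x hxW _ _ key
    simp only [map_sum, res_smul, res_res, ores_ores] at h
    have := (he W' (hW'W.trans hWU)).1 h
    funext i
    have hi := congrFun this i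
    rw [← hs i, ← hs' i, ← ogerm_ores (hW'W.trans (hW i)) x hxW' (s i),
      ← ogerm_ores (hW'W.trans (hW' i)) x hxW' (s' i)]
    exact congrArg _ hi
  · intro a
    obtain ⟨V, hxV, s, rfl⟩ := A.exists_germ_eq x a
    obtain ⟨c, hc⟩ := (he (V ⊓ U) inf_le_right).2 (A.res inf_le_left s)
    have hxi : x ∈ V ⊓ U := ⟨hxV, hx⟩
    refine ⟨fun i => ogerm (V ⊓ U) x hxi (c i), ?_⟩
    have := congrArg (A.germ (V ⊓ U) x hxi) hc
    simpa only [map_sum, germ_smul, germ_res] using this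

theorem pullbackStalk_bijective {n : ℕ} {U : S.Opens} {e : Fin n → A.Sec U} (he : A.IsBasisOn e)
    (t : T) (ht : f t ∈ U) :
    Function.Bijective (fun c : Fin n → T.presheaf.stalk t =>
      ∑ i, c i • A.tmul f t 1 (A.germ U (f t) ht (e i))) := by
  have hb := A.stalk_bijective he (f t) ht
  have hli : LinearIndependent (S.presheaf.stalk (f t)) (fun i => A.germ U (f t) ht (e i)) := by
    rw [Fintype.linearIndependent_iff]
    intro c hc i
    have : c = 0 := hb.1 (by simpa using hc)
    rw [this]; rfl
  let b : Module.Basis (Fin n) (S.presheaf.stalk (f t)) (A.Stalk (f t)) := Module.Basis.mk hli (by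
    intro a _
    obtain ⟨c, rfl⟩ := hb.2 a
    exact Submodule.sum_mem _ fun i _ =>
      Submodule.smul_mem _ _ (Submodule.subset_span (Set.mem_range_self i)))
  let b' := Algebra.TensorProduct.basis (T.presheaf.stalk t) b
  have hb' : ∀ i, b' i = A.tmul f t 1 (A.germ U (f t) ht (e i)) := by
    intro i
    rw [Algebra.TensorProduct.basis_apply, Module.Basis.mk_apply]
    rfl
  have hfun : (fun c : Fin n → T.presheaf.stalk t =>
      ∑ i, c i • A.tmul f t 1 (A.germ U (f t) ht (e i))) = b'.equivFun.symm := by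
    funext c
    refine Eq.trans ?_ (b'.equivFun_symm_apply c).symm
    exact Finset.sum_congr rfl fun i _ =>
      congrArg (fun z : A.PullbackStalk f t => c i • z) (hb' i).symm
  rw [hfun]
  exact b'.equivFun.symm.bijective

/-- The pullback of a basis is a basis. -/
theorem isBasisOn_pullSec {n : ℕ} {U : S.Opens} {e : Fin n → A.Sec U} (he : A.IsBasisOn e)
    {V : T.Opens} (hV : V ≤ f ⁻¹ᵁ U) :
    (A.pullback f).IsBasisOn (fun i => A.pullSec f hV (e i)) := by
  intro W hW
  have hval : ∀ (W : T.Opens) (hW : W ≤ V) (c : Fin n → Γ(T, W)) t (ht : t ∈ W),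
      val t ht (∑ i, c i • (A.pullback f).res hW (A.pullSec f hV (e i))) =
      ∑ i, ogerm W t ht (c i) • A.tmul f t 1 (A.germ U (f t) (mem_of_le_preimage hV (hW ht)) (e i)) := by
    intro W hW c t ht
    simp only [map_sum, val_smul, val_res, val_pullSec]
  constructor
  · intro c c' h
    funext i
    refine ogerm_ext _ _ fun t ht => ?_
    have h1 := congrArg (val t ht) h
    simp only [hval] at h1
    exact congrFun ((A.pullbackStalk_bijective f he t (mem_of_le_preimage hV (hW ht))).1 h1) i
  · intro s
    have hst : ∀ t (ht : t ∈ W), ∃ γ : Fin n → T.presheaf.stalk t,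
        ∑ i, γ i • A.tmul f t 1 (A.germ U (f t) (mem_of_le_preimage hV (hW ht)) (e i)) = val t ht s :=
      fun t ht => (A.pullbackStalk_bijective f he t (mem_of_le_preimage hV (hW ht))).2 (val t ht s)
    choose γ hγ using hst
    have hloc : ∀ i, ∃ c : Γ(T, W), ∀ t (ht : t ∈ W), ogerm W t ht c = γ t ht i := by
      intro i
      refine exists_of_local_germs W (fun t ht => γ t ht i) fun t ht => ?_
      obtain ⟨W', hW', U', hU', htW', ι, _, c, a, h⟩ := exists_val s t ht
      have ha : ∀ k, ∃ d : Fin n → Γ(S, U' ⊓ U), ∑ j, d j • A.res inf_le_right (e j) =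
          A.res inf_le_left (a k) := fun k => (he (U' ⊓ U) inf_le_right).2 _
      choose d hd using ha
      have hle : W' ≤ f ⁻¹ᵁ (U' ⊓ U) := fun y hy => ⟨hU' hy, hV (hW (hW' hy))⟩
      have hsum : ∀ t' (h' : t' ∈ W'), (fun j => ogerm W' t' h'
          (∑ k, c k * opull f hle (d k j))) = γ t' (hW' h') := by
        intro t' h'
        refine (A.pullbackStalk_bijective f he t' (mem_of_le_preimage hV (hW (hW' h')))).1 ?_
        dsimp only
        rw [hγ, h t' h']
        simp only [map_sum, map_mul, ogerm_opull, Finset.sum_smul]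
        rw [Finset.sum_comm]
        refine Finset.sum_congr rfl fun k _ => ?_
        rw [← A.germ_res (inf_le_left : U' ⊓ U ≤ U') (f t') (mem_of_le_preimage hle h') (a k), ← hd k]
        simp only [map_sum, germ_smul, germ_res, tmul_sum, tmul_smul, smul_tmul]
        exact Finset.sum_congr rfl fun j _ => by rw [mul_one, mul_comm]
      exact ⟨W', hW', htW', ∑ k, c k * opull f hle (d k i),
        fun y hy => congrFun (hsum y hy) i⟩
    choose c hc using hloc
    refine ⟨c, val_ext fun t ht => ?_⟩
    dsimp only
    rw [hval, ← hγ t ht]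
    simp only [hc]

end PullbackStalk

section Compare

variable {S T T' T'' : Scheme.{u}} (A : AlgebraSheaf S)

attribute [local instance] stalkAlgebra

/-- The identification of stalks `𝒜_y = 𝒜_x` for equal points `x = y` of `S`. -/
def stalkEq {x y : S} (h : x = y) : A.Stalk y →+* A.Stalk x :=
  (A.sheaf.presheaf.stalkSpecializes (specializes_of_eq h)).hom

theorem stalkEq_germ {x y : S} (h : x = y) (U : S.Opens) (hx : x ∈ U) (hy : y ∈ U) (a : A.Sec U) :
    A.stalkEq h (A.germ U y hy a) = A.germ U x hx a := by
  exact TopCat.Presheaf.germ_stalkSpecializes_apply A.sheaf.presheaf hy (specializes_of_eq h) a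

theorem comp_point {f : T ⟶ S} {f' : T' ⟶ S} (g : T ⟶ T') (h : g ≫ f' = f) (t : T) :
    f t = f' (g t) := by
  subst h
  rfl

variable {f : T ⟶ S} {f' : T' ⟶ S} (g : T ⟶ T') (h : g ≫ f' = f)

/-- For a morphism `g : T ⟶ T'` over `S`, the canonical homomorphism
`(f'^*𝒜)_{g(t)} = 𝒪_{T',g(t)} ⊗ 𝒜_{f'(g(t))} → 𝒪_{T,t} ⊗ 𝒜_{f(t)} = (f^*𝒜)_t`. -/
def stalkCompare (t : T) : A.PullbackStalk f' (g t) →+* A.PullbackStalk f t :=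
  Algebra.TensorProduct.mapRingHom
    (S.presheaf.stalkSpecializes (specializes_of_eq (comp_point g h t))).hom
    (g.stalkMap t).hom (A.stalkEq (comp_point g h t))
    (by
      subst h
      ext x
      change (g.stalkMap t).hom ((f'.stalkMap (g t)).hom x) =
        ((g ≫ f').stalkMap t).hom ((S.presheaf.stalkSpecializes _).hom x)
      rw [Scheme.Hom.stalkMap_comp]
      have : S.presheaf.stalkSpecializes (specializes_of_eq (comp_point g rfl t)) =
        𝟙 (S.presheaf.stalk (f' (g t))) := TopCat.Presheaf.stalkSpecializes_refl _ _
      exact congrArg (fun φ : S.presheaf.stalk (f' (g t)) ⟶ S.presheaf.stalk (f' (g t)) =>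
        (g.stalkMap t).hom ((f'.stalkMap (g t)).hom (φ.hom x))) this.symm)
    (by
      ext x
      have := TopCat.Presheaf.stalkSpecializes_stalkFunctor_map (C := CommRingCat.{u}) A.str
        (specializes_of_eq (comp_point g h t))
      exact (congrArg (fun φ => φ.hom x) this).symm)

theorem stalkCompare_tmul (t : T) (c : T'.presheaf.stalk (g t)) (a : A.Stalk (f' (g t))) :
    A.stalkCompare g h t (A.tmul f' (g t) c a) =
      A.tmul f t ((g.stalkMap t).hom c) (A.stalkEq (comp_point g h t) a) :=
  Algebra.TensorProduct.mapRingHom_tmul ..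

theorem stalkCompare_smul (t : T) (c : T'.presheaf.stalk (g t)) (x : A.PullbackStalk f' (g t)) :
    A.stalkCompare g h t (c • x) = (g.stalkMap t).hom c • A.stalkCompare g h t x := by
  rw [Algebra.smul_def, map_mul, Algebra.smul_def, ← tmul_one, stalkCompare_tmul, map_one,
    ← tmul_one]

/-- For a morphism `g : T ⟶ T'` over `S`, the canonical homomorphism `f'^*𝒜 → g_* f^*𝒜`
on sections. -/
def compare {W : T'.Opens} {V : T.Opens} (hV : V ≤ g ⁻¹ᵁ W) :
    (A.pullback f').Sec W →+* (A.pullback f).Sec V where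
  toFun s := ⟨fun t => A.stalkCompare g h t.1 (val (g t.1) (mem_of_le_preimage hV t.2) s), by
    intro t ht
    obtain ⟨W', hW', U, hU, htW', ι, _, c, a, hs⟩ := exists_val s (g t) (mem_of_le_preimage hV ht)
    have hle : V ⊓ g ⁻¹ᵁ W' ≤ g ⁻¹ᵁ W' := inf_le_right
    refine ⟨V ⊓ g ⁻¹ᵁ W', inf_le_left, U, ?_, ⟨ht, htW'⟩, ι, inferInstance,
      fun k => opull g hle (c k), a, ?_⟩
    · intro y hy
      have := mem_of_le_preimage hU (mem_of_le_preimage hle hy)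
      rw [← comp_point g h y] at this
      exact this
    · intro t' ht'
      have h1 := hs (g t') (mem_of_le_preimage hle ht')
      refine (congrArg (A.stalkCompare g h t') h1).trans ?_
      rw [map_sum]
      refine Finset.sum_congr rfl fun k _ => ?_
      rw [stalkCompare_tmul, ogerm_opull, stalkEq_germ]⟩
  map_one' := val_ext fun t ht => map_one (A.stalkCompare g h t)
  map_mul' _ _ := val_ext fun t ht => map_mul (A.stalkCompare g h t) _ _
  map_zero' := val_ext fun t ht => map_zero (A.stalkCompare g h t)
  map_add' _ _ := val_ext fun t ht => map_add (A.stalkCompare g h t) _ _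

theorem val_compare {W : T'.Opens} {V : T.Opens} (hV : V ≤ g ⁻¹ᵁ W) (s : (A.pullback f').Sec W)
    (t : T) (ht : t ∈ V) : val t ht (A.compare g h hV s) =
      A.stalkCompare g h t (val (g t) (mem_of_le_preimage hV ht) s) := rfl

theorem compare_smul {W : T'.Opens} {V : T.Opens} (hV : V ≤ g ⁻¹ᵁ W) (c : Γ(T', W))
    (s : (A.pullback f').Sec W) :
    A.compare g h hV (c • s) = opull g hV c • A.compare g h hV s := by
  refine val_ext fun t ht => ?_
  rw [val_compare, val_smul, val_smul, stalkCompare_smul, ogerm_opull, val_compare]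

theorem compare_pullSec {U : S.Opens} {W : T'.Opens} {V : T.Opens} (hV : V ≤ g ⁻¹ᵁ W)
    (hW : W ≤ f' ⁻¹ᵁ U) (hU : V ≤ f ⁻¹ᵁ U) (a : A.Sec U) :
    A.compare g h hV (A.pullSec f' hW a) = A.pullSec f hU a := by
  refine val_ext fun t ht => ?_
  rw [val_compare, val_pullSec, val_pullSec, stalkCompare_tmul, map_one, stalkEq_germ]

theorem res_compare {W : T'.Opens} {V V' : T.Opens} (hV : V ≤ g ⁻¹ᵁ W) (hV' : V' ≤ V)
    (s : (A.pullback f').Sec W) :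
    (A.pullback f).res hV' (A.compare g h hV s) = A.compare g h (hV'.trans hV) s :=
  rfl

theorem compare_res {W W' : T'.Opens} {V : T.Opens} (hV : V ≤ g ⁻¹ᵁ W') (hW : W' ≤ W)
    (hV' : V ≤ g ⁻¹ᵁ W) (s : (A.pullback f').Sec W) :
    A.compare g h hV ((A.pullback f').res hW s) = A.compare g h hV' s :=
  rfl

/-- Every element of `(f^*𝒜)_t` is a sum of pure tensors. -/
theorem tmul_induction {f : T ⟶ S} {t : T} {P : A.PullbackStalk f t → Prop}
    (x : A.PullbackStalk f t) (zero : P 0) (tmul : ∀ c a, P (A.tmul f t c a))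
    (add : ∀ x y, P x → P y → P (x + y)) : P x :=
  TensorProduct.induction_on x zero tmul add

theorem stalkEq_self {x : S} (h : x = x) (a : A.Stalk x) : A.stalkEq h a = a := by
  have := TopCat.Presheaf.stalkSpecializes_refl A.sheaf.presheaf x
  exact congrArg (fun φ => φ.hom a) this

theorem stalkEq_stalkEq {x y z : S} (h : x = y) (h' : y = z) (a : A.Stalk z) :
    A.stalkEq h (A.stalkEq h' a) = A.stalkEq (h.trans h') a := by
  subst h'
  rw [stalkEq_self]

theorem compare_id {f : T ⟶ S} (h : 𝟙 T ≫ f = f) {V W : T.Opens} (hV : V ≤ (𝟙 T) ⁻¹ᵁ W)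
    (hVW : V ≤ W) (s : (A.pullback f).Sec W) :
    A.compare (𝟙 T) h hV s = (A.pullback f).res hVW s := by
  refine val_ext fun t ht => ?_
  rw [val_compare, val_res]
  have key : ∀ x : A.PullbackStalk f t, A.stalkCompare (𝟙 T) h t x = x := by
    intro x
    refine A.tmul_induction (P := fun x => A.stalkCompare (𝟙 T) h t x = x) x (map_zero _) ?_ ?_
    · intro c a
      refine (A.stalkCompare_tmul (𝟙 T) h t c a).trans ?_
      rw [Scheme.Hom.stalkMap_id]
      exact congrArg (A.tmul f t c) (A.stalkEq_self _ a)
    · intro x y hx hy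
      exact (map_add (A.stalkCompare (𝟙 T) h t) x y).trans (congrArg₂ _ hx hy)
  exact key _

theorem compare_comp {f'' : T'' ⟶ S} (k : T' ⟶ T'') (h' : k ≫ f'' = f')
    (h'' : (g ≫ k) ≫ f'' = f) {W : T''.Opens} {V' : T'.Opens} {V : T.Opens}
    (hV' : V' ≤ k ⁻¹ᵁ W) (hV : V ≤ g ⁻¹ᵁ V') (hVW : V ≤ (g ≫ k) ⁻¹ᵁ W)
    (s : (A.pullback f'').Sec W) :
    A.compare g h hV (A.compare k h' hV' s) = A.compare (g ≫ k) h'' hVW s := by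
  refine val_ext fun t ht => ?_
  rw [val_compare, val_compare, val_compare]
  have key : ∀ x : A.PullbackStalk f'' (k (g t)),
      A.stalkCompare g h t (A.stalkCompare k h' (g t) x) = A.stalkCompare (g ≫ k) h'' t x := by
    intro x
    refine A.tmul_induction (P := fun x => A.stalkCompare g h t (A.stalkCompare k h' (g t) x) =
      A.stalkCompare (g ≫ k) h'' t x) x ?_ ?_ ?_
    · exact ((congrArg _ (map_zero _)).trans (map_zero _)).trans (map_zero _).symm
    · intro c a
      refine Eq.trans ?_ (A.stalkCompare_tmul (g ≫ k) h'' t c a).symm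
      rw [stalkCompare_tmul, stalkCompare_tmul, stalkEq_stalkEq, Scheme.Hom.stalkMap_comp]
      rfl
    · intro x y hx hy
      rw [map_add, map_add, hx, hy]
      exact (map_add (A.stalkCompare (g ≫ k) h'' t) x y).symm
  exact key _

variable {A}

/-- The `𝒪_T(V)`-submodule of `(f^*𝒜)(V)` generated by the images of the sections over `W` of a
submodule `ℬ ⊆ f'^*𝒜`. -/
def compareSpan (B : (A.pullback f').Submod) {W : T'.Opens} {V : T.Opens} (hV : V ≤ g ⁻¹ᵁ W) :
    Submodule Γ(T, V) ((A.pullback f).Sec V) :=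
  Submodule.span Γ(T, V) (A.compare g h hV '' (B.obj W : Set ((A.pullback f').Sec W)))

theorem res_mem_compareSpan (B : (A.pullback f').Submod) {W W' : T'.Opens} {V V' : T.Opens}
    (hV : V ≤ g ⁻¹ᵁ W) (hV' : V' ≤ g ⁻¹ᵁ W') (hVV : V' ≤ V) (hWW : W' ≤ W)
    {s : (A.pullback f).Sec V} (hs : s ∈ compareSpan g h B hV) :
    (A.pullback f).res hVV s ∈ compareSpan g h B hV' := by
  induction hs using Submodule.span_induction with
  | mem x hx =>
    obtain ⟨b, hb, rfl⟩ := hx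
    refine Submodule.subset_span ⟨(A.pullback f').res hWW b, B.res_mem hWW hb, ?_⟩
    rfl
  | zero => rw [map_zero]; exact Submodule.zero_mem _
  | add x y _ _ hx hy => rw [map_add]; exact Submodule.add_mem _ hx hy
  | smul c x _ hx => rw [res_smul]; exact Submodule.smul_mem _ _ hx

/-- The pullback `g^*ℬ ⊆ g^*f'^*𝒜 = f^*𝒜` of a submodule `ℬ ⊆ f'^*𝒜` along a morphism
`g : T ⟶ T'` over `S`: the image of the sheaf `g^*ℬ`, that is, the sections of `f^*𝒜` that are
locally `𝒪_T`-linear combinations of the images of sections of `ℬ`. (When `f'^*𝒜/ℬ` is flat,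
`g^*ℬ → g^*f'^*𝒜` is injective and this is `g^*ℬ` itself.) -/
def Submod.pullback (B : (A.pullback f').Submod) : (A.pullback f).Submod where
  obj V :=
    { carrier := {s | ∀ t ∈ V, ∃ (V' : T.Opens) (hV' : V' ≤ V) (W : T'.Opens)
        (hW : V' ≤ g ⁻¹ᵁ W), t ∈ V' ∧ (A.pullback f).res hV' s ∈ compareSpan g h B hW}
      add_mem' := by
        intro s s' hs hs' t ht
        obtain ⟨V1, hV1, W1, hW1, ht1, h1⟩ := hs t ht
        obtain ⟨V2, hV2, W2, hW2, ht2, h2⟩ := hs' t ht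
        have hle : V1 ⊓ V2 ≤ g ⁻¹ᵁ (W1 ⊓ W2) := fun y hy => ⟨hW1 hy.1, hW2 hy.2⟩
        refine ⟨V1 ⊓ V2, inf_le_left.trans hV1, W1 ⊓ W2, hle, ⟨ht1, ht2⟩, ?_⟩
        rw [map_add]
        have h1' := res_mem_compareSpan g h B hW1 hle inf_le_left inf_le_left h1
        have h2' := res_mem_compareSpan g h B hW2 hle inf_le_right inf_le_right h2
        rw [res_res] at h1' h2'
        exact Submodule.add_mem _ h1' h2'
      zero_mem' := by
        intro t ht
        refine ⟨V, le_rfl, ⊤, le_top, ht, ?_⟩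
        rw [map_zero]
        exact Submodule.zero_mem _
      smul_mem' := by
        intro c s hs t ht
        obtain ⟨V1, hV1, W1, hW1, ht1, h1⟩ := hs t ht
        refine ⟨V1, hV1, W1, hW1, ht1, ?_⟩
        rw [res_smul]
        exact Submodule.smul_mem _ _ h1 }
  res_mem := by
    intro U V hVU s hs t ht
    obtain ⟨V1, hV1, W1, hW1, ht1, h1⟩ := hs t (hVU ht)
    refine ⟨V1 ⊓ V, inf_le_right, W1, inf_le_left.trans hW1, ⟨ht1, ht⟩, ?_⟩
    have h1' := res_mem_compareSpan g h B hW1 (inf_le_left.trans hW1) (inf_le_left : V1 ⊓ V ≤ V1)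
      le_rfl h1
    rw [res_res] at h1' ⊢
    exact h1'
  of_locally := by
    intro U s hs t ht
    obtain ⟨V, hVU, htV, hV⟩ := hs t ht
    obtain ⟨V1, hV1, W1, hW1, ht1, h1⟩ := hV t htV
    refine ⟨V1, hV1.trans hVU, W1, hW1, ht1, ?_⟩
    rw [res_res] at h1
    exact h1

theorem compareSpan_le (B : (A.pullback f').Submod) {W : T'.Opens} {V : T.Opens}
    (hV : V ≤ g ⁻¹ᵁ W) : compareSpan g h B hV ≤ (B.pullback g h).obj V := by
  intro s hs t ht
  exact ⟨V, le_rfl, W, hV, ht, by rw [res_self]; exact hs⟩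

theorem compare_mem (B : (A.pullback f').Submod) {W : T'.Opens} {V : T.Opens}
    (hV : V ≤ g ⁻¹ᵁ W) {b : (A.pullback f').Sec W} (hb : b ∈ B.obj W) :
    A.compare g h hV b ∈ (B.pullback g h).obj V :=
  compareSpan_le g h B hV (Submodule.subset_span ⟨b, hb, rfl⟩)

/-- To show `g^*ℬ ⊆ ℬ'` it suffices to consider images of sections of `ℬ`. -/
theorem Submod.pullback_obj_le (B : (A.pullback f').Submod) (B' : (A.pullback f).Submod)
    (hB : ∀ (W : T'.Opens) (V : T.Opens) (hV : V ≤ g ⁻¹ᵁ W) (b : (A.pullback f').Sec W),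
      b ∈ B.obj W → A.compare g h hV b ∈ B'.obj V) (V : T.Opens) :
    (B.pullback g h).obj V ≤ B'.obj V := by
  intro s hs
  refine B'.of_locally s fun t ht => ?_
  obtain ⟨V1, hV1, W1, hW1, ht1, h1⟩ := hs t ht
  refine ⟨V1, hV1, ht1, ?_⟩
  refine Submodule.span_le.2 ?_ h1
  rintro _ ⟨b, hb, rfl⟩
  exact hB W1 V1 hW1 b hb

theorem Submod.pullback_id {f : T ⟶ S} (h : 𝟙 T ≫ f = f) (B : (A.pullback f).Submod) :
    B.pullback (𝟙 T) h = B := by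
  refine Submod.ext' fun V => le_antisymm (Submod.pullback_obj_le _ _ _ _ ?_ V) ?_
  · intro W V hV b hb
    rw [A.compare_id h hV hV]
    exact B.res_mem _ hb
  · intro s hs
    have hV : V ≤ (𝟙 T) ⁻¹ᵁ V := le_rfl
    have := compare_mem (𝟙 T) h B hV hs
    rwa [A.compare_id h hV le_rfl, res_self] at this

theorem Submod.pullback_comp {f'' : T'' ⟶ S} (k : T' ⟶ T'') (h' : k ≫ f'' = f')
    (h'' : (g ≫ k) ≫ f'' = f) (B : (A.pullback f'').Submod) :
    B.pullback (g ≫ k) h'' = (B.pullback k h').pullback g h := by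
  refine Submod.ext' fun V => le_antisymm (Submod.pullback_obj_le _ _ _ _ ?_ V)
    (Submod.pullback_obj_le _ _ _ _ ?_ V)
  · intro W V hV b hb
    have hV' : V ≤ g ⁻¹ᵁ (k ⁻¹ᵁ W) := hV
    rw [← A.compare_comp g h k h' h'' (le_refl (k ⁻¹ᵁ W)) hV' hV b]
    exact compare_mem g h _ _ (compare_mem k h' B _ hb)
  · intro W V hV b hb
    refine Submod.of_locally _ _ fun t ht => ?_
    obtain ⟨W1, hW1, U, hU, htW1, h1⟩ := hb (g t) (mem_of_le_preimage hV ht)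
    have hle : V ⊓ g ⁻¹ᵁ W1 ≤ g ⁻¹ᵁ W1 := inf_le_right
    refine ⟨V ⊓ g ⁻¹ᵁ W1, inf_le_left, ⟨ht, htW1⟩, ?_⟩
    rw [res_compare, ← A.compare_res g h hle hW1]
    generalize (A.pullback f').res hW1 b = x at h1
    induction h1 using Submodule.span_induction with
    | mem x hx =>
      obtain ⟨b, hb, rfl⟩ := hx
      have hVU : V ⊓ g ⁻¹ᵁ W1 ≤ (g ≫ k) ⁻¹ᵁ U := fun y hy => hU (hle hy)
      rw [A.compare_comp g h k h' h'' hU hle hVU]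
      exact compare_mem _ _ _ _ hb
    | zero => rw [map_zero]; exact Submodule.zero_mem _
    | add x y _ _ hx hy => rw [map_add]; exact Submodule.add_mem _ hx hy
    | smul c x _ hx => rw [compare_smul]; exact Submodule.smul_mem _ _ hx

theorem Submod.ContainsOne.pullback {B : (A.pullback f').Submod} (hB : B.ContainsOne) :
    (B.pullback g h).ContainsOne := by
  intro V
  have := compare_mem g h B (V := V) (W := ⊤) le_top (hB ⊤)
  rwa [map_one] at this

theorem Submod.MulClosed.pullback {B : (A.pullback f').Submod} (hB : B.MulClosed) :
    (B.pullback g h).MulClosed := by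
  intro V s s' hs hs' t ht
  obtain ⟨V1, hV1, W1, hW1, ht1, h1⟩ := hs t ht
  obtain ⟨V2, hV2, W2, hW2, ht2, h2⟩ := hs' t ht
  have hle : V1 ⊓ V2 ≤ g ⁻¹ᵁ (W1 ⊓ W2) := fun y hy => ⟨hW1 hy.1, hW2 hy.2⟩
  refine ⟨V1 ⊓ V2, inf_le_left.trans hV1, W1 ⊓ W2, hle, ⟨ht1, ht2⟩, ?_⟩
  have h1' := res_mem_compareSpan g h B hW1 hle inf_le_left inf_le_left h1
  have h2' := res_mem_compareSpan g h B hW2 hle inf_le_right inf_le_right h2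
  rw [res_res] at h1' h2'
  rw [map_mul]
  have h3 := Submodule.mul_mem_mul h1' h2'
  rw [compareSpan, Submodule.span_mul_span] at h3
  refine Submodule.span_mono ?_ h3
  rintro _ ⟨_, ⟨b, hb, rfl⟩, _, ⟨b', hb', rfl⟩, rfl⟩
  exact ⟨b * b', hB _ _ _ hb hb', map_mul _ _ _⟩

theorem Submod.IsSubalgebra.pullback {B : (A.pullback f').Submod} (hB : B.IsSubalgebra) :
    (B.pullback g h).IsSubalgebra :=
  ⟨hB.1.pullback g h, hB.2.pullback g h⟩

end Compare

section Local

open Matrix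

variable {X : Scheme.{u}} {A : AlgebraSheaf X}

/-- The linear combination `∑ y_j a_j|_V`. -/
def comb {n : ℕ} {U V : X.Opens} (h : V ≤ U) (a : Fin n → A.Sec U) (y : Fin n → Γ(X, V)) :
    A.Sec V :=
  ∑ j, y j • A.res h (a j)

theorem comb_add {n : ℕ} {U V : X.Opens} (h : V ≤ U) (a : Fin n → A.Sec U)
    (y y' : Fin n → Γ(X, V)) : comb h a (y + y') = comb h a y + comb h a y' := by
  simp [comb, add_smul, Finset.sum_add_distrib]

theorem comb_sub {n : ℕ} {U V : X.Opens} (h : V ≤ U) (a : Fin n → A.Sec U)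
    (y y' : Fin n → Γ(X, V)) : comb h a (y - y') = comb h a y - comb h a y' := by
  simp [comb, sub_smul, Finset.sum_sub_distrib]

theorem comb_smul {n : ℕ} {U V : X.Opens} (h : V ≤ U) (a : Fin n → A.Sec U) (c : Γ(X, V))
    (y : Fin n → Γ(X, V)) : comb h a (c • y) = c • comb h a y := by
  simp [comb, Finset.smul_sum, smul_smul]

theorem comb_zero {n : ℕ} {U V : X.Opens} (h : V ≤ U) (a : Fin n → A.Sec U) :
    comb h a (0 : Fin n → Γ(X, V)) = 0 := by
  simp [comb]

theorem res_comb {n : ℕ} {U V W : X.Opens} (h : V ≤ U) (h' : W ≤ V) (a : Fin n → A.Sec U)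
    (y : Fin n → Γ(X, V)) :
    A.res h' (comb h a y) = comb (h'.trans h) a (fun j => ores h' (y j)) := by
  simp only [comb, map_sum, res_smul, res_res]

/-- If `b_k = ∑_j M_{jk} a_j`, then `∑_k y_k b_k = ∑_j (M y)_j a_j`. -/
theorem comb_comb {m n : ℕ} {U V : X.Opens} (h : V ≤ U) (a : Fin n → A.Sec U)
    (b : Fin m → A.Sec U) (M : Matrix (Fin n) (Fin m) Γ(X, U))
    (hb : ∀ k, b k = comb le_rfl a (fun j => M j k)) (y : Fin m → Γ(X, V)) :
    comb h b y = comb h a ((M.map (ores h)) *ᵥ y) := by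
  have : ∀ k, A.res h (b k) = ∑ j, ores h (M j k) • A.res h (a j) := fun k => by
    rw [hb k, res_comb]; rfl
  simp only [comb, this, Finset.smul_sum, smul_smul, Matrix.mulVec, dotProduct, Finset.sum_smul,
    Matrix.map_apply]
  rw [Finset.sum_comm]
  exact Finset.sum_congr rfl fun j _ => Finset.sum_congr rfl fun k _ => by rw [mul_comm]

/-- In terms of the basis `a` of `𝒜|_U`, the submodule `ℬ|_U` is the kernel of the matrix `L`,
which has a right inverse `E`. -/
structure IsKernelOn {n r : ℕ} (B : A.Submod) {U : X.Opens} (a : Fin n → A.Sec U)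
    (L : Matrix (Fin r) (Fin n) Γ(X, U)) (E : Matrix (Fin n) (Fin r) Γ(X, U)) : Prop where
  mul_eq : L * E = 1
  mem_iff : ∀ (V : X.Opens) (h : V ≤ U) (y : Fin n → Γ(X, V)),
    comb h a y ∈ B.obj V ↔ (L.map (ores h)) *ᵥ y = 0

theorem exists_isKernelOn {n r : ℕ} {B : A.Submod} {U : X.Opens} {a : Fin n → A.Sec U}
    (ha : A.IsBasisOn a) {e : Fin r → A.Sec U}
    (he : ∀ (V : X.Opens) (h : V ≤ U),
      Function.Bijective (fun c : Fin r → Γ(X, V) => (B.obj V).mkQ (comb h e c))) :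
    ∃ (L : Matrix (Fin r) (Fin n) Γ(X, U)) (E : Matrix (Fin n) (Fin r) Γ(X, U)),
      IsKernelOn B a L E := by
  have h1 : ∀ i, ∃ y, comb le_rfl a y = e i := fun i => (ha U le_rfl).2 (e i)
  choose E' hE using h1
  have h2 : ∀ j, ∃ c, (B.obj U).mkQ (comb le_rfl e c) = (B.obj U).mkQ (a j) :=
    fun j => (he U le_rfl).2 ((B.obj U).mkQ (a j))
  choose L' hL using h2
  let E : Matrix (Fin n) (Fin r) Γ(X, U) := Matrix.of fun j i => E' i j
  let L : Matrix (Fin r) (Fin n) Γ(X, U) := Matrix.of fun i j => L' j i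
  have key : ∀ (V : X.Opens) (h : V ≤ U) (y : Fin n → Γ(X, V)),
      (B.obj V).mkQ (comb h a y) = (B.obj V).mkQ (comb h e ((L.map (ores h)) *ᵥ y)) := by
    intro V h y
    rw [← comb_comb h e (fun k => comb le_rfl e (fun i => L i k)) L (fun _ => rfl) y]
    simp only [comb, map_sum, map_smul]
    refine Finset.sum_congr rfl fun j _ => ?_
    congr 1
    have h3 : a j - comb le_rfl e (L' j) ∈ B.obj U := by
      rw [← Submodule.ker_mkQ (B.obj U), LinearMap.mem_ker, map_sub, hL j, sub_self]
    have h4 := B.res_mem h h3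
    rw [map_sub, ← Submodule.ker_mkQ (B.obj V), LinearMap.mem_ker, map_sub, sub_eq_zero] at h4
    rw [h4]
    simp only [comb, map_sum]
    rfl
  refine ⟨L, E, ?_, ?_⟩
  · ext i k
    have h5 := key U le_rfl (E' k)
    rw [hE k] at h5
    have hid : ∀ (M : Matrix (Fin r) (Fin n) Γ(X, U)), M.map (ores (le_refl U)) = M := by
      intro M; ext i j; exact ores_self _ _
    have h6 : comb le_rfl e (Pi.single k 1) = e k := by
      simp [comb, Pi.single_apply, res_self]
    rw [← h6, hid] at h5
    have h7 := (he U le_rfl).1 h5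
    have h8 := congrFun h7 i
    rw [Matrix.one_apply, Matrix.mul_apply]
    rw [Pi.single_apply] at h8
    exact h8.symm
  · intro V h y
    rw [← (B.obj V).ker_mkQ, LinearMap.mem_ker, key V h y]
    constructor
    · intro h0
      refine (he V h).1 ?_
      dsimp only
      rw [h0, comb_zero, map_zero]
    · intro h0
      rw [h0, comb_zero, map_zero]

theorem map_mul_map {n r : ℕ} {R R' : Type u} [CommRing R] [CommRing R'] (φ : R →+* R')
    {L : Matrix (Fin r) (Fin n) R} {E : Matrix (Fin n) (Fin r) R} (h : L * E = 1) :
    L.map φ * E.map φ = 1 := by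
  rw [← Matrix.map_mul, h]
  exact Matrix.map_one _ (map_zero φ) (map_one φ)

theorem IsKernelOn.res {n r : ℕ} {B : A.Submod} {U : X.Opens} {a : Fin n → A.Sec U}
    {L : Matrix (Fin r) (Fin n) Γ(X, U)} {E : Matrix (Fin n) (Fin r) Γ(X, U)}
    (hk : IsKernelOn B a L E) {V : X.Opens} (h : V ≤ U) :
    IsKernelOn B (fun j => A.res h (a j)) (L.map (ores h)) (E.map (ores h)) := by
  refine ⟨map_mul_map _ hk.mul_eq, ?_⟩
  intro W hW y
  have h1 : comb hW (fun j => A.res h (a j)) y = comb (hW.trans h) a y := by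
    simp only [comb, res_res]
  have h2 : (L.map (ores h)).map (ores hW) = L.map (ores (hW.trans h)) := by
    ext i j; exact ores_ores _ _ _
  rw [h1, h2]
  exact hk.mem_iff W _ y

theorem IsKernelOn.bijective {n r : ℕ} {B : A.Submod} {U : X.Opens} {a : Fin n → A.Sec U}
    (ha : A.IsBasisOn a) {L : Matrix (Fin r) (Fin n) Γ(X, U)}
    {E : Matrix (Fin n) (Fin r) Γ(X, U)} (hk : IsKernelOn B a L E) (V : X.Opens) (h : V ≤ U) :
    Function.Bijective (fun c : Fin r → Γ(X, V) =>
      (B.obj V).mkQ (comb h (fun i => comb le_rfl a (fun j => E j i)) c)) := by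
  have hLE := map_mul_map (ores h) hk.mul_eq
  have hc : ∀ c : Fin r → Γ(X, V), comb h (fun i => comb le_rfl a (fun j => E j i)) c =
      comb h a ((E.map (ores h)) *ᵥ c) := fun c => comb_comb h a _ E (fun _ => rfl) c
  simp only [hc]
  have hmk : ∀ s s' : A.Sec V, (B.obj V).mkQ s = (B.obj V).mkQ s' ↔ s - s' ∈ B.obj V := by
    intro s s'
    simp only [Submodule.mkQ_apply]
    exact Submodule.Quotient.eq _
  constructor
  · intro c c' hcc
    dsimp only at hcc
    rw [hmk, ← comb_sub, hk.mem_iff, Matrix.mulVec_sub, Matrix.mulVec_mulVec,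
      Matrix.mulVec_mulVec, hLE, Matrix.one_mulVec, Matrix.one_mulVec, sub_eq_zero] at hcc
    exact hcc
  · intro q
    obtain ⟨s, rfl⟩ := Submodule.mkQ_surjective _ q
    obtain ⟨y, rfl⟩ := (ha V h).2 s
    refine ⟨(L.map (ores h)) *ᵥ y, ?_⟩
    dsimp only
    refine (hmk _ (comb h a y)).2 ?_
    rw [← comb_sub, hk.mem_iff, Matrix.mulVec_sub, Matrix.mulVec_mulVec,
      hLE, Matrix.one_mulVec, sub_self]

/-- Locally on `X`, `𝒜` has a basis in which `ℬ` is the kernel of a split matrix. -/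
def IsLocallyKernel (B : A.Submod) (n r : ℕ) : Prop :=
  ∀ x : X, ∃ U : X.Opens, x ∈ U ∧ ∃ a : Fin n → A.Sec U, A.IsBasisOn a ∧
    ∃ (L : Matrix (Fin r) (Fin n) Γ(X, U)) (E : Matrix (Fin n) (Fin r) Γ(X, U)),
      IsKernelOn B a L E

theorem IsLocallyKernel.quotientLocallyFree {B : A.Submod} {n r : ℕ}
    (hB : IsLocallyKernel B n r) : B.QuotientLocallyFree r := by
  intro x
  obtain ⟨U, hx, a, ha, L, E, hk⟩ := hB x
  exact ⟨U, hx, _, fun V h => hk.bijective ha V h⟩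

theorem IsLocallyKernel.isQuasicoherent {B : A.Submod} {n r : ℕ}
    (hB : IsLocallyKernel B n r) : B.IsQuasicoherent := by
  intro x
  obtain ⟨U, hx, a, ha, L, E, hk⟩ := hB x
  obtain ⟨V, hV, hxV, hVU⟩ := TopologicalSpace.Opens.isBasis_iff_nbhd.1
    (Scheme.isBasis_affineOpens X) hx
  refine ⟨V, hxV, hV, fun g => ?_⟩
  have hloc := hV.isLocalization_basicOpen g
  have halg : ∀ c : Γ(X, V), algebraMap Γ(X, V) Γ(X, X.basicOpen g) c =
    ores (X.basicOpen_le g) c := fun c => rfl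
  have hLE := map_mul_map (ores hVU) hk.mul_eq
  constructor
  · intro s hs h0
    obtain ⟨y, rfl⟩ := (ha V hVU).2 s
    change A.res _ (comb hVU a y) = 0 at h0
    rw [res_comb, ← comb_zero ((X.basicOpen_le g).trans hVU) a] at h0
    have h1 := (ha _ _).1 h0
    have h2 : ∀ j, ∃ k : ℕ, g ^ k * y j = 0 := by
      intro j
      have h3 : algebraMap Γ(X, V) Γ(X, X.basicOpen g) (y j) = 0 := congrFun h1 j
      obtain ⟨⟨_, k, rfl⟩, hk⟩ := (IsLocalization.map_eq_zero_iff (Submonoid.powers g) _ _).1 h3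
      exact ⟨k, hk⟩
    choose k hk using h2
    refine ⟨∑ j, k j, ?_⟩
    change _ • comb hVU a y = 0
    rw [← comb_smul, ← comb_zero hVU a]
    congr 1
    funext j
    change g ^ (∑ j, k j) * y j = 0
    rw [← Finset.sum_erase_add _ _ (Finset.mem_univ j), pow_add, mul_assoc, hk j, mul_zero]
  · intro s hs
    obtain ⟨y, rfl⟩ := (ha _ ((X.basicOpen_le g).trans hVU)).2 s
    change comb _ a y ∈ _ at hs
    obtain ⟨⟨_, k, rfl⟩, hk'⟩ := IsLocalization.exist_integer_multiples_of_finite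
      (Submonoid.powers g) y
    choose z hz using hk'
    have hz' : (fun j => ores (X.basicOpen_le g) (z j)) =
        ores (X.basicOpen_le g) g ^ k • y := by
      funext j
      refine (hz j).trans ?_
      rw [Algebra.smul_def, halg, map_pow]
      rfl
    have hL0 := (hk.mem_iff _ _ _).1 hs
    refine ⟨k, comb hVU a (z - (E.map (ores hVU)) *ᵥ ((L.map (ores hVU)) *ᵥ z)), ?_, ?_⟩
    · rw [hk.mem_iff, Matrix.mulVec_sub, Matrix.mulVec_mulVec, hLE, Matrix.one_mulVec, sub_self]
    · change _ = _ • comb _ a y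
      rw [res_comb, ← comb_smul, ← hz']
      congr 1
      have h1 : (fun i => ores (X.basicOpen_le g) (((L.map (ores hVU)) *ᵥ z) i)) = 0 := by
        funext i
        have h2 : ores (X.basicOpen_le g) (((L.map (ores hVU)) *ᵥ z) i) =
            ((L.map (ores ((X.basicOpen_le g).trans hVU))) *ᵥ
              (fun j => ores (X.basicOpen_le g) (z j))) i := by
          simp only [Matrix.mulVec, dotProduct, map_sum, map_mul, Matrix.map_apply, ores_ores]
        rw [h2, hz', Matrix.mulVec_smul, hL0, smul_zero]
      funext j
      rw [Pi.sub_apply, map_sub]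
      have h3 : ores (X.basicOpen_le g)
          (((E.map (ores hVU)) *ᵥ ((L.map (ores hVU)) *ᵥ z)) j) = 0 := by
        have h4 : ∀ i, ores (X.basicOpen_le g) (((L.map (ores hVU)) *ᵥ z) i) = 0 :=
          fun i => congrFun h1 i
        rw [Matrix.mulVec, dotProduct, map_sum]
        exact Finset.sum_eq_zero fun i _ => by rw [map_mul, h4, mul_zero]
      rw [h3, sub_zero]

end Local

section Pullback

open Matrix

variable {S T T' : Scheme.{u}} {A : AlgebraSheaf S} {f : T ⟶ S} {f' : T' ⟶ S}

/-- Locally on `T`, the pullback `f^*𝒜` has a basis pulled back from `S`. -/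
theorem Submod.QuotientLocallyFree.exists_kernel {n r : ℕ} (hA : A.IsLocallyFree n)
    {B : (A.pullback f').Submod} (hB : B.QuotientLocallyFree r) (t : T') :
    ∃ (U : S.Opens) (W : T'.Opens) (hW : W ≤ f' ⁻¹ᵁ U), t ∈ W ∧ ∃ a : Fin n → A.Sec U,
      A.IsBasisOn a ∧ ∃ (L : Matrix (Fin r) (Fin n) Γ(T', W))
        (E : Matrix (Fin n) (Fin r) Γ(T', W)),
        IsKernelOn B (fun j => A.pullSec f' hW (a j)) L E := by
  obtain ⟨U, hU, a, ha⟩ := hA (f' t)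
  obtain ⟨W, hW, e, he⟩ := hB t
  have hle : W ⊓ f' ⁻¹ᵁ U ≤ f' ⁻¹ᵁ U := inf_le_right
  refine ⟨U, W ⊓ f' ⁻¹ᵁ U, hle, ⟨hW, hU⟩, a, ha, ?_⟩
  refine exists_isKernelOn (A.isBasisOn_pullSec f' ha hle)
    (e := fun i => (A.pullback f').res inf_le_left (e i)) ?_
  intro V hV
  have := he V (hV.trans inf_le_left)
  simp only [comb, res_res]
  exact this

theorem Submod.QuotientLocallyFree.pullback_isLocallyKernel {n r : ℕ} (hA : A.IsLocallyFree n)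
    (g : T ⟶ T') (h : g ≫ f' = f) {B : (A.pullback f').Submod}
    (hB : B.QuotientLocallyFree r) : IsLocallyKernel (B.pullback g h) n r := by
  intro t
  obtain ⟨U, W, hW, htW, a, ha, L, E, hk⟩ := hB.exists_kernel hA (g t)
  have hU : g ⁻¹ᵁ W ≤ f ⁻¹ᵁ U := by
    subst h
    intro y hy
    exact hW hy
  have hid : g ⁻¹ᵁ W ≤ g ⁻¹ᵁ W := le_rfl
  refine ⟨g ⁻¹ᵁ W, htW, fun j => A.pullSec f hU (a j), A.isBasisOn_pullSec f ha hU,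
    L.map (opull g hid), E.map (opull g hid), map_mul_map _ hk.mul_eq, ?_⟩
  have hcomp : ∀ (V : T.Opens) (hV : V ≤ g ⁻¹ᵁ W) (W' : T'.Opens) (hW' : W' ≤ W)
      (hVW : V ≤ g ⁻¹ᵁ W') (y : Fin n → Γ(T', W')),
      A.compare g h hVW (comb hW' (fun j => A.pullSec f' hW (a j)) y) =
      comb hV (fun j => A.pullSec f hU (a j)) (fun j => opull g hVW (y j)) := by
    intro V hV W' hW' hVW y
    simp only [comb, map_sum, compare_smul]
    refine Finset.sum_congr rfl fun j _ => ?_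
    congr 1
    rw [A.compare_res g h hVW hW' hV, A.compare_pullSec g h hV hW (hV.trans hU)]
    rfl
  have hLmap : ∀ (V : T.Opens) (hV : V ≤ g ⁻¹ᵁ W),
      (L.map (opull g hid)).map (ores hV) = L.map (opull g hV) := by
    intro V hV; ext i j; exact ores_opull g hid hV _
  intro V hV y
  rw [hLmap V hV]
  constructor
  · -- sections of the pullback are killed by the matrix
    have hspan : ∀ (V : T.Opens) (hV : V ≤ g ⁻¹ᵁ W) (W' : T'.Opens) (hW' : W' ≤ W)
        (hVW : V ≤ g ⁻¹ᵁ W') (s : (A.pullback f).Sec V), s ∈ compareSpan g h B hVW →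
        ∃ y : Fin n → Γ(T, V), s = comb hV (fun j => A.pullSec f hU (a j)) y ∧
          (L.map (opull g hV)) *ᵥ y = 0 := by
      intro V hV W' hW' hVW s hs
      induction hs using Submodule.span_induction with
      | mem x hx =>
        obtain ⟨b, hb, rfl⟩ := hx
        obtain ⟨y, rfl⟩ := ((A.isBasisOn_pullSec f' ha hW) W' hW').2 b
        have h0 := (hk.mem_iff W' hW' y).1 hb
        refine ⟨fun j => opull g hVW (y j), hcomp V hV W' hW' hVW y, ?_⟩
        funext i
        have h1 := congrArg (opull g hVW) (congrFun h0 i)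
        simp only [Matrix.mulVec, dotProduct, map_sum, map_mul, Matrix.map_apply, Pi.zero_apply,
          map_zero] at h1 ⊢
        rw [← h1]
        exact Finset.sum_congr rfl fun j _ => by rw [opull_ores g hVW hW' hV]
      | zero => exact ⟨0, (comb_zero _ _).symm, Matrix.mulVec_zero _⟩
      | add x x' _ _ hx hx' =>
        obtain ⟨y, rfl, hy⟩ := hx
        obtain ⟨y', rfl, hy'⟩ := hx'
        exact ⟨y + y', (comb_add _ _ _ _).symm, by rw [Matrix.mulVec_add, hy, hy', add_zero]⟩
      | smul c x _ hx =>
        obtain ⟨y, rfl, hy⟩ := hx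
        exact ⟨c • y, (comb_smul _ _ _ _).symm, by rw [Matrix.mulVec_smul, hy, smul_zero]⟩
    intro hs
    funext i
    refine ogerm_ext _ _ fun x hx => ?_
    obtain ⟨V1, hV1, W1, hW1, hx1, h1⟩ := hs x hx
    have hle : V1 ≤ g ⁻¹ᵁ (W1 ⊓ W) := fun z hz => ⟨hW1 hz, hV (hV1 hz)⟩
    have h2 := res_mem_compareSpan g h B hW1 hle le_rfl inf_le_left h1
    rw [res_res] at h2
    obtain ⟨y', hy', hy0⟩ := hspan V1 (hV1.trans hV) (W1 ⊓ W) inf_le_right hle _ h2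
    rw [res_comb] at hy'
    have h3 := (A.isBasisOn_pullSec f ha hU V1 (hV1.trans hV)).1 hy'
    rw [← ogerm_ores hV1 x hx1, ← ogerm_ores hV1 x hx1]
    congr 1
    rw [← h3] at hy0
    have h4 := congrFun hy0 i
    simp only [Matrix.mulVec, dotProduct, map_sum, map_mul, Matrix.map_apply, Pi.zero_apply,
      map_zero, ores_opull] at h4 ⊢
    exact h4
  · -- vectors killed by the matrix are combinations of pulled back sections
    intro hy
    have hb : ∀ k : Fin n, comb le_rfl (fun j => A.pullSec f' hW (a j))
        (Pi.single k 1 - E *ᵥ (L *ᵥ (Pi.single k 1))) ∈ B.obj W := by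
      intro k
      rw [hk.mem_iff]
      have hidL : L.map (ores (le_refl W)) = L := by ext i j; exact ores_self _ _
      rw [hidL, Matrix.mulVec_sub, Matrix.mulVec_mulVec _ L E, hk.mul_eq,
        Matrix.one_mulVec, sub_self]
    have hmem : ∑ k, y k • A.compare g h hV (comb le_rfl (fun j => A.pullSec f' hW (a j))
        (Pi.single k 1 - E *ᵥ (L *ᵥ (Pi.single k 1)))) ∈ (B.pullback g h).obj V :=
      Submodule.sum_mem _ fun k _ => Submodule.smul_mem _ _ (compare_mem g h B hV (hb k))
    convert hmem using 1
    simp only [hcomp V hV W le_rfl hV, ← comb_smul]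
    have hsum : ∀ z : Fin n → Fin n → Γ(T, V),
        ∑ k, comb hV (fun j => A.pullSec f hU (a j)) (z k) =
        comb hV (fun j => A.pullSec f hU (a j)) (∑ k, z k) := by
      intro z
      simp only [comb, Finset.sum_apply, Finset.sum_smul]
      exact Finset.sum_comm
    rw [hsum]
    congr 1
    have hz : y = y - (E.map (opull g hV)) *ᵥ ((L.map (opull g hV)) *ᵥ y) := by
      rw [hy, Matrix.mulVec_zero, sub_zero]
    refine hz.trans ?_
    funext j
    simp only [Matrix.mulVec_mulVec, ← Matrix.map_mul]
    simp only [Pi.sub_apply, Finset.sum_apply, Pi.smul_apply, smul_eq_mul, map_sub, mul_sub,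
      Finset.sum_sub_distrib, Matrix.mulVec_single_one, Matrix.col_apply]
    congr 1
    · simp [Pi.single_apply, apply_ite (opull g hV)]
    · simp only [Matrix.mulVec, dotProduct, Matrix.map_apply]
      exact Finset.sum_congr rfl fun k _ => mul_comm _ _

theorem Submod.QuotientLocallyFree.pullback {n r : ℕ} (hA : A.IsLocallyFree n)
    (g : T ⟶ T') (h : g ≫ f' = f) {B : (A.pullback f').Submod}
    (hB : B.QuotientLocallyFree r) : (B.pullback g h).QuotientLocallyFree r :=
  (hB.pullback_isLocallyKernel hA g h).quotientLocallyFree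

theorem Submod.QuotientLocallyFree.pullback_isQuasicoherent {n r : ℕ} (hA : A.IsLocallyFree n)
    (g : T ⟶ T') (h : g ≫ f' = f) {B : (A.pullback f').Submod}
    (hB : B.QuotientLocallyFree r) : (B.pullback g h).IsQuasicoherent :=
  (hB.pullback_isLocallyKernel hA g h).isQuasicoherent

end Pullback

end AlgebraSheaf

section Functors

variable {S : Scheme.{u}}

/-- The category of locally Noetherian schemes over `S`. -/
abbrev LocNoethOver (S : Scheme.{u}) : Type (u + 1) :=
  ObjectProperty.FullSubcategory (fun T : Over S => IsLocallyNoetherian T.left)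

namespace AlgebraSheaf

variable (A : AlgebraSheaf S)

/-- A family of subalgebras of `𝒜` of corank `δ` on `f : T ⟶ S`: a quasi-coherent
`𝒪_T`-subalgebra `ℬ` of `f^*𝒜` such that `f^*𝒜/ℬ` is locally free of rank `δ`. -/
structure IsFamilyOfSubalgebras {T : Scheme.{u}} {f : T ⟶ S} (δ : ℕ)
    (B : (A.pullback f).Submod) : Prop where
  isSubalgebra : B.IsSubalgebra
  isQuasicoherent : B.IsQuasicoherent
  quotientLocallyFree : B.QuotientLocallyFree δ

/-- A `T`-point of the Grassmannian `Gr(d, 𝒜)`, where `𝒜` is locally free of rank `n`: a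
quasi-coherent `𝒪_T`-submodule `ℰ` of `f^*𝒜` such that `f^*𝒜/ℰ` is locally free of rank
`n - d`. -/
structure IsGrassmannianPoint {T : Scheme.{u}} {f : T ⟶ S} (n : ℕ) (d : ℤ)
    (E : (A.pullback f).Submod) : Prop where
  isQuasicoherent : E.IsQuasicoherent
  quotientLocallyFree : ∃ r : ℕ, (r : ℤ) = n - d ∧ E.QuotientLocallyFree r

variable {A} {n : ℕ} (hA : A.IsLocallyFree n)

/-- The functor `F^δ_𝒜` of families of subalgebras of corank `δ` of a locally free `𝒜`, on
locally Noetherian `S`-schemes, with pullback of families. -/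
def territoryFunctor (δ : ℕ) : (LocNoethOver S)ᵒᵖ ⥤ Type u where
  obj T := {B : (A.pullback T.unop.obj.hom).Submod // A.IsFamilyOfSubalgebras δ B}
  map g := ↾fun B => ⟨B.1.pullback g.unop.hom.left (Over.w g.unop.hom),
    B.2.isSubalgebra.pullback _ _,
    B.2.quotientLocallyFree.pullback_isQuasicoherent hA _ _,
    B.2.quotientLocallyFree.pullback hA _ _⟩
  map_id T := by
    ext B
    exact Submod.pullback_id (T := T.unop.obj.left) (Over.w (𝟙 T.unop.obj)) B.1
  map_comp g g' := by
    ext B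
    exact Submod.pullback_comp g'.unop.hom.left (Over.w g'.unop.hom) g.unop.hom.left
      (Over.w g.unop.hom) (Over.w (g'.unop.hom ≫ g.unop.hom)) B.1

/-- The Grassmannian functor `Gr(d, 𝒜)` of an `𝒜` which is locally free of rank `n`, on locally
Noetherian `S`-schemes. -/
def grassmannianFunctor (d : ℤ) : (LocNoethOver S)ᵒᵖ ⥤ Type u where
  obj T := {E : (A.pullback T.unop.obj.hom).Submod // A.IsGrassmannianPoint n d E}
  map g := ↾fun E => ⟨E.1.pullback g.unop.hom.left (Over.w g.unop.hom), by
    obtain ⟨r, hr, h⟩ := E.2.quotientLocallyFree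
    exact ⟨h.pullback_isQuasicoherent hA _ _, r, hr, h.pullback hA _ _⟩⟩
  map_id T := by
    ext B
    exact Submod.pullback_id (T := T.unop.obj.left) (Over.w (𝟙 T.unop.obj)) B.1
  map_comp g g' := by
    ext B
    exact Submod.pullback_comp g'.unop.hom.left (Over.w g'.unop.hom) g.unop.hom.left
      (Over.w g.unop.hom) (Over.w (g'.unop.hom ≫ g.unop.hom)) B.1

end AlgebraSheaf

end Functors

end AlgebraicGeometry

end

/-!
Everything is reduced to matrices. Over an open set on which `𝒜` is free, a submodule `ℬ` with
locally free quotient of rank `r` is locally the kernel of an `r × n` matrix `L` with a right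
inverse (`IsKernelOn`). Such an `L` is unique up to left multiplication by an invertible matrix,
and it is compatible with base change (`IsKernelOn.pullback`).

*The Grassmannian.* On all schemes, consider the presheaf of pairs consisting of a morphism `T ⟶ S`
and a submodule of the pullback of `𝒜` with locally free quotient of rank `r`
(`grPresheaf`). Submodules glue, so that it is a Zariski sheaf (`grPresheaf_isSheaf`). For an affine
open `U` of `S`, a basis of `𝒜|_U` and a choice `I` of `r` indices, the points at which the columns
of `L` in `I` form an invertible matrix can be normalized to have the identity there. The other
entries are then free, so that such points are represented by an affine space over `U`
(`GrChart.scheme`). The inclusion of a chart is an open immersion, since a determinant being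
invertible is an open condition (`GrChart.hom_presheaf`), and the charts cover because over a local
ring some maximal minor of a right invertible matrix is a unit (`exists_isUnit_det_submatrix`). A
Zariski sheaf with such a cover by schemes is representable; the result is locally Noetherian
because the charts are.

*The locus of subalgebras.* Let `ℬ` be the universal submodule on a scheme `G` representing the
Grassmannian. Where `ℬ` is the kernel of `L` and `E` is a right inverse of `L`, the columns of
`1 - E L` generate `ℬ`, so that `ℬ` is a subalgebra if and only if `L` kills the coordinates of `1`
and of the products of these generators. These finitely many functions are the `obstruction`; they
are compatible with base change. To avoid gluing ideals, the ideal of the locus is defined without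
choices, as the functions that vanish on every scheme over `G` on which `ℬ` becomes a subalgebra
(`subalgebraIdeal`). On small affine open sets it is generated by the obstructions
(`subalgebraIdeal_eq`: test with the closed subscheme which they define), whence it commutes with
localization and is an ideal sheaf. A morphism to `G` factors through the corresponding closed
subscheme if and only if the pullback of `ℬ` is a subalgebra (`exists_comp_subschemeι_iff`).
-/

noncomputable section
namespace AlgebraicGeometry

/-! ### Functions along open immersions -/

section OpenImmersion

variable {T T' : Scheme.{u}} (g : T ⟶ T')

theorem opull_injective [IsOpenImmersion g] {W : T'.Opens} {V : T.Opens} (h : V ≤ g ⁻¹ᵁ W)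
    (hW : W ≤ g ''ᵁ V) : Function.Injective (opull g h) := by
  intro c c' hc
  refine ogerm_ext _ _ fun x hx => ?_
  obtain ⟨t, ht, rfl⟩ := hW hx
  have h1 := congrArg (ogerm V t ht) hc
  rw [ogerm_opull, ogerm_opull] at h1
  exact (ConcreteCategory.bijective_of_isIso (g.stalkMap t)).1 h1

theorem exists_opull_eq [IsOpenImmersion g] {V : T.Opens} (h : V ≤ g ⁻¹ᵁ (g ''ᵁ V)) (c : Γ(T, V)) :
    ∃ c', opull g h c' = c := by
  refine ⟨(g.appIso V).inv c, ?_⟩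
  have := g.appIso_inv_appLE (U := V) (V := V) h
  have h2 := congrArg (fun φ => φ.hom c) this
  refine h2.trans ?_
  exact ores_self le_rfl c

theorem opull_opull {T'' : Scheme.{u}} (k : T' ⟶ T'') {W : T''.Opens} {V' : T'.Opens} {V : T.Opens}
    (hV' : V' ≤ k ⁻¹ᵁ W) (hV : V ≤ g ⁻¹ᵁ V') (hVW : V ≤ (g ≫ k) ⁻¹ᵁ W) (c : Γ(T'', W)) :
    opull g hV (opull k hV' c) = opull (g ≫ k) hVW c := by
  have := Scheme.Hom.appLE_comp_appLE g k W V' V hV' hV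
  exact congrArg (fun φ => φ.hom c) this

theorem ores_eq_zero_of_cover {X : Scheme.{u}} {U : X.Opens} (c : Γ(X, U))
    (h : ∀ x ∈ U, ∃ (V : X.Opens) (hV : V ≤ U), x ∈ V ∧ ores hV c = 0) : c = 0 := by
  refine ogerm_ext _ _ fun x hx => ?_
  obtain ⟨V, hV, hxV, h0⟩ := h x hx
  rw [← ogerm_ores hV x hxV, h0, map_zero, map_zero]

end OpenImmersion

namespace AlgebraSheaf

open Matrix

/-! ### Kernels of split matrices -/

section Kernel

variable {X : Scheme.{u}} {A : AlgebraSheaf X}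

/-- Two sections which agree locally are equal. -/
theorem sec_ext_of_locally {U : X.Opens} (s s' : A.Sec U)
    (h : ∀ x ∈ U, ∃ (V : X.Opens) (hV : V ≤ U), x ∈ V ∧ A.res hV s = A.res hV s') : s = s' := by
  refine TopCat.Presheaf.section_ext A.sheaf U s s' fun x hx => ?_
  obtain ⟨V, hV, hxV, h0⟩ := h x hx
  have h1 := congrArg (A.germ V x hxV) h0
  rw [germ_res, germ_res] at h1
  exact h1

theorem ores_mulVec {m n : ℕ} {U V W : X.Opens} (h : V ≤ U) (h' : W ≤ V)
    (L : Matrix (Fin m) (Fin n) Γ(X, U)) (y : Fin n → Γ(X, V)) :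
    (fun i => ores h' ((L.map (ores h) *ᵥ y) i)) =
      L.map (ores (h'.trans h)) *ᵥ (fun j => ores h' (y j)) := by
  funext i
  simp only [Matrix.mulVec, dotProduct, map_sum, map_mul, Matrix.map_apply, ores_ores]

theorem map_ores_self {m n : ℕ} {U : X.Opens} (h : U ≤ U) (L : Matrix (Fin m) (Fin n) Γ(X, U)) :
    L.map (ores h) = L := by
  ext i j; exact ores_self _ _

theorem IsKernelOn.mem_iff_self {n r : ℕ} {B : A.Submod} {U : X.Opens} {a : Fin n → A.Sec U}
    {L : Matrix (Fin r) (Fin n) Γ(X, U)} {E : Matrix (Fin n) (Fin r) Γ(X, U)}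
    (hk : IsKernelOn B a L E) (y : Fin n → Γ(X, U)) :
    comb le_rfl a y ∈ B.obj U ↔ L *ᵥ y = 0 := by
  rw [hk.mem_iff, map_ores_self]

/-- A matrix with kernel `ℬ` is unique up to a factor on the left: `L' = (L' E) L`. -/
theorem IsKernelOn.eq_mul {n r : ℕ} {B : A.Submod} {U : X.Opens} {a : Fin n → A.Sec U}
    {L L' : Matrix (Fin r) (Fin n) Γ(X, U)} {E E' : Matrix (Fin n) (Fin r) Γ(X, U)}
    (hk : IsKernelOn B a L E) (hk' : IsKernelOn B a L' E') : L' = L' * E * L := by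
  have h : ∀ y, L' *ᵥ y = (L' * E * L) *ᵥ y := by
    intro y
    have h1 : L *ᵥ (y - E *ᵥ (L *ᵥ y)) = 0 := by
      rw [Matrix.mulVec_sub, Matrix.mulVec_mulVec, hk.mul_eq, Matrix.one_mulVec, sub_self]
    rw [← hk.mem_iff_self, hk'.mem_iff_self, Matrix.mulVec_sub, sub_eq_zero] at h1
    rw [h1, Matrix.mulVec_mulVec, Matrix.mulVec_mulVec]
  ext i j
  have := congrFun (h (Pi.single j 1)) i
  simpa using this

/-- Two matrices with the same kernel and a common right inverse are equal. -/
theorem IsKernelOn.unique {n r : ℕ} {B : A.Submod} {U : X.Opens} {a : Fin n → A.Sec U}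
    {L L' : Matrix (Fin r) (Fin n) Γ(X, U)} {E : Matrix (Fin n) (Fin r) Γ(X, U)}
    (hk : IsKernelOn B a L E) (hk' : IsKernelOn B a L' E) : L' = L := by
  rw [hk.eq_mul hk', hk'.mul_eq, Matrix.one_mul]

/-- A split matrix over an open set on which `𝒜` is free, and which locally cuts out `ℬ`, cuts out
`ℬ`. -/
theorem isKernelOn_of_locally {n r : ℕ} {B : A.Submod} {U : X.Opens} {a : Fin n → A.Sec U}
    {L : Matrix (Fin r) (Fin n) Γ(X, U)} {E : Matrix (Fin n) (Fin r) Γ(X, U)} (hLE : L * E = 1)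
    (h : ∀ x ∈ U, ∃ (V : X.Opens) (hV : V ≤ U), x ∈ V ∧
      IsKernelOn B (fun j => A.res hV (a j)) (L.map (ores hV)) (E.map (ores hV))) :
    IsKernelOn B a L E := by
  refine ⟨hLE, fun V hV y => ?_⟩
  have key : ∀ (V' W : X.Opens) (hW : W ≤ U) (hV' : V' ≤ W) (hVV : V' ≤ V)
      (hk : IsKernelOn B (fun j => A.res hW (a j)) (L.map (ores hW)) (E.map (ores hW))),
      A.res hVV (comb hV a y) ∈ B.obj V' ↔
        (fun i => ores hVV ((L.map (ores hV) *ᵥ y) i)) = 0 := by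
    intro V' W hW hV' hVV hk
    have h1 : A.res hVV (comb hV a y) =
        comb hV' (fun j => A.res hW (a j)) (fun j => ores hVV (y j)) := by
      rw [res_comb]
      simp only [comb, res_res]
    have h2 : (L.map (ores hW)).map (ores hV') = L.map (ores (hVV.trans hV)) := by
      ext i j; exact ores_ores _ _ _
    rw [h1, hk.mem_iff, h2, ores_mulVec]
  constructor
  · intro hs
    funext i
    refine ores_eq_zero_of_cover _ fun x hx => ?_
    obtain ⟨W, hW, hxW, hk⟩ := h x (hV hx)
    refine ⟨V ⊓ W, inf_le_left, ⟨hx, hxW⟩, ?_⟩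
    exact congrFun ((key (V ⊓ W) W hW inf_le_right inf_le_left hk).1 (B.res_mem _ hs)) i
  · intro h0
    refine B.of_locally _ fun x hx => ?_
    obtain ⟨W, hW, hxW, hk⟩ := h x (hV hx)
    refine ⟨V ⊓ W, inf_le_left, ⟨hx, hxW⟩, ?_⟩
    refine (key (V ⊓ W) W hW inf_le_right inf_le_left hk).2 ?_
    rw [h0]
    funext i
    exact map_zero _

/-- Multiplication of the matrix by an invertible matrix on the left does not change the kernel. -/
theorem IsKernelOn.mul_left {n r : ℕ} {B : A.Submod} {U : X.Opens} {a : Fin n → A.Sec U}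
    {L : Matrix (Fin r) (Fin n) Γ(X, U)} {E E' : Matrix (Fin n) (Fin r) Γ(X, U)}
    (hk : IsKernelOn B a L E) {M M' : Matrix (Fin r) (Fin r) Γ(X, U)} (hM : M' * M = 1)
    (hE : M * L * E' = 1) : IsKernelOn B a (M * L) E' := by
  refine ⟨hE, fun V hV y => ?_⟩
  rw [hk.mem_iff]
  have hM' := map_mul_map (ores hV) hM
  rw [Matrix.map_mul, ← Matrix.mulVec_mulVec]
  constructor
  · intro h; rw [h, Matrix.mulVec_zero]
  · intro h
    have := congrArg (fun v => (M'.map (ores hV)) *ᵥ v) h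
    simpa only [Matrix.mulVec_mulVec, ← Matrix.mul_assoc, hM', Matrix.one_mul, Matrix.mulVec_zero]
      using this

/-- The kernel of a matrix `L` in terms of a basis `a` of `𝒜` over all of `X`. -/
def kernelSubmod {n r : ℕ} {a : Fin n → A.Sec ⊤} (ha : A.IsBasisOn a)
    (L : Matrix (Fin r) (Fin n) Γ(X, ⊤)) : A.Submod where
  obj V :=
    { carrier := {s | ∃ y, comb le_top a y = s ∧ L.map (ores le_top) *ᵥ y = 0}
      add_mem' := by
        rintro _ _ ⟨y, rfl, hy⟩ ⟨z, rfl, hz⟩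
        exact ⟨y + z, comb_add _ _ _ _, by rw [Matrix.mulVec_add, hy, hz, add_zero]⟩
      zero_mem' := ⟨0, comb_zero _ _, Matrix.mulVec_zero _⟩
      smul_mem' := by
        rintro c _ ⟨y, rfl, hy⟩
        exact ⟨c • y, comb_smul _ _ _ _, by rw [Matrix.mulVec_smul, hy, smul_zero]⟩ }
  res_mem := by
    rintro U V h _ ⟨y, rfl, hy⟩
    refine ⟨fun j => ores h (y j), (res_comb _ _ _ _).symm, ?_⟩
    rw [← ores_mulVec le_top h, hy]
    funext i
    exact map_zero _
  of_locally := by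
    intro U s hs
    obtain ⟨y, rfl⟩ := (ha U le_top).2 s
    refine ⟨y, rfl, ?_⟩
    funext i
    refine ores_eq_zero_of_cover _ fun x hx => ?_
    obtain ⟨V, hV, hxV, z, hz, hz0⟩ := hs x hx
    refine ⟨V, hV, hxV, ?_⟩
    have h1 : A.res hV (comb le_top a y) = comb le_top a z := hz.symm
    rw [res_comb] at h1
    have h2 := (ha V le_top).1 h1
    have h3 := ores_mulVec le_top hV L y
    rw [h2, hz0] at h3
    exact congrFun h3 i

theorem isKernelOn_kernelSubmod {n r : ℕ} {a : Fin n → A.Sec ⊤} (ha : A.IsBasisOn a)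
    {L : Matrix (Fin r) (Fin n) Γ(X, ⊤)} {E : Matrix (Fin n) (Fin r) Γ(X, ⊤)} (h : L * E = 1) :
    IsKernelOn (kernelSubmod ha L) a L E := by
  refine ⟨h, fun V hV y => ?_⟩
  constructor
  · rintro ⟨z, hz, hz0⟩
    rw [← (ha V hV).1 hz]
    exact hz0
  · intro h0
    exact ⟨y, rfl, h0⟩

theorem IsKernelOn.submod_eq {n r : ℕ} {B B' : A.Submod} {a : Fin n → A.Sec ⊤}
    (ha : A.IsBasisOn a) {L : Matrix (Fin r) (Fin n) Γ(X, ⊤)}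
    {E E' : Matrix (Fin n) (Fin r) Γ(X, ⊤)} (hk : IsKernelOn B a L E) (hk' : IsKernelOn B' a L E') :
    B = B' := by
  refine Submod.ext' fun V => ?_
  ext s
  obtain ⟨y, rfl⟩ := (ha V le_top).2 s
  exact (hk.mem_iff V le_top y).trans (hk'.mem_iff V le_top y).symm

end Kernel

/-! ### Pullback of kernels -/

section PullbackKernel

variable {S T T' : Scheme.{u}} {A : AlgebraSheaf S} {f : T ⟶ S} {f' : T' ⟶ S}

theorem preimage_le_of_comp (g : T ⟶ T') (h : g ≫ f' = f) {U : S.Opens} {W : T'.Opens}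
    {V : T.Opens} (hW : W ≤ f' ⁻¹ᵁ U) (hV : V ≤ g ⁻¹ᵁ W) : V ≤ f ⁻¹ᵁ U := by
  subst h
  intro y hy
  exact hW (hV hy)

/-- The canonical map on linear combinations of a basis coming from `S`. -/
theorem compare_comb {n : ℕ} (g : T ⟶ T') (h : g ≫ f' = f) {U : S.Opens} (a : Fin n → A.Sec U)
    {W W' : T'.Opens} {V V' : T.Opens} (hW : W ≤ f' ⁻¹ᵁ U) (hV : V ≤ f ⁻¹ᵁ U) (hW' : W' ≤ W)
    (hV' : V' ≤ V) (hVW : V' ≤ g ⁻¹ᵁ W') (y : Fin n → Γ(T', W')) :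
    A.compare g h hVW (comb hW' (fun j => A.pullSec f' hW (a j)) y) =
      comb hV' (fun j => A.pullSec f hV (a j)) (fun j => opull g hVW (y j)) := by
  simp only [comb, map_sum, compare_smul]
  refine Finset.sum_congr rfl fun j _ => ?_
  congr 1
  have hV1 : V' ≤ g ⁻¹ᵁ W := fun z hz => hW' (hVW hz)
  rw [A.compare_res g h hVW hW' hV1, A.compare_pullSec g h hV1 hW (hV'.trans hV)]
  rfl

theorem opull_mulVec (g : T ⟶ T') {m n : ℕ} {W W' : T'.Opens} {V V' : T.Opens}
    (hW' : W' ≤ W) (hVW : V' ≤ g ⁻¹ᵁ W') (hV : V ≤ g ⁻¹ᵁ W) (hV' : V' ≤ V)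
    (L : Matrix (Fin m) (Fin n) Γ(T', W)) (y : Fin n → Γ(T', W')) :
    (fun i => opull g hVW ((L.map (ores hW') *ᵥ y) i)) =
      (L.map (opull g hV)).map (ores hV') *ᵥ (fun j => opull g hVW (y j)) := by
  funext i
  simp only [Matrix.mulVec, dotProduct, map_sum, map_mul, Matrix.map_apply]
  refine Finset.sum_congr rfl fun j _ => ?_
  rw [ores_opull, opull_ores g hVW hW' (hV'.trans hV)]

/-- If `ℬ` is the kernel of a split matrix `L` over `W`, in terms of a basis coming from `S`, then
`g^*ℬ` is the kernel of the pulled back matrix. -/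
theorem IsKernelOn.pullback {n r : ℕ} (g : T ⟶ T') (h : g ≫ f' = f)
    {B : (A.pullback f').Submod} {U : S.Opens} {a : Fin n → A.Sec U} (ha : A.IsBasisOn a)
    {W : T'.Opens} (hW : W ≤ f' ⁻¹ᵁ U) {L : Matrix (Fin r) (Fin n) Γ(T', W)}
    {E : Matrix (Fin n) (Fin r) Γ(T', W)} (hk : IsKernelOn B (fun j => A.pullSec f' hW (a j)) L E)
    {V₀ : T.Opens} (hV₀ : V₀ ≤ g ⁻¹ᵁ W) (hU : V₀ ≤ f ⁻¹ᵁ U) :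
    IsKernelOn (B.pullback g h) (fun j => A.pullSec f hU (a j)) (L.map (opull g hV₀))
      (E.map (opull g hV₀)) := by
  refine ⟨map_mul_map _ hk.mul_eq, fun V hV y => ?_⟩
  constructor
  · have hspan : ∀ (V : T.Opens) (hV : V ≤ V₀) (W' : T'.Opens) (hW' : W' ≤ W)
        (hVW : V ≤ g ⁻¹ᵁ W') (s : (A.pullback f).Sec V), s ∈ compareSpan g h B hVW →
        ∃ y : Fin n → Γ(T, V), s = comb hV (fun j => A.pullSec f hU (a j)) y ∧
          (L.map (opull g hV₀)).map (ores hV) *ᵥ y = 0 := by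
      intro V hV W' hW' hVW s hs
      induction hs using Submodule.span_induction with
      | mem x hx =>
        obtain ⟨b, hb, rfl⟩ := hx
        obtain ⟨y, rfl⟩ := ((A.isBasisOn_pullSec f' ha hW) W' hW').2 b
        have h0 := (hk.mem_iff W' hW' y).1 hb
        refine ⟨fun j => opull g hVW (y j), compare_comb g h a hW hU hW' hV hVW y, ?_⟩
        rw [← opull_mulVec g hW' hVW hV₀ hV, h0]
        funext i
        exact map_zero _
      | zero => exact ⟨0, (comb_zero _ _).symm, Matrix.mulVec_zero _⟩
      | add x x' _ _ hx hx' =>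
        obtain ⟨y, rfl, hy⟩ := hx
        obtain ⟨y', rfl, hy'⟩ := hx'
        exact ⟨y + y', (comb_add _ _ _ _).symm, by rw [Matrix.mulVec_add, hy, hy', add_zero]⟩
      | smul c x _ hx =>
        obtain ⟨y, rfl, hy⟩ := hx
        exact ⟨c • y, (comb_smul _ _ _ _).symm, by rw [Matrix.mulVec_smul, hy, smul_zero]⟩
    intro hs
    funext i
    refine ores_eq_zero_of_cover _ fun x hx => ?_
    obtain ⟨V1, hV1, W1, hW1, hx1, h1⟩ := hs x hx
    refine ⟨V1, hV1, hx1, ?_⟩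
    have hle : V1 ≤ g ⁻¹ᵁ (W1 ⊓ W) := fun z hz => ⟨hW1 hz, hV₀ (hV (hV1 hz))⟩
    have h2 := res_mem_compareSpan g h B hW1 hle le_rfl inf_le_left h1
    rw [res_res] at h2
    obtain ⟨y', hy', hy0⟩ := hspan V1 (hV1.trans hV) (W1 ⊓ W) inf_le_right hle _ h2
    rw [res_comb] at hy'
    have h3 := (A.isBasisOn_pullSec f ha hU V1 (hV1.trans hV)).1 hy'
    rw [← h3, ← ores_mulVec hV hV1] at hy0
    exact congrFun hy0 i
  · -- `y = (1 - E L) y`, and the columns of `1 - E L` are images of sections of `ℬ`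
    intro hy
    have hU' : g ⁻¹ᵁ W ≤ f ⁻¹ᵁ U := preimage_le_of_comp g h hW le_rfl
    have hVW : V ≤ g ⁻¹ᵁ W := hV.trans hV₀
    have hb : ∀ k : Fin n, comb le_rfl (fun j => A.pullSec f' hW (a j))
        (Pi.single k 1 - E *ᵥ (L *ᵥ (Pi.single k 1))) ∈ B.obj W := by
      intro k
      rw [hk.mem_iff_self, Matrix.mulVec_sub, Matrix.mulVec_mulVec _ L E, hk.mul_eq,
        Matrix.one_mulVec, sub_self]
    have hmem : ∑ k, y k • A.compare g h hVW (comb le_rfl (fun j => A.pullSec f' hW (a j))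
        (Pi.single k 1 - E *ᵥ (L *ᵥ (Pi.single k 1)))) ∈ (B.pullback g h).obj V :=
      Submodule.sum_mem _ fun k _ => Submodule.smul_mem _ _ (compare_mem g h B hVW (hb k))
    convert hmem using 1
    simp only [compare_comb g h a hW hU le_rfl hV hVW, ← comb_smul]
    have hsum : ∀ z : Fin n → Fin n → Γ(T, V),
        ∑ k, comb hV (fun j => A.pullSec f hU (a j)) (z k) =
        comb hV (fun j => A.pullSec f hU (a j)) (∑ k, z k) := by
      intro z
      simp only [comb, Finset.sum_apply, Finset.sum_smul]
      exact Finset.sum_comm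
    rw [hsum]
    congr 1
    have hmap : ∀ {p q : ℕ} (M : Matrix (Fin p) (Fin q) Γ(T', W)),
        (M.map (opull g hV₀)).map (ores hV) = M.map (opull g hVW) := by
      intro p q M; ext i j; exact ores_opull g hV₀ hV _
    rw [hmap] at hy
    have hz : y = y - (E.map (opull g hVW)) *ᵥ ((L.map (opull g hVW)) *ᵥ y) := by
      rw [hy, Matrix.mulVec_zero, sub_zero]
    refine hz.trans ?_
    funext j
    simp only [Matrix.mulVec_mulVec, ← Matrix.map_mul]
    simp only [Pi.sub_apply, Finset.sum_apply, Pi.smul_apply, smul_eq_mul, map_sub, mul_sub,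
      Finset.sum_sub_distrib, Matrix.mulVec_single_one, Matrix.col_apply]
    congr 1
    · simp [Pi.single_apply, apply_ite (opull g hVW)]
    · simp only [Matrix.mulVec, dotProduct, Matrix.map_apply]
      exact Finset.sum_congr rfl fun k _ => mul_comm _ _

/-- A submodule with locally free quotient is quasi-coherent. -/
theorem Submod.QuotientLocallyFree.isQuasicoherent {n r : ℕ} (hA : A.IsLocallyFree n)
    {B : (A.pullback f).Submod} (hB : B.QuotientLocallyFree r) : B.IsQuasicoherent := by
  have h : 𝟙 T ≫ f = f := Category.id_comp f
  have := hB.pullback_isQuasicoherent hA (𝟙 T) h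
  rwa [Submod.pullback_id] at this

theorem Submod.quotientLocallyFree_of_isKernelOn {n r : ℕ} {B : (A.pullback f).Submod}
    (h : ∀ t : T, ∃ (U : S.Opens) (a : Fin n → A.Sec U) (W : T.Opens) (hW : W ≤ f ⁻¹ᵁ U)
      (L : Matrix (Fin r) (Fin n) Γ(T, W)) (E : Matrix (Fin n) (Fin r) Γ(T, W)), A.IsBasisOn a ∧
      t ∈ W ∧ IsKernelOn B (fun j => A.pullSec f hW (a j)) L E) : B.QuotientLocallyFree r := by
  refine IsLocallyKernel.quotientLocallyFree (n := n) fun t => ?_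
  obtain ⟨U, a, W, hW, L, E, ha, ht, hk⟩ := h t
  exact ⟨W, ht, _, A.isBasisOn_pullSec f ha hW, L, E, hk⟩

end PullbackKernel

/-! ### Submodules and open immersions -/

section OpenImmersion

variable {S T T' : Scheme.{u}} {A : AlgebraSheaf S} {f : T ⟶ S} {f' : T' ⟶ S} {n : ℕ}

theorem compare_injective (hA : A.IsLocallyFree n) (g : T ⟶ T') [IsOpenImmersion g]
    (h : g ≫ f' = f) {W : T'.Opens} {V : T.Opens} (hV : V ≤ g ⁻¹ᵁ W) (hW : W ≤ g ''ᵁ V) :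
    Function.Injective (A.compare g h hV) := by
  intro s s' hs
  refine sec_ext_of_locally s s' fun x hx => ?_
  obtain ⟨t, ht, rfl⟩ := hW hx
  obtain ⟨U, hU, a, ha⟩ := hA (f' (g t))
  have hW1 : W ⊓ f' ⁻¹ᵁ U ≤ f' ⁻¹ᵁ U := inf_le_right
  have hV1 : V ⊓ g ⁻¹ᵁ (W ⊓ f' ⁻¹ᵁ U) ≤ g ⁻¹ᵁ (W ⊓ f' ⁻¹ᵁ U) := inf_le_right
  refine ⟨W ⊓ f' ⁻¹ᵁ U, inf_le_left, ⟨hx, hU⟩, ?_⟩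
  have hV2 : V ⊓ g ⁻¹ᵁ (W ⊓ f' ⁻¹ᵁ U) ≤ f ⁻¹ᵁ U := preimage_le_of_comp g h hW1 hV1
  have hs1 := congrArg ((A.pullback f).res (inf_le_left : V ⊓ g ⁻¹ᵁ (W ⊓ f' ⁻¹ᵁ U) ≤ V)) hs
  rw [res_compare, res_compare, ← A.compare_res g h hV1 inf_le_left,
    ← A.compare_res g h hV1 inf_le_left] at hs1
  obtain ⟨y, hy⟩ := (A.isBasisOn_pullSec f' ha hW1 _ le_rfl).2 ((A.pullback f').res inf_le_left s)
  obtain ⟨y', hy'⟩ := (A.isBasisOn_pullSec f' ha hW1 _ le_rfl).2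
    ((A.pullback f').res inf_le_left s')
  rw [← hy, ← hy'] at hs1 ⊢
  have e := fun y => compare_comb g h a hW1 hV2 le_rfl le_rfl hV1 y
  have hs2 := (e y).symm.trans (hs1.trans (e y'))
  have h3 := (A.isBasisOn_pullSec f ha hV2 _ le_rfl).1 hs2
  have hinj : Function.Injective (opull g hV1) := by
    refine opull_injective g hV1 ?_
    rintro _ ⟨hz1, hz2⟩
    obtain ⟨z, hz, rfl⟩ := hW hz1
    exact ⟨z, ⟨hz, ⟨hz1, hz2⟩⟩, rfl⟩
  have h4 : y = y' := by
    funext j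
    exact hinj (congrFun h3 j)
  rw [h4]

/-- A section over an open subset of the image of an open immersion `g` lies in `ℬ` if its image
lies in `g^*ℬ`. -/
theorem mem_of_compare_mem (hA : A.IsLocallyFree n) (g : T ⟶ T') [IsOpenImmersion g]
    (h : g ≫ f' = f) {W : T'.Opens} {V : T.Opens} (hV : V ≤ g ⁻¹ᵁ W) (hW : W ≤ g ''ᵁ V)
    (B : (A.pullback f').Submod) {s : (A.pullback f').Sec W}
    (hs : A.compare g h hV s ∈ (B.pullback g h).obj V) : s ∈ B.obj W := by
  refine B.of_locally s fun x hx => ?_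
  obtain ⟨t, ht, rfl⟩ := hW hx
  obtain ⟨V1, hV1, W1, hW1, ht1, h1⟩ := hs t ht
  have hle : ∀ V2 : T.Opens, V2 ≤ g ⁻¹ᵁ (g ''ᵁ V2) := fun V2 => (g.preimage_image_eq V2).ge
  have hW2 : g ''ᵁ V1 ≤ W := by
    rintro _ ⟨z, hz, rfl⟩
    exact hV (hV1 hz)
  have hW3 : g ''ᵁ V1 ≤ W1 := by
    rintro _ ⟨z, hz, rfl⟩
    exact hW1 hz
  refine ⟨g ''ᵁ V1, hW2, ⟨t, ht1, rfl⟩, ?_⟩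
  have key : ∀ x ∈ compareSpan g h B hW1, ∃ b ∈ B.obj (g ''ᵁ V1),
      A.compare g h (hle V1) b = x := by
    intro x hx
    induction hx using Submodule.span_induction with
    | mem x hx =>
      obtain ⟨b, hb, rfl⟩ := hx
      exact ⟨(A.pullback f').res hW3 b, B.res_mem _ hb, A.compare_res g h _ hW3 hW1 b⟩
    | zero => exact ⟨0, Submodule.zero_mem _, map_zero _⟩
    | add x y _ _ hx hy =>
      obtain ⟨b, hb, rfl⟩ := hx
      obtain ⟨b', hb', rfl⟩ := hy
      exact ⟨b + b', Submodule.add_mem _ hb hb', map_add _ _ _⟩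
    | smul c x _ hx =>
      obtain ⟨b, hb, rfl⟩ := hx
      obtain ⟨c, rfl⟩ := exists_opull_eq g (hle V1) c
      exact ⟨c • b, Submodule.smul_mem _ _ hb, A.compare_smul g h (hle V1) c b⟩
  obtain ⟨b, hb, hbs⟩ := key _ h1
  rw [res_compare, ← A.compare_res g h (hle V1) hW2] at hbs
  rwa [← compare_injective hA g h (hle V1) le_rfl hbs]

/-- Every section is locally in the image of the canonical map for an open immersion. -/
theorem exists_compare_eq (hA : A.IsLocallyFree n) (g : T ⟶ T') [IsOpenImmersion g]
    (h : g ≫ f' = f) {V : T.Opens} (s : (A.pullback f).Sec V) (t : T) (ht : t ∈ V) :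
    ∃ (V' : T.Opens) (hV' : V' ≤ V) (hle : V' ≤ g ⁻¹ᵁ (g ''ᵁ V')), t ∈ V' ∧
      ∃ b : (A.pullback f').Sec (g ''ᵁ V'), A.compare g h hle b = (A.pullback f).res hV' s := by
  obtain ⟨U, hU, a, ha⟩ := hA (f t)
  have hV1 : V ⊓ f ⁻¹ᵁ U ≤ f ⁻¹ᵁ U := inf_le_right
  have hle : V ⊓ f ⁻¹ᵁ U ≤ g ⁻¹ᵁ (g ''ᵁ (V ⊓ f ⁻¹ᵁ U)) := (g.preimage_image_eq _).ge
  have hW : g ''ᵁ (V ⊓ f ⁻¹ᵁ U) ≤ f' ⁻¹ᵁ U := by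
    subst h
    rintro _ ⟨z, hz, rfl⟩
    exact hz.2
  obtain ⟨y, hy⟩ := (A.isBasisOn_pullSec f ha hV1 _ le_rfl).2 ((A.pullback f).res inf_le_left s)
  choose y' hy' using fun j => exists_opull_eq g hle (y j)
  refine ⟨V ⊓ f ⁻¹ᵁ U, inf_le_left, hle, ⟨ht, hU⟩,
    comb le_rfl (fun j => A.pullSec f' hW (a j)) y', ?_⟩
  rw [compare_comb g h a hW hV1 le_rfl le_rfl hle, ← hy]
  simp only [hy']
  rfl

/-- Membership in a submodule may be tested after pullback to an open cover. -/
theorem mem_iff_forall_compare_mem (hA : A.IsLocallyFree n) {ι : Type*} {X : ι → Scheme.{u}}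
    (u : ∀ i, X i ⟶ T') [∀ i, IsOpenImmersion (u i)] {fX : ∀ i, X i ⟶ S}
    (h : ∀ i, u i ≫ f' = fX i) (hcov : ∀ t : T', ∃ i x, u i x = t) (B : (A.pullback f').Submod)
    {W : T'.Opens} (s : (A.pullback f').Sec W) :
    s ∈ B.obj W ↔
      ∀ i, A.compare (u i) (h i) (le_refl (u i ⁻¹ᵁ W)) s ∈ (B.pullback (u i) (h i)).obj _ := by
  constructor
  · intro hs i
    exact compare_mem _ _ _ _ hs
  · intro hs
    refine B.of_locally s fun t ht => ?_
    obtain ⟨i, x, rfl⟩ := hcov t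
    have hW : u i ''ᵁ (u i ⁻¹ᵁ W) ≤ W := (u i).image_preimage_le W
    refine ⟨u i ''ᵁ (u i ⁻¹ᵁ W), hW, ⟨x, ht, rfl⟩, ?_⟩
    refine mem_of_compare_mem hA (u i) (h i) (V := u i ⁻¹ᵁ W) ((u i).preimage_image_eq _).ge
      le_rfl B ?_
    exact hs i

end OpenImmersion

open Limits

/-! ### Gluing submodules along an open cover -/

section Glue

variable {S T' : Scheme.{u}} {A : AlgebraSheaf S} {f' : T' ⟶ S} {n : ℕ}
  {ι : Type*} {X : ι → Scheme.{u}} (u : ∀ i, X i ⟶ T') {fX : ∀ i, X i ⟶ S}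
  (h : ∀ i, u i ≫ f' = fX i)

/-- The sections whose image in `(f'u_i)^*𝒜` lies in `ℬ_i` for all `i`. For compatible submodules
`ℬ_i` on an open cover this is the submodule of `f'^*𝒜` glued from them. -/
def gluedSubmod (B : ∀ i, (A.pullback (fX i)).Submod) : (A.pullback f').Submod where
  obj W :=
    { carrier := {s | ∀ i, A.compare (u i) (h i) (le_refl (u i ⁻¹ᵁ W)) s ∈ (B i).obj (u i ⁻¹ᵁ W)}
      add_mem' := by
        intro s s' hs hs' i
        rw [map_add]
        exact Submodule.add_mem _ (hs i) (hs' i)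
      zero_mem' := by
        intro i
        rw [map_zero]
        exact Submodule.zero_mem _
      smul_mem' := by
        intro c s hs i
        rw [compare_smul]
        exact Submodule.smul_mem _ _ (hs i) }
  res_mem := by
    intro W W' hW s hs i
    exact (B i).res_mem (U := u i ⁻¹ᵁ W) (V := u i ⁻¹ᵁ W') (fun z hz => hW hz) (hs i)
  of_locally := by
    intro W s hs i
    refine (B i).of_locally _ fun x hx => ?_
    obtain ⟨V, hV, hxV, h1⟩ := hs (u i x) hx
    exact ⟨u i ⁻¹ᵁ V, fun z hz => hV hz, hxV, h1 i⟩

theorem gluedSubmod_pullback (hA : A.IsLocallyFree n) [∀ i, IsOpenImmersion (u i)]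
    (B : ∀ i, (A.pullback (fX i)).Submod)
    (hB : ∀ (i k : ι) (Z : Scheme.{u}) (p : Z ⟶ X i) (q : Z ⟶ X k) (fZ : Z ⟶ S)
      (hp : p ≫ fX i = fZ) (hq : q ≫ fX k = fZ), p ≫ u i = q ≫ u k →
      (B i).pullback p hp = (B k).pullback q hq) (i : ι) :
    (gluedSubmod u h B).pullback (u i) (h i) = B i := by
  refine Submod.ext' fun V => le_antisymm (Submod.pullback_obj_le _ _ _ _ ?_ V) ?_
  · intro W V hV b hb
    exact (B i).res_mem hV (hb i)
  · intro s hs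
    refine Submod.of_locally _ s fun t ht => ?_
    obtain ⟨V', hV', hle, htV, b, hb⟩ := exists_compare_eq hA (u i) (h i) s t ht
    refine ⟨V', hV', htV, ?_⟩
    rw [← hb]
    refine compare_mem _ _ _ _ fun k => ?_
    -- compare with `ℬ_i` on the intersection of the `i`-th and the `k`-th piece
    obtain ⟨Z, p, q, hq', hpq, hZ⟩ : ∃ (Z : Scheme.{u}) (p : Z ⟶ X i) (q : Z ⟶ X k),
        IsOpenImmersion q ∧ p ≫ u i = q ≫ u k ∧ ∀ x y, u i x = u k y → ∃ w, p w = x ∧ q w = y :=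
      ⟨_, Limits.pullback.fst (u i) (u k), Limits.pullback.snd (u i) (u k), inferInstance,
        Limits.pullback.condition, fun x y h => Scheme.Pullback.exists_preimage_pullback x y h⟩
    have hq : q ≫ fX k = p ≫ fX i := by
      rw [← h k, ← h i, ← Category.assoc, ← Category.assoc, hpq]
    have hcond := hB i k _ p q _ rfl hq hpq
    have hqV : q ⁻¹ᵁ (u k ⁻¹ᵁ (u i ''ᵁ V')) ≤ q ⁻¹ᵁ (u k ⁻¹ᵁ (u i ''ᵁ V')) := le_rfl
    refine mem_of_compare_mem hA q hq hqV ?_ (B k) ?_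
    · rintro x ⟨z, hz, hzx⟩
      obtain ⟨w, -, hw⟩ := hZ z x hzx
      refine ⟨w, ?_, hw⟩
      change u k (q w) ∈ u i ''ᵁ V'
      rw [hw]
      exact ⟨z, hz, hzx⟩
    · rw [← hcond]
      have hpV : q ⁻¹ᵁ (u k ⁻¹ᵁ (u i ''ᵁ V')) ≤ p ⁻¹ᵁ V' := by
        intro z hz
        have h1 : u k (q z) ∈ u i ''ᵁ V' := hz
        have h2 : u k (q z) = u i (p z) := by
          rw [← Scheme.Hom.comp_apply, ← Scheme.Hom.comp_apply, hpq]
        rw [h2] at h1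
        exact ((u i).apply_mem_image_iff (x := p z) (U := V')).1 h1
      have hall : (p ≫ u i) ≫ f' = p ≫ fX i := by rw [Category.assoc, h i]
      have hall' : (q ≫ u k) ≫ f' = p ≫ fX i := by rw [← hpq, hall]
      have e1 := A.compare_comp p rfl (u i) (h i) hall hle hpV
        (fun z hz => hle (hpV hz)) b
      have e2 := A.compare_comp q hq (u k) (h k) hall' (le_refl (u k ⁻¹ᵁ (u i ''ᵁ V'))) hqV
        (fun z hz => hz) b
      have e3 : A.compare (q ≫ u k) hall' (fun z hz => hz) b =
          A.compare (p ≫ u i) hall (fun z hz => hle (hpV hz)) b := by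
        have : ∀ (w : Z ⟶ T') (hw : p ≫ u i = w) (hall' : w ≫ f' = p ≫ fX i)
          (h1 : q ⁻¹ᵁ (u k ⁻¹ᵁ (u i ''ᵁ V')) ≤ w ⁻¹ᵁ (u i ''ᵁ V')),
          A.compare w hall' h1 b =
          A.compare (p ≫ u i) hall (fun z hz => hle (hpV hz)) b := by
          rintro _ rfl _ _
          rfl
        exact this _ hpq hall' _
      have e4 := e2.trans (e3.trans e1.symm)
      rw [hb] at e4
      rw [e4]
      exact compare_mem _ _ _ _ ((B i).res_mem _ hs)

/-- The property of having a locally free quotient is local. -/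
theorem Submod.quotientLocallyFree_of_cover (hA : A.IsLocallyFree n) [∀ i, IsOpenImmersion (u i)]
    (hcov : ∀ t : T', ∃ i x, u i x = t) {r : ℕ} (B : (A.pullback f').Submod)
    (hB : ∀ i, (B.pullback (u i) (h i)).QuotientLocallyFree r) : B.QuotientLocallyFree r := by
  refine Submod.quotientLocallyFree_of_isKernelOn (n := n) fun t => ?_
  obtain ⟨i, x, rfl⟩ := hcov t
  obtain ⟨U, V, hV, hxV, a, ha, L, E, hk⟩ := (hB i).exists_kernel hA x
  have hle : V ≤ u i ⁻¹ᵁ (u i ''ᵁ V) := ((u i).preimage_image_eq _).ge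
  have hW : u i ''ᵁ V ≤ f' ⁻¹ᵁ U := by
    rintro _ ⟨z, hz, rfl⟩
    have h1 := hV hz
    have h2 : fX i z = f' (u i z) := by rw [← h i]; rfl
    change f' (u i z) ∈ U
    rw [← h2]
    exact h1
  choose L' hL' using fun i' j => exists_opull_eq (u i) hle (L i' j)
  choose E' hE' using fun i' j => exists_opull_eq (u i) hle (E i' j)
  have hinj := opull_injective (u i) hle le_rfl
  have hL : (Matrix.of L').map (opull (u i) hle) = L := by ext i' j; exact hL' i' j
  have hE : (Matrix.of E').map (opull (u i) hle) = E := by ext i' j; exact hE' i' j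
  refine ⟨U, a, u i ''ᵁ V, hW, Matrix.of L', Matrix.of E', ha, ⟨x, hxV, rfl⟩, ?_, ?_⟩
  · have h1 : (Matrix.of L' * Matrix.of E').map (opull (u i) hle) = 1 := by
      rw [Matrix.map_mul, hL, hE, hk.mul_eq]
    ext i' j
    refine hinj ?_
    have h2 := congrFun (congrFun h1 i') j
    rw [Matrix.map_apply] at h2
    rw [h2, Matrix.one_apply, Matrix.one_apply, apply_ite (opull (u i) hle), map_one, map_zero]
  · intro W' hW' y
    have hVV : u i ⁻¹ᵁ W' ≤ V := by
      intro z hz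
      exact ((u i).apply_mem_image_iff (x := z) (U := V)).1 (hW' hz)
    have hWim : W' ≤ u i ''ᵁ (u i ⁻¹ᵁ W') := by
      intro z hz
      obtain ⟨z, -, rfl⟩ := hW' hz
      exact ⟨z, hz, rfl⟩
    have e1 : comb hW' (fun j => A.pullSec f' hW (a j)) y ∈ B.obj W' ↔
        A.compare (u i) (h i) (le_refl (u i ⁻¹ᵁ W'))
          (comb hW' (fun j => A.pullSec f' hW (a j)) y) ∈ (B.pullback (u i) (h i)).obj _ :=
      ⟨fun hs => compare_mem _ _ _ _ hs, fun hs => mem_of_compare_mem hA _ _ _ hWim B hs⟩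
    rw [e1, compare_comb (u i) (h i) a hW hV hW' hVV le_rfl, hk.mem_iff, ← hL,
      ← opull_mulVec (u i) hW' le_rfl hle hVV]
    have hinj' := opull_injective (u i) (le_refl (u i ⁻¹ᵁ W')) hWim
    constructor
    · intro h0
      funext i'
      exact hinj' ((congrFun h0 i').trans (map_zero _).symm)
    · intro h0
      rw [h0]
      funext i'
      exact map_zero _

end Glue

/-! ### The Grassmannian as a Zariski sheaf on all schemes -/

section Presheaf

variable {S : Scheme.{u}} {A : AlgebraSheaf S} {n : ℕ}

/-- A morphism `f : T ⟶ S` with a submodule of `f^*𝒜` with locally free quotient of rank `r`. -/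
abbrev GrPoint (A : AlgebraSheaf S) (r : ℕ) (T : Scheme.{u}) : Type u :=
  Σ f : T ⟶ S, {E : (A.pullback f).Submod // E.QuotientLocallyFree r}

theorem GrPoint.ext {r : ℕ} {T : Scheme.{u}} {x y : GrPoint A r T} (h : 𝟙 T ≫ y.1 = x.1)
    (h' : x.2.1 = y.2.1.pullback (𝟙 T) h) : x = y := by
  obtain ⟨f, E, hE⟩ := x
  obtain ⟨f', E', hE'⟩ := y
  dsimp only at h h'
  obtain rfl : f' = f := (Category.id_comp f').symm.trans h
  rw [Submod.pullback_id] at h'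
  subst h'
  rfl

/-- Equality of points given by pullbacks, in terms of submodules of the same sheaf. -/
theorem GrPoint.mk_eq_iff {r : ℕ} {T T₁ T₂ : Scheme.{u}} {f₁ : T₁ ⟶ S} {f₂ : T₂ ⟶ S}
    {g₁ : T ⟶ T₁} {g₂ : T ⟶ T₂} {E₁ : (A.pullback f₁).Submod} {E₂ : (A.pullback f₂).Submod}
    {fT : T ⟶ S} (h₁ : g₁ ≫ f₁ = fT) (h₂ : g₂ ≫ f₂ = fT)
    (hE₁ : (E₁.pullback g₁ rfl).QuotientLocallyFree r)
    (hE₂ : (E₂.pullback g₂ rfl).QuotientLocallyFree r) :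
    (⟨g₁ ≫ f₁, E₁.pullback g₁ rfl, hE₁⟩ : GrPoint A r T) = ⟨g₂ ≫ f₂, E₂.pullback g₂ rfl, hE₂⟩ ↔
      E₁.pullback g₁ h₁ = E₂.pullback g₂ h₂ := by
  subst h₁
  have key : ∀ (f : T ⟶ S) (h : g₂ ≫ f₂ = f) (h' : (E₂.pullback g₂ h).QuotientLocallyFree r),
      (⟨g₂ ≫ f₂, E₂.pullback g₂ rfl, hE₂⟩ : GrPoint A r T) = ⟨f, E₂.pullback g₂ h, h'⟩ := by
    rintro _ rfl _
    rfl
  have h3 : (E₂.pullback g₂ h₂).QuotientLocallyFree r := by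
    have : ∀ (f : T ⟶ S) (h : g₂ ≫ f₂ = f), (E₂.pullback g₂ h).QuotientLocallyFree r := by
      rintro _ rfl
      exact hE₂
    exact this _ h₂
  rw [key _ h₂ h3]
  constructor
  · intro h
    have := eq_of_heq (Sigma.mk.inj h).2
    exact congrArg Subtype.val this
  · intro h
    congr 1
    exact Subtype.ext h

/-- The functor `T ↦ GrPoint A r T` on all schemes. -/
def grPresheaf (hA : A.IsLocallyFree n) (r : ℕ) : Scheme.{u}ᵒᵖ ⥤ Type u where
  obj T := GrPoint A r T.unop
  map g := ↾fun x => ⟨g.unop ≫ x.1, x.2.1.pullback g.unop rfl, x.2.2.pullback hA _ _⟩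
  map_id T := by
    refine ConcreteCategory.hom_ext _ _ fun x => ?_
    exact GrPoint.ext (x := ⟨𝟙 T.unop ≫ x.1, x.2.1.pullback (𝟙 T.unop) rfl, _⟩) (y := x) rfl rfl
  map_comp {T₁ T₂ T₃} g g' := by
    refine ConcreteCategory.hom_ext _ _ fun x => ?_
    change (⟨(g'.unop ≫ g.unop) ≫ x.1, x.2.1.pullback (g'.unop ≫ g.unop) rfl, _⟩ :
      GrPoint A r T₃.unop) = ⟨g'.unop ≫ g.unop ≫ x.1,
        (x.2.1.pullback g.unop rfl).pullback g'.unop rfl, _⟩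
    refine (GrPoint.mk_eq_iff rfl (Category.assoc _ _ _).symm _ _).2 ?_
    exact Submod.pullback_comp _ _ _ _ _ _

theorem grPresheaf_map_eq_iff (hA : A.IsLocallyFree n) (r : ℕ) {T T₁ T₂ : Scheme.{u}}
    {g₁ : T ⟶ T₁} {g₂ : T ⟶ T₂} {x₁ : GrPoint A r T₁} {x₂ : GrPoint A r T₂} {fT : T ⟶ S}
    (h₁ : g₁ ≫ x₁.1 = fT) (h₂ : g₂ ≫ x₂.1 = fT) :
    (grPresheaf hA r).map g₁.op x₁ = (grPresheaf hA r).map g₂.op x₂ ↔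
      x₁.2.1.pullback g₁ h₁ = x₂.2.1.pullback g₂ h₂ :=
  GrPoint.mk_eq_iff h₁ h₂ _ _

theorem grPresheaf_map_eq_iff' (hA : A.IsLocallyFree n) (r : ℕ) {T T₁ : Scheme.{u}}
    {g₁ : T ⟶ T₁} {x₁ : GrPoint A r T₁} {x : GrPoint A r T} (h₁ : g₁ ≫ x₁.1 = x.1) :
    (grPresheaf hA r).map g₁.op x₁ = x ↔ x₁.2.1.pullback g₁ h₁ = x.2.1 := by
  have h := grPresheaf_map_eq_iff hA r (g₂ := 𝟙 T) (x₂ := x) h₁ (Category.id_comp _)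
  rw [Submod.pullback_id] at h
  have h1 : (grPresheaf hA r).map (𝟙 T).op x = x := (grPresheaf hA r).map_id_apply (op T) x
  rwa [h1] at h

theorem grPresheaf_isSheaf (hA : A.IsLocallyFree n) (r : ℕ) :
    Presieve.IsSheaf Scheme.zariskiTopology (grPresheaf hA r) := by
  rw [Precoverage.isSheaf_toGrothendieck_iff_of_isStableUnderBaseChange]
  rintro Y R hR x hx
  obtain ⟨(𝓤 : Scheme.OpenCover Y), rfl⟩ := Scheme.exists_cover_of_mem_pretopology hR
  let xj : ∀ j, GrPoint A r (𝓤.X j) := fun j => x (𝓤.f j) (.mk _)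
  have hxj : ∀ (i j : 𝓤.I₀) (Z : Scheme.{u}) (p : Z ⟶ 𝓤.X i) (q : Z ⟶ 𝓤.X j),
      p ≫ 𝓤.f i = q ≫ 𝓤.f j →
      (grPresheaf hA r).map p.op (xj i) = (grPresheaf hA r).map q.op (xj j) := by
    intro i j Z p q h
    exact hx p q (.mk i) (.mk j) h
  let F : Y ⟶ S := 𝓤.glueMorphisms (fun j => (xj j).1) fun i j =>
    congrArg Sigma.fst (hxj i j _ _ _ Limits.pullback.condition)
  have hF : ∀ j, 𝓤.f j ≫ F = (xj j).1 := fun j => 𝓤.ι_glueMorphisms _ _ j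
  have hcov : ∀ t : Y, ∃ i z, 𝓤.f i z = t := fun t => ⟨𝓤.idx t, 𝓤.covers t⟩
  let B : (A.pullback F).Submod := gluedSubmod (fX := fun j => (xj j).1) 𝓤.f hF
    (fun j => (xj j).2.1)
  have hB : ∀ j, B.pullback (𝓤.f j) (hF j) = (xj j).2.1 := by
    refine gluedSubmod_pullback (fX := fun j => (xj j).1) 𝓤.f hF hA (fun j => (xj j).2.1) ?_
    intro i k Z p q fZ hp hq hpq
    exact (grPresheaf_map_eq_iff hA r hp hq).1 (hxj i k Z p q hpq)
  have hBq : B.QuotientLocallyFree r :=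
    Submod.quotientLocallyFree_of_cover 𝓤.f hF hA hcov B fun j => by rw [hB]; exact (xj j).2.2
  refine ⟨(⟨F, B, hBq⟩ : GrPoint A r Y), ?_, ?_⟩
  · rintro Z e ⟨j⟩
    exact (grPresheaf_map_eq_iff' hA r (hF j)).2 (hB j)
  · intro y hy
    have hy' : ∀ j, (grPresheaf hA r).map (𝓤.f j).op y = xj j := fun j => hy (𝓤.f j) (.mk j)
    have hyF : y.1 = F := by
      refine 𝓤.hom_ext _ _ fun j => ?_
      rw [hF]
      exact congrArg Sigma.fst (hy' j)
    obtain ⟨yf, yE, hyE⟩ := y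
    dsimp only at hyF
    subst hyF
    have h1 : ∀ j, yE.pullback (𝓤.f j) (hF j) = (xj j).2.1 := fun j =>
      (grPresheaf_map_eq_iff' hA r (x₁ := ⟨F, yE, hyE⟩) (hF j)).1 (hy' j)
    have h2 : yE = B := by
      refine Submod.ext' fun W => ?_
      ext s
      rw [mem_iff_forall_compare_mem hA 𝓤.f hF hcov yE s,
        mem_iff_forall_compare_mem hA 𝓤.f hF hcov B s]
      simp only [h1, hB]
    subst h2
    rfl

end Presheaf

/-! ### Matrices with prescribed columns -/

section Matrices

variable {n r : ℕ}

/-- The indices of the entries of an `r × n` matrix outside the columns in the range of `I`. -/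
abbrev FreeEntries (I : Fin r ↪ Fin n) : Type u :=
  ULift.{u} (Fin r × {j : Fin n // j ∉ Set.range I})

/-- The matrix whose multiplication on the right selects the columns `I 0, I 1, …`. -/
def columnSelector (R : Type u) [CommRing R] (I : Fin r ↪ Fin n) : Matrix (Fin n) (Fin r) R :=
  Matrix.of fun j k => if I k = j then 1 else 0

open Classical in
/-- The `r × n` matrix whose columns `I 0, I 1, …` form the unit matrix, with the given remaining
entries. -/
def normalizedMatrix {R : Type u} [CommRing R] (I : Fin r ↪ Fin n) (c : FreeEntries.{u} I → R) :
    Matrix (Fin r) (Fin n) R :=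
  Matrix.of fun i j => if h : j ∈ Set.range I then (if I i = j then 1 else 0)
    else c ⟨i, ⟨j, h⟩⟩

variable {R R' : Type u} [CommRing R] [CommRing R']

theorem mul_columnSelector (I : Fin r ↪ Fin n) (L : Matrix (Fin r) (Fin n) R) :
    L * columnSelector R I = L.submatrix id I := by
  ext i k
  simp [columnSelector, Matrix.mul_apply]

theorem normalizedMatrix_mul (I : Fin r ↪ Fin n) (c : FreeEntries.{u} I → R) :
    normalizedMatrix I c * columnSelector R I = 1 := by
  rw [mul_columnSelector]
  ext i k
  simp [normalizedMatrix, Matrix.one_apply]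

theorem eq_normalizedMatrix {I : Fin r ↪ Fin n} {L : Matrix (Fin r) (Fin n) R}
    (h : L * columnSelector R I = 1) :
    L = normalizedMatrix I (fun p : FreeEntries.{u} I => L p.down.1 p.down.2) := by
  rw [mul_columnSelector] at h
  ext i j
  simp only [normalizedMatrix, Matrix.of_apply]
  split_ifs with h1 h2
  · subst h2
    simpa using congrFun (congrFun h i) i
  · obtain ⟨k, rfl⟩ := h1
    have hk : i ≠ k := fun hk => h2 (by rw [hk])
    simpa [Matrix.one_apply, hk] using congrFun (congrFun h i) k
  · rfl

theorem normalizedMatrix_map (φ : R →+* R') (I : Fin r ↪ Fin n) (c : FreeEntries.{u} I → R) :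
    (normalizedMatrix I c).map φ = normalizedMatrix I (fun p => φ (c p)) := by
  ext i j
  simp only [normalizedMatrix, Matrix.map_apply, Matrix.of_apply]
  split_ifs <;> simp

theorem normalizedMatrix_injective (I : Fin r ↪ Fin n) :
    Function.Injective (normalizedMatrix (R := R) I) := by
  intro c c' h
  funext p
  have h1 := congrFun (congrFun h p.down.1) p.down.2
  simpa only [normalizedMatrix, Matrix.of_apply, dif_neg p.down.2.2] using h1

theorem columnSelector_map (φ : R →+* R') (I : Fin r ↪ Fin n) :
    (columnSelector R I).map φ = columnSelector R' I := by
  ext i j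
  simp [columnSelector, apply_ite φ]

/-- The expansion of the determinant of a product in terms of square submatrices of the first
factor. -/
theorem det_mul_eq_sum (L : Matrix (Fin r) (Fin n) R) (E : Matrix (Fin n) (Fin r) R) :
    (L * E).det = ∑ I : Fin r → Fin n, (∏ k, E (I k) k) * (L.submatrix id I).det := by
  have h1 : (L * E)ᵀ = fun k => ∑ j, E j k • Lᵀ j := by
    funext k i
    simp [Matrix.mul_apply, mul_comm]
  have h2 : ∀ M : Matrix (Fin r) (Fin r) R, M.det = Matrix.detRowAlternating Mᵀ := fun M =>
    (Matrix.det_transpose M).symm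
  rw [h2, h1]
  have h3 := (Matrix.detRowAlternating (n := Fin r) (R := R)).toMultilinearMap.map_sum
    (fun k j => E j k • Lᵀ j)
  refine h3.trans (Finset.sum_congr rfl fun I _ => ?_)
  refine (MultilinearMap.map_smul_univ _ _ _).trans ?_
  rw [h2]
  rfl

/-- If `L` has a right inverse over a local ring, then some maximal minor of `L` is invertible. -/
theorem exists_isUnit_det_submatrix [IsLocalRing R] {L : Matrix (Fin r) (Fin n) R}
    {E : Matrix (Fin n) (Fin r) R} (h : L * E = 1) :
    ∃ I : Fin r ↪ Fin n, IsUnit (L.submatrix id I).det := by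
  have h1 : IsUnit (∑ I : Fin r → Fin n, (∏ k, E (I k) k) * (L.submatrix id I).det) := by
    rw [← det_mul_eq_sum, h, Matrix.det_one]
    exact isUnit_one
  obtain ⟨I, hI⟩ : ∃ I : Fin r → Fin n, IsUnit (L.submatrix id I).det := by
    by_contra! hI
    refine (IsLocalRing.mem_maximalIdeal _).1 (Ideal.sum_mem _ fun I _ => ?_) h1
    exact Ideal.mul_mem_left _ _ ((IsLocalRing.mem_maximalIdeal _).2 (hI I))
  refine ⟨⟨I, fun k l hkl => ?_⟩, hI⟩
  by_contra hne
  have h0 : (L.submatrix id I).det = 0 :=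
    Matrix.det_zero_of_column_eq hne fun i => by simp [hkl]
  exact not_isUnit_zero (h0 ▸ hI)

end Matrices

/-! ### The charts of the Grassmannian -/

section Chart

variable {S : Scheme.{u}} {A : AlgebraSheaf S} {n r : ℕ}

/-- The data indexing the standard charts of the Grassmannian: an open subset `U` of `S`, a basis
`a` of `𝒜` over `U` and a choice of `r` of the basis elements. -/
structure GrChart (A : AlgebraSheaf S) (n r : ℕ) : Type u where
  /-- the open subset -/
  U : S.Opens
  /-- the basis -/
  a : Fin n → A.Sec U
  isBasisOn : A.IsBasisOn a
  /-- the indices of the chosen basis elements -/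
  I : Fin r ↪ Fin n

/-- Over `W`, the point `x` lies in the chart: the chosen basis elements form a basis of the
quotient of `𝒜`. -/
def GrChart.Contains (χ : GrChart A n r) {T : Scheme.{u}} (x : GrPoint A r T)
    (W : T.Opens) : Prop :=
  ∃ (hW : W ≤ x.1 ⁻¹ᵁ χ.U) (L : Matrix (Fin r) (Fin n) Γ(T, W)),
    IsKernelOn x.2.1 (fun j => A.pullSec x.1 hW (χ.a j)) L (columnSelector Γ(T, W) χ.I)

variable {T T' : Scheme.{u}} (χ : GrChart A n r)

theorem GrChart.Contains.map (hA : A.IsLocallyFree n) {χ : GrChart A n r} {x : GrPoint A r T'}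
    {W : T'.Opens} (h : χ.Contains x W) (g : T ⟶ T') {V : T.Opens} (hV : V ≤ g ⁻¹ᵁ W) :
    χ.Contains ((grPresheaf hA r).map g.op x) V := by
  obtain ⟨hW, L, hk⟩ := h
  refine ⟨fun z hz => hW (hV hz), L.map (opull g hV), ?_⟩
  have := hk.pullback g rfl χ.isBasisOn hW hV (fun z hz => hW (hV hz))
  rwa [columnSelector_map] at this

theorem GrChart.Contains.mono {χ : GrChart A n r} {x : GrPoint A r T}
    {W W' : T.Opens} (h : χ.Contains x W) (hW' : W' ≤ W) : χ.Contains x W' := by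
  obtain ⟨hW, L, hk⟩ := h
  refine ⟨hW'.trans hW, L.map (ores hW'), ?_⟩
  have := hk.res hW'
  rwa [columnSelector_map] at this

theorem GrChart.contains_of_locally {x : GrPoint A r T} {V : T.Opens}
    (h : ∀ t ∈ V, ∃ W, t ∈ W ∧ χ.Contains x W) : χ.Contains x V := by
  have h' : ∀ t ∈ V, ∃ (W : T.Opens) (hWV : W ≤ V), t ∈ W ∧ χ.Contains x W := by
    intro t ht
    obtain ⟨W, htW, hW⟩ := h t ht
    exact ⟨W ⊓ V, inf_le_right, ⟨htW, ht⟩, hW.mono inf_le_left⟩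
  choose W hWV htW hWU L hk using h'
  have huniq : ∀ t (ht : t ∈ V) t' (ht' : t' ∈ V) (z : T) (hz : z ∈ W t ht) (hz' : z ∈ W t' ht')
      i j, ogerm _ z hz (L t ht i j) = ogerm _ z hz' (L t' ht' i j) := by
    intro t ht t' ht' z hz hz' i j
    have k1 := (hk t ht).res (inf_le_left : W t ht ⊓ W t' ht' ≤ _)
    have k2 := (hk t' ht').res (inf_le_right : W t ht ⊓ W t' ht' ≤ _)
    rw [columnSelector_map] at k1 k2
    have h1 := congrFun (congrFun (k1.unique k2) i) j
    have hzz : z ∈ W t ht ⊓ W t' ht' := ⟨hz, hz'⟩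
    have h2 := congrArg (ogerm (W t ht ⊓ W t' ht') z hzz) h1
    rw [Matrix.map_apply, Matrix.map_apply, ogerm_ores, ogerm_ores] at h2
    exact h2.symm
  have hglue : ∀ i j, ∃ c : Γ(T, V), ∀ t (ht : t ∈ V),
      ogerm V t ht c = ogerm _ t (htW t ht) (L t ht i j) := by
    intro i j
    refine exists_of_local_germs V (fun t ht => ogerm _ t (htW t ht) (L t ht i j)) fun t ht => ?_
    exact ⟨W t ht, hWV t ht, htW t ht, L t ht i j, fun y hy => huniq _ _ _ _ _ _ _ _ _⟩
  choose c hc using hglue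
  have hres : ∀ t (ht : t ∈ V), (Matrix.of c).map (ores (hWV t ht)) = L t ht := by
    intro t ht
    ext i j
    refine ogerm_ext _ _ fun z hz => ?_
    rw [Matrix.map_apply, ogerm_ores, Matrix.of_apply, hc]
    exact huniq _ _ _ _ _ _ _ _ _
  refine ⟨fun t ht => hWU t ht (htW t ht), Matrix.of c, isKernelOn_of_locally ?_ ?_⟩
  · ext i k
    refine ogerm_ext _ _ fun t ht => ?_
    have h1 := congrFun (congrFun (hk t ht).mul_eq i) k
    rw [← hres t ht, ← columnSelector_map (ores (hWV t ht)), ← Matrix.map_mul,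
      ← Matrix.map_one (ores (hWV t ht)) (map_zero _) (map_one _)] at h1
    have h2 := congrArg (ogerm _ t (htW t ht)) h1
    rwa [Matrix.map_apply, Matrix.map_apply, ogerm_ores, ogerm_ores] at h2
  · intro t ht
    refine ⟨W t ht, hWV t ht, htW t ht, ?_⟩
    rw [hres t ht, columnSelector_map]
    exact hk t ht

/-- Near a point at which the minor of the matrix `L` given by the columns `I` is invertible, `x`
lies in the chart. -/
theorem GrChart.exists_contains_of_isUnit {x : GrPoint A r T} {W : T.Opens} (hW : W ≤ x.1 ⁻¹ᵁ χ.U)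
    {L : Matrix (Fin r) (Fin n) Γ(T, W)} {E : Matrix (Fin n) (Fin r) Γ(T, W)}
    (hk : IsKernelOn x.2.1 (fun j => A.pullSec x.1 hW (χ.a j)) L E) (t : T) (ht : t ∈ W)
    (hu : IsUnit (ogerm W t ht (L.submatrix id χ.I).det)) : ∃ W', t ∈ W' ∧ χ.Contains x W' := by
  have hle : T.basicOpen (L.submatrix id χ.I).det ≤ W := T.basicOpen_le _
  refine ⟨T.basicOpen (L.submatrix id χ.I).det, (T.mem_basicOpen _ t ht).2 hu, hle.trans hW, ?_⟩
  have hk' := hk.res hle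
  have hunit : IsUnit (((L.map (ores hle)).submatrix id χ.I).det) := by
    have h1 : IsUnit (ores hle (L.submatrix id χ.I).det) :=
      RingedSpace.isUnit_res_basicOpen _ _
    rwa [RingHom.map_det] at h1
  set M := (L.map (ores hle)).submatrix id χ.I with hM
  have h1 : M⁻¹ * M = 1 := Matrix.nonsing_inv_mul M hunit
  have h2 : M * M⁻¹ = 1 := Matrix.mul_nonsing_inv M hunit
  refine ⟨M⁻¹ * L.map (ores hle), hk'.mul_left h2 ?_⟩
  rw [Matrix.mul_assoc, mul_columnSelector, ← hM, h1]

/-- In terms of a given basis of `𝒜` near a point of `S`, a submodule with locally free quotient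
is locally the kernel of a split matrix. -/
theorem Submod.QuotientLocallyFree.exists_isKernelOn {f : T ⟶ S} {B : (A.pullback f).Submod}
    (hB : B.QuotientLocallyFree r) {U : S.Opens} {a : Fin n → A.Sec U} (ha : A.IsBasisOn a)
    (t : T) (ht : f t ∈ U) :
    ∃ (W : T.Opens) (hW : W ≤ f ⁻¹ᵁ U), t ∈ W ∧ ∃ (L : Matrix (Fin r) (Fin n) Γ(T, W))
        (E : Matrix (Fin n) (Fin r) Γ(T, W)), IsKernelOn B (fun j => A.pullSec f hW (a j)) L E := by
  obtain ⟨W, hW, e, he⟩ := hB t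
  have hle : W ⊓ f ⁻¹ᵁ U ≤ f ⁻¹ᵁ U := inf_le_right
  refine ⟨W ⊓ f ⁻¹ᵁ U, hle, ⟨hW, ht⟩, ?_⟩
  refine AlgebraSheaf.exists_isKernelOn (A.isBasisOn_pullSec f ha hle)
    (e := fun i => (A.pullback f).res inf_le_left (e i)) ?_
  intro V hV
  have := he V (hV.trans inf_le_left)
  simp only [comb, res_res]
  exact this

/-- Every point of the Grassmannian locally lies in some chart. -/
theorem GrChart.exists_contains (hA : A.IsLocallyFree n) (x : GrPoint A r T) (t : T) :
    ∃ (χ : GrChart A n r) (W : T.Opens), t ∈ W ∧ χ.Contains x W := by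
  obtain ⟨U, hU, a, ha⟩ := hA (x.1 t)
  obtain ⟨W, hW, ht, L, E, hk⟩ := x.2.2.exists_isKernelOn ha t hU
  have h1 := map_mul_map (ogerm W t ht) hk.mul_eq
  obtain ⟨I, hI⟩ := exists_isUnit_det_submatrix h1
  let χ : GrChart A n r := ⟨U, a, ha, I⟩
  refine ⟨χ, χ.exists_contains_of_isUnit hW hk t ht ?_⟩
  rw [RingHom.map_det]
  exact hI

/-- Being in a chart is an open condition: if the pullback of `x` along `g` lies in a chart, then
so does `x` near the image of `g`. -/
theorem GrChart.exists_contains_of_map (hA : A.IsLocallyFree n) {x : GrPoint A r T'} (g : T ⟶ T')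
    (h : χ.Contains ((grPresheaf hA r).map g.op x) ⊤) (t : T) :
    ∃ W, g t ∈ W ∧ χ.Contains x W := by
  obtain ⟨hU, L', hk'⟩ := h
  have hgU : x.1 (g t) ∈ χ.U := hU (show t ∈ ⊤ from trivial)
  obtain ⟨W, hW, ht, L, E, hk⟩ := x.2.2.exists_isKernelOn χ.isBasisOn (g t) hgU
  refine χ.exists_contains_of_isUnit hW hk (g t) ht ?_
  have hle : g ⁻¹ᵁ W ≤ (g ≫ x.1) ⁻¹ᵁ χ.U := fun z hz => hW hz
  have k1 := hk.pullback g rfl χ.isBasisOn hW le_rfl hle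
  have k2 := hk'.res (le_top : g ⁻¹ᵁ W ≤ ⊤)
  -- `1 = L' J = (L' E) (L J)` on `g⁻¹ W`, where `J` selects the columns of the chart
  have h3 := k1.eq_mul k2
  have h4 := k2.mul_eq
  rw [h3, columnSelector_map, Matrix.mul_assoc, mul_columnSelector] at h4
  have h5 := congrArg Matrix.det h4
  rw [Matrix.det_mul, Matrix.det_one, mul_comm] at h5
  have h6 : ((L.map (opull g (le_refl (g ⁻¹ᵁ W)))).submatrix id χ.I).det =
      opull g (le_refl (g ⁻¹ᵁ W)) (L.submatrix id χ.I).det := by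
    rw [RingHom.map_det]
    rfl
  rw [h6] at h5
  have h7 := (IsUnit.of_mul_eq_one _ h5).map (ogerm (g ⁻¹ᵁ W) t ht)
  have h8 := (congrArg IsUnit (ogerm_opull g (le_refl (g ⁻¹ᵁ W)) t ht _)).mp h7
  exact (isUnit_map_iff (g.stalkMap t).hom _).1 h8

end Chart

/-! ### Representability of the Grassmannian -/

section Representable

variable {S : Scheme.{u}} {A : AlgebraSheaf S} {n r : ℕ}

theorem opull_top {T T' : Scheme.{u}} (g : T ⟶ T') (h : (⊤ : T.Opens) ≤ g ⁻¹ᵁ ⊤) (c : Γ(T', ⊤)) :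
    opull g h c = g.appTop.hom c := by
  have : g.appLE ⊤ ⊤ h = g.appTop := by
    rw [Scheme.Hom.appTop, Scheme.Hom.app_eq_appLE]
    rfl
  exact congrArg (fun φ => φ.hom c) this

theorem grPresheaf_map_comp (hA : A.IsLocallyFree n) (r : ℕ) {T₁ T₂ T₃ : Scheme.{u}}
    (g : T₁ ⟶ T₂) (k : T₂ ⟶ T₃) (x : GrPoint A r T₃) : (grPresheaf hA r).map (g ≫ k).op x =
      (grPresheaf hA r).map g.op ((grPresheaf hA r).map k.op x) :=
  (grPresheaf hA r).map_comp_apply k.op g.op x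

variable (χ : GrChart A n r)

/-- The chart itself: an affine space over `U`, whose coordinates are the entries of a normalized
matrix outside the unit columns. -/
def GrChart.scheme : Scheme.{u} := 𝔸(FreeEntries.{u} χ.I; χ.U.toScheme)

/-- The structure morphism of a chart. -/
def GrChart.proj : χ.scheme ⟶ S := (𝔸(FreeEntries.{u} χ.I; χ.U.toScheme) ↘ χ.U.toScheme) ≫ χ.U.ι

theorem GrChart.top_le : (⊤ : χ.scheme.Opens) ≤ χ.proj ⁻¹ᵁ χ.U := by
  intro x _
  exact ((𝔸(FreeEntries.{u} χ.I; χ.U.toScheme) ↘ χ.U.toScheme) x).2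

/-- The coordinate functions on a chart. -/
def GrChart.coord (p : FreeEntries.{u} χ.I) : Γ(χ.scheme, ⊤) := AffineSpace.coord _ p

theorem GrChart.hom_ext {T : Scheme.{u}} {g g' : T ⟶ χ.scheme} (h : g ≫ χ.proj = g' ≫ χ.proj)
    (h' : ∀ p, g.appTop.hom (χ.coord p) = g'.appTop.hom (χ.coord p)) : g = g' := by
  refine AffineSpace.hom_ext ?_ h'
  refine (cancel_mono χ.U.ι).1 ?_
  exact (Category.assoc _ _ _).trans (h.trans (Category.assoc _ _ _).symm)

theorem GrChart.exists_hom {T : Scheme.{u}} (f : T ⟶ S) (hf : (⊤ : T.Opens) ≤ f ⁻¹ᵁ χ.U)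
    (c : FreeEntries.{u} χ.I → Γ(T, ⊤)) :
    ∃ g : T ⟶ χ.scheme, g ≫ χ.proj = f ∧ ∀ p, g.appTop.hom (χ.coord p) = c p := by
  have hr : Set.range f ⊆ Set.range χ.U.ι := by
    rintro _ ⟨t, rfl⟩
    rw [Scheme.Opens.range_ι]
    exact hf (show t ∈ ⊤ from trivial)
  refine ⟨AffineSpace.homOfVector (IsOpenImmersion.lift χ.U.ι f hr) c, ?_, ?_⟩
  · exact (AffineSpace.homOfVector_over_assoc _ c χ.U.ι).trans (IsOpenImmersion.lift_fac _ _ _)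
  · intro p
    exact AffineSpace.homOfVector_appTop_coord _ _ _

/-- The matrix of coordinate functions on a chart. -/
def GrChart.matrix : Matrix (Fin r) (Fin n) Γ(χ.scheme, ⊤) := normalizedMatrix χ.I χ.coord

theorem GrChart.isBasisOn_top : (A.pullback χ.proj).IsBasisOn
    (fun j => A.pullSec χ.proj χ.top_le (χ.a j)) :=
  A.isBasisOn_pullSec χ.proj χ.isBasisOn χ.top_le

theorem GrChart.isKernelOn : IsKernelOn (kernelSubmod χ.isBasisOn_top χ.matrix)
    (fun j => A.pullSec χ.proj χ.top_le (χ.a j)) χ.matrix (columnSelector _ χ.I) :=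
  isKernelOn_kernelSubmod _ (normalizedMatrix_mul _ _)

/-- The point of the Grassmannian over a chart: the kernel of the matrix of coordinates. -/
def GrChart.point : GrPoint A r χ.scheme :=
  ⟨χ.proj, kernelSubmod χ.isBasisOn_top χ.matrix,
    Submod.quotientLocallyFree_of_isKernelOn (n := n) fun _ =>
      ⟨χ.U, χ.a, ⊤, χ.top_le, _, _, χ.isBasisOn, trivial, χ.isKernelOn⟩⟩

theorem GrChart.isKernelOn_pullback {T : Scheme.{u}} (g : T ⟶ χ.scheme) {f : T ⟶ S}
    (h : g ≫ χ.proj = f) (hf : (⊤ : T.Opens) ≤ f ⁻¹ᵁ χ.U) :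
    IsKernelOn (χ.point.2.1.pullback g h) (fun j => A.pullSec f hf (χ.a j))
      (normalizedMatrix χ.I (fun p => g.appTop.hom (χ.coord p))) (columnSelector _ χ.I) := by
  have h1 : (⊤ : T.Opens) ≤ g ⁻¹ᵁ ⊤ := le_rfl
  have := χ.isKernelOn.pullback g h χ.isBasisOn χ.top_le h1 hf
  rw [columnSelector_map, GrChart.matrix, normalizedMatrix_map] at this
  simp only [opull_top] at this
  exact this

theorem GrChart.contains_point : χ.Contains χ.point ⊤ := ⟨χ.top_le, χ.matrix, χ.isKernelOn⟩

/-- A point which lies in a chart comes from a morphism to the chart. -/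
theorem GrChart.Contains.exists_map_eq (hA : A.IsLocallyFree n) {χ : GrChart A n r}
    {T : Scheme.{u}} {x : GrPoint A r T} (h : χ.Contains x ⊤) :
    ∃ g : T ⟶ χ.scheme, (grPresheaf hA r).map g.op χ.point = x := by
  obtain ⟨hf, L, hk⟩ := h
  obtain ⟨g, hg, hc⟩ := χ.exists_hom x.1 hf
    (fun p : FreeEntries.{u} χ.I => L p.down.1 p.down.2)
  refine ⟨g, (grPresheaf_map_eq_iff' hA r hg).2 ?_⟩
  have h1 := χ.isKernelOn_pullback g hg hf
  simp only [hc] at h1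
  rw [← eq_normalizedMatrix hk.mul_eq] at h1
  exact h1.submod_eq (A.isBasisOn_pullSec _ χ.isBasisOn hf) hk

theorem GrChart.map_point_injective (hA : A.IsLocallyFree n) {T : Scheme.{u}}
    {g g' : T ⟶ χ.scheme}
    (h : (grPresheaf hA r).map g.op χ.point = (grPresheaf hA r).map g'.op χ.point) : g = g' := by
  have hp : g ≫ χ.proj = g' ≫ χ.proj := congrArg Sigma.fst h
  refine χ.hom_ext hp fun p => ?_
  have hE := (grPresheaf_map_eq_iff hA r hp rfl).1 h
  have hf : (⊤ : T.Opens) ≤ (g' ≫ χ.proj) ⁻¹ᵁ χ.U := fun z _ => χ.top_le trivial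
  have h1 := χ.isKernelOn_pullback g hp hf
  have h2 := χ.isKernelOn_pullback g' rfl hf
  exact congrFun (normalizedMatrix_injective _ (h2.unique (hE ▸ h1))) p

/-- The morphism from a chart to the Grassmannian. -/
def GrChart.hom (hA : A.IsLocallyFree n) : yoneda.obj χ.scheme ⟶ grPresheaf hA r :=
  yonedaEquiv.symm χ.point

theorem GrChart.hom_presheaf (hA : A.IsLocallyFree n) :
    IsOpenImmersion.presheaf (χ.hom hA) := by
  refine MorphismProperty.relative.of_exists fun T x' => ?_
  obtain ⟨x, rfl⟩ := yonedaEquiv.symm.surjective x'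
  change GrPoint A r T at x
  -- the largest open subset of `T` over which `x` lies in the chart
  let V : T.Opens := sSup {W | χ.Contains x W}
  have hV : χ.Contains x V := by
    refine χ.contains_of_locally fun t ht => ?_
    obtain ⟨W, hW, htW⟩ := Opens.mem_sSup.1 ht
    exact ⟨W, htW, hW⟩
  have hVι : (⊤ : V.toScheme.Opens) ≤ V.ι ⁻¹ᵁ V := fun z _ => z.2
  obtain ⟨g, hg⟩ := (hV.map hA V.ι hVι).exists_map_eq hA
  refine ⟨V.toScheme, yoneda.map g, V.ι, ?_, inferInstance⟩
  refine IsPullback.of_forall_isPullback_app fun T' => ?_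
  rw [Types.isPullback_iff]
  refine ⟨?_, ?_, ?_⟩
  · refine ConcreteCategory.hom_ext _ _ fun k => ?_
    change (grPresheaf hA r).map (k ≫ g).op χ.point = (grPresheaf hA r).map (k ≫ V.ι).op x
    exact (grPresheaf_map_comp hA r k g _).trans ((congrArg _ hg).trans
      (grPresheaf_map_comp hA r k V.ι x).symm)
  · rintro k k' ⟨-, hk⟩
    change k ≫ V.ι = k' ≫ V.ι at hk
    exact (cancel_mono V.ι).1 hk
  · intro k₁ k₂ hk
    change T'.unop ⟶ χ.scheme at k₁
    change T'.unop ⟶ T at k₂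
    change (grPresheaf hA r).map k₁.op χ.point = (grPresheaf hA r).map k₂.op x at hk
    have hc : χ.Contains ((grPresheaf hA r).map k₂.op x) ⊤ := by
      rw [← hk]
      exact χ.contains_point.map hA k₁ le_rfl
    have hr : Set.range k₂ ⊆ Set.range V.ι := by
      rintro _ ⟨t, rfl⟩
      rw [Scheme.Opens.range_ι]
      obtain ⟨W, htW, hW⟩ := χ.exists_contains_of_map hA k₂ hc t
      exact Opens.mem_sSup.2 ⟨W, hW, htW⟩
    refine ⟨IsOpenImmersion.lift V.ι k₂ hr, ?_, IsOpenImmersion.lift_fac _ _ _⟩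
    refine χ.map_point_injective hA ?_
    change (grPresheaf hA r).map (IsOpenImmersion.lift V.ι k₂ hr ≫ g).op χ.point = _
    refine (grPresheaf_map_comp hA r _ g _).trans ((congrArg _ hg).trans ?_)
    refine (grPresheaf_map_comp hA r _ V.ι x).symm.trans ?_
    rw [IsOpenImmersion.lift_fac]
    exact hk.symm

theorem grChart_isLocallySurjective (hA : A.IsLocallyFree n) :
    Presheaf.IsLocallySurjective Scheme.zariskiTopology
      (Sigma.desc fun χ : GrChart A n r => χ.hom hA) where
  imageSieve_mem {T} x := by
    change GrPoint A r T at x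
    have hloc := fun t : T => GrChart.exists_contains hA x t
    choose χ W htW hW using hloc
    have hsup : iSup W = ⊤ := by
      refine le_antisymm le_top fun t _ => ?_
      exact Opens.mem_iSup.2 ⟨t, htW t⟩
    let 𝓤 : T.OpenCover := Scheme.openCoverOfIsOpenCover T W hsup
    refine GrothendieckTopology.superset_covering _ ?_ 𝓤.mem_grothendieckTopology
    rw [Sieve.ofArrows, Sieve.generate_le_iff]
    rintro _ _ ⟨t⟩
    have hι : (⊤ : (W t).toScheme.Opens) ≤ (W t).ι ⁻¹ᵁ W t := fun z _ => z.2
    obtain ⟨g, hg⟩ := ((hW t).map hA (W t).ι hι).exists_map_eq hA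
    refine ⟨(Sigma.ι (fun χ : GrChart A n r => yoneda.obj χ.scheme) (χ t)).app _ g, ?_⟩
    have h1 : Sigma.ι (fun χ : GrChart A n r => yoneda.obj χ.scheme) (χ t) ≫
      (Sigma.desc fun χ : GrChart A n r => χ.hom hA) = (χ t).hom hA := Sigma.ι_desc _ _
    have h2 := ConcreteCategory.congr_hom (NatTrans.congr_app h1 (op (W t).toScheme)) g
    exact h2.trans hg

instance GrChart.isLocallyNoetherian [IsLocallyNoetherian S] : IsLocallyNoetherian χ.scheme := by
  change IsLocallyNoetherian 𝔸(FreeEntries.{u} χ.I; χ.U.toScheme)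
  exact LocallyOfFiniteType.isLocallyNoetherian
    (𝔸(FreeEntries.{u} χ.I; χ.U.toScheme) ↘ χ.U.toScheme)

/-- The Grassmannian is representable by a locally Noetherian scheme. -/
theorem exists_grPresheaf_representableBy [IsLocallyNoetherian S] (hA : A.IsLocallyFree n)
    (r : ℕ) : ∃ (G : Scheme.{u}) (_ : IsLocallyNoetherian G),
      Nonempty ((grPresheaf hA r).RepresentableBy G) := by
  let F : Sheaf Scheme.zariskiTopology.{u} (Type u) :=
    ⟨grPresheaf hA r, (isSheaf_iff_isSheaf_of_type _ _).2 (grPresheaf_isSheaf hA r)⟩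
  let φ : ∀ χ : GrChart A n r, yoneda.obj χ.scheme ⟶ F.1 := fun χ => χ.hom hA
  have hφ : ∀ χ, IsOpenImmersion.presheaf (φ χ) := fun χ => χ.hom_presheaf hA
  have : Presheaf.IsLocallySurjective Scheme.zariskiTopology (Sigma.desc φ) :=
    grChart_isLocallySurjective hA
  refine ⟨(Scheme.LocalRepresentability.glueData hφ).glued, ?_,
    ⟨Scheme.LocalRepresentability.representableBy hφ⟩⟩
  refine (isLocallyNoetherian_iff_openCover
    (Scheme.LocalRepresentability.glueData hφ).openCover).2 fun χ => ?_
  exact GrChart.isLocallyNoetherian (A := A) χ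

end Representable

/-! ### The Grassmannian functor on locally Noetherian schemes -/

section Grassmannian

variable {S : Scheme.{u}} {A : AlgebraSheaf S} {n : ℕ}

theorem isGrassmannianPoint_iff (hA : A.IsLocallyFree n) {δ : ℕ} {T : Scheme.{u}} {f : T ⟶ S}
    {E : (A.pullback f).Submod} :
    A.IsGrassmannianPoint n ((n : ℤ) - δ) E ↔ E.QuotientLocallyFree δ := by
  constructor
  · rintro ⟨-, r, hr, h⟩
    obtain rfl : r = δ := by omega
    exact h
  · intro h
    exact ⟨h.isQuasicoherent hA, δ, by omega, h⟩

theorem exists_grassmannianFunctor_representableBy [IsLocallyNoetherian S]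
    (hA : A.IsLocallyFree n) (δ : ℕ) : ∃ G : LocNoethOver S,
      Nonempty ((grassmannianFunctor hA ((n : ℤ) - δ)).RepresentableBy G) := by
  obtain ⟨G, hG, ⟨R⟩⟩ := exists_grPresheaf_representableBy hA δ
  let x : GrPoint A δ G := R.homEquiv (𝟙 G)
  have hR : ∀ {T : Scheme.{u}} (g : T ⟶ G), R.homEquiv g = (grPresheaf hA δ).map g.op x := by
    intro T g
    have := R.homEquiv_comp g (𝟙 G)
    rwa [Category.comp_id] at this
  let GG : LocNoethOver S := ⟨Over.mk x.1, hG⟩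
  let Φ : ∀ T : LocNoethOver S, (T ⟶ GG) →
      {E : (A.pullback T.obj.hom).Submod // A.IsGrassmannianPoint n ((n : ℤ) - δ) E} :=
    fun T g => ⟨x.2.1.pullback g.hom.left (Over.w g.hom),
      (isGrassmannianPoint_iff hA).2 (x.2.2.pullback hA _ _)⟩
  have hΦ : ∀ T, Function.Bijective (Φ T) := by
    intro T
    constructor
    · intro g g' h
      have h1 := (grPresheaf_map_eq_iff hA δ (x₁ := x) (x₂ := x) (Over.w g.hom)
        (Over.w g'.hom)).2 (congrArg Subtype.val h)
      have h2 : g.hom.left = g'.hom.left := by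
        apply R.homEquiv.injective
        rw [hR, hR]
        exact h1
      exact InducedCategory.hom_ext (Over.OverMorphism.ext h2)
    · rintro ⟨E, hE⟩
      let y : GrPoint A δ T.obj.left := ⟨T.obj.hom, E, (isGrassmannianPoint_iff hA).1 hE⟩
      obtain ⟨k, hk⟩ := R.homEquiv.surjective y
      rw [hR] at hk
      have hk1 : k ≫ x.1 = T.obj.hom := congrArg Sigma.fst hk
      have hk2 := (grPresheaf_map_eq_iff' hA δ (x₁ := x) (x := y) hk1).1 hk
      exact ⟨InducedCategory.homMk (Over.homMk k hk1), Subtype.ext hk2⟩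
  refine ⟨GG, ⟨⟨fun {T} => Equiv.ofBijective (Φ T) (hΦ T), ?_⟩⟩⟩
  intro T T' g h
  refine Subtype.ext ?_
  exact Submod.pullback_comp g.hom.left (Over.w g.hom) h.hom.left (Over.w h.hom)
    (Over.w (g ≫ h).hom) x.2.1

end Grassmannian

/-! ### Obstructions to being a subalgebra -/

section Subalgebra

variable {X : Scheme.{u}} {A : AlgebraSheaf X} {n r : ℕ}

/-- The generators of the kernel of `L`: the columns of `1 - E L`. -/
def kernelGen {B : A.Submod} {U : X.Opens} {a : Fin n → A.Sec U}
    {L : Matrix (Fin r) (Fin n) Γ(X, U)} {E : Matrix (Fin n) (Fin r) Γ(X, U)}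
    (_ : IsKernelOn B a L E) (k : Fin n) : A.Sec U :=
  comb le_rfl a (fun j => (1 - E * L : Matrix (Fin n) (Fin n) Γ(X, U)) j k)

theorem kernelGen_mem {B : A.Submod} {U : X.Opens} {a : Fin n → A.Sec U}
    {L : Matrix (Fin r) (Fin n) Γ(X, U)} {E : Matrix (Fin n) (Fin r) Γ(X, U)}
    (hk : IsKernelOn B a L E) (k : Fin n) : kernelGen hk k ∈ B.obj U := by
  have h1 : L * (1 - E * L) = 0 := by
    rw [Matrix.mul_sub, Matrix.mul_one, ← Matrix.mul_assoc, hk.mul_eq, Matrix.one_mul, sub_self]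
  rw [kernelGen, hk.mem_iff_self]
  funext i
  exact congrFun (congrFun h1 i) k

/-- Every section of `ℬ` is a combination of the generators, with its own coordinates as
coefficients. -/
theorem comb_eq_sum_kernelGen {B : A.Submod} {U V : X.Opens} {a : Fin n → A.Sec U}
    {L : Matrix (Fin r) (Fin n) Γ(X, U)} {E : Matrix (Fin n) (Fin r) Γ(X, U)}
    (hk : IsKernelOn B a L E) (hV : V ≤ U) {y : Fin n → Γ(X, V)}
    (hy : comb hV a y ∈ B.obj V) : comb hV a y = ∑ k, y k • A.res hV (kernelGen hk k) := by
  have h0 := (hk.mem_iff V hV y).1 hy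
  have h1 := comb_comb hV a (kernelGen hk) (1 - E * L) (fun _ => rfl) y
  refine Eq.trans ?_ h1.symm
  congr 1
  have h2 : (1 - E * L).map (ores hV) = 1 - E.map (ores hV) * L.map (ores hV) := by
    rw [← Matrix.map_mul]
    ext i j
    simp only [Matrix.map_apply, Matrix.sub_apply, map_sub, Matrix.one_apply, apply_ite (ores hV),
      map_one, map_zero]
  rw [h2, Matrix.sub_mulVec, Matrix.one_mulVec, ← Matrix.mulVec_mulVec, h0, Matrix.mulVec_zero,
    sub_zero]

/-- The coordinates, in the quotient `𝒜/ℬ`, of the unit section and of the products of the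
generators of `ℬ`. They vanish if and only if `ℬ` is a subalgebra. -/
def obstruction {B : A.Submod} {U : X.Opens} {a : Fin n → A.Sec U}
    {L : Matrix (Fin r) (Fin n) Γ(X, U)} {E : Matrix (Fin n) (Fin r) Γ(X, U)}
    (hk : IsKernelOn B a L E) : Set Γ(X, U) :=
  {c | ∃ (y : Fin n → Γ(X, U)) (i : Fin r), c = (L *ᵥ y) i ∧
    (comb le_rfl a y = 1 ∨ ∃ k l, comb le_rfl a y = kernelGen hk k * kernelGen hk l)}

theorem obstruction_eq_zero {B : A.Submod} {U : X.Opens} {a : Fin n → A.Sec U}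
    {L : Matrix (Fin r) (Fin n) Γ(X, U)} {E : Matrix (Fin n) (Fin r) Γ(X, U)}
    (hk : IsKernelOn B a L E) (hB : B.IsSubalgebra) {c : Γ(X, U)} (hc : c ∈ obstruction hk) :
    c = 0 := by
  obtain ⟨y, i, rfl, hy⟩ := hc
  have h1 : comb le_rfl a y ∈ B.obj U := by
    obtain hy | ⟨k, l, hy⟩ := hy
    · rw [hy]
      exact hB.1 U
    · rw [hy]
      exact hB.2 U _ _ (kernelGen_mem hk k) (kernelGen_mem hk l)
  exact congrFun ((hk.mem_iff_self y).1 h1) i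

theorem one_mem_of_obstruction {B : A.Submod} {U : X.Opens} {a : Fin n → A.Sec U}
    (ha : A.IsBasisOn a) {L : Matrix (Fin r) (Fin n) Γ(X, U)}
    {E : Matrix (Fin n) (Fin r) Γ(X, U)} (hk : IsKernelOn B a L E)
    (h : ∀ c ∈ obstruction hk, c = 0) : (1 : A.Sec U) ∈ B.obj U := by
  obtain ⟨y, hy⟩ := (ha U le_rfl).2 1
  change comb le_rfl a y = 1 at hy
  rw [← hy, hk.mem_iff_self]
  funext i
  exact h _ ⟨y, i, rfl, Or.inl hy⟩

theorem mul_mem_of_obstruction {B : A.Submod} {U : X.Opens} {a : Fin n → A.Sec U}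
    (ha : A.IsBasisOn a) {L : Matrix (Fin r) (Fin n) Γ(X, U)}
    {E : Matrix (Fin n) (Fin r) Γ(X, U)} (hk : IsKernelOn B a L E)
    (h : ∀ c ∈ obstruction hk, c = 0) {V : X.Opens} (hV : V ≤ U) {s t : A.Sec V}
    (hs : s ∈ B.obj V) (ht : t ∈ B.obj V) : s * t ∈ B.obj V := by
  have hkl : ∀ k l, kernelGen hk k * kernelGen hk l ∈ B.obj U := by
    intro k l
    obtain ⟨y, hy⟩ := (ha U le_rfl).2 (kernelGen hk k * kernelGen hk l)
    change comb le_rfl a y = _ at hy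
    rw [← hy, hk.mem_iff_self]
    funext i
    exact h _ ⟨y, i, rfl, Or.inr ⟨k, l, hy⟩⟩
  obtain ⟨y, rfl⟩ := (ha V hV).2 s
  obtain ⟨z, rfl⟩ := (ha V hV).2 t
  have h1 := comb_eq_sum_kernelGen hk hV hs
  have h2 := comb_eq_sum_kernelGen hk hV ht
  change comb hV a y * comb hV a z ∈ B.obj V
  rw [h1, h2, Finset.sum_mul_sum]
  refine Submodule.sum_mem _ fun k _ => Submodule.sum_mem _ fun l _ => ?_
  rw [smul_mul_smul_comm, ← map_mul]
  exact Submodule.smul_mem _ _ (B.res_mem hV (hkl k l))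

theorem isSubalgebra_of_locally {B : A.Submod}
    (h : ∀ x : X, ∃ (U : X.Opens) (a : Fin n → A.Sec U) (L : Matrix (Fin r) (Fin n) Γ(X, U))
      (E : Matrix (Fin n) (Fin r) Γ(X, U)) (hk : IsKernelOn B a L E), x ∈ U ∧ A.IsBasisOn a ∧
      ∀ c ∈ obstruction hk, c = 0) : B.IsSubalgebra := by
  constructor
  · intro V
    refine B.of_locally _ fun x hx => ?_
    obtain ⟨U, a, L, E, hk, hxU, ha, h0⟩ := h x
    refine ⟨V ⊓ U, inf_le_left, ⟨hx, hxU⟩, ?_⟩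
    have := B.res_mem (inf_le_right : V ⊓ U ≤ U) (one_mem_of_obstruction ha hk h0)
    rwa [map_one] at this ⊢
  · intro V s t hs ht
    refine B.of_locally _ fun x hx => ?_
    obtain ⟨U, a, L, E, hk, hxU, ha, h0⟩ := h x
    refine ⟨V ⊓ U, inf_le_left, ⟨hx, hxU⟩, ?_⟩
    rw [map_mul]
    exact mul_mem_of_obstruction ha hk h0 inf_le_right (B.res_mem _ hs) (B.res_mem _ ht)

end Subalgebra

section PullbackObstruction

variable {S T T' : Scheme.{u}} {A : AlgebraSheaf S} {f : T ⟶ S} {f' : T' ⟶ S} {n r : ℕ}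

theorem compare_kernelGen (g : T ⟶ T') (h : g ≫ f' = f) {B : (A.pullback f').Submod}
    {U : S.Opens} {a : Fin n → A.Sec U} (ha : A.IsBasisOn a) {W : T'.Opens} (hW : W ≤ f' ⁻¹ᵁ U)
    {L : Matrix (Fin r) (Fin n) Γ(T', W)} {E : Matrix (Fin n) (Fin r) Γ(T', W)}
    (hk : IsKernelOn B (fun j => A.pullSec f' hW (a j)) L E) {V : T.Opens} (hV : V ≤ g ⁻¹ᵁ W)
    (hU : V ≤ f ⁻¹ᵁ U) (k : Fin n) :
    A.compare g h hV (kernelGen hk k) = kernelGen (hk.pullback g h ha hW hV hU) k := by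
  rw [kernelGen, compare_comb g h a hW hU le_rfl le_rfl hV]
  congr 1
  funext j
  rw [← Matrix.map_mul]
  simp only [Matrix.sub_apply, map_sub, Matrix.one_apply, apply_ite (opull g hV), map_one,
    map_zero, Matrix.map_apply]

/-- The obstructions for `g^*ℬ` are the pullbacks of those for `ℬ`. -/
theorem obstruction_pullback (g : T ⟶ T') (h : g ≫ f' = f) {B : (A.pullback f').Submod}
    {U : S.Opens} {a : Fin n → A.Sec U} (ha : A.IsBasisOn a) {W : T'.Opens} (hW : W ≤ f' ⁻¹ᵁ U)
    {L : Matrix (Fin r) (Fin n) Γ(T', W)} {E : Matrix (Fin n) (Fin r) Γ(T', W)}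
    (hk : IsKernelOn B (fun j => A.pullSec f' hW (a j)) L E) {V : T.Opens} (hV : V ≤ g ⁻¹ᵁ W)
    (hU : V ≤ f ⁻¹ᵁ U) :
    obstruction (hk.pullback g h ha hW hV hU) = opull g hV '' obstruction hk := by
  have hL : ∀ (y : Fin n → Γ(T', W)) i,
      (L.map (opull g hV) *ᵥ (fun j => opull g hV (y j))) i = opull g hV ((L *ᵥ y) i) := by
    intro y i
    simp only [Matrix.mulVec, dotProduct, map_sum, map_mul, Matrix.map_apply]
  have hb := A.isBasisOn_pullSec f ha hU V le_rfl
  have hb' := A.isBasisOn_pullSec f' ha hW W le_rfl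
  have hcc := fun y => compare_comb g h a hW hU le_rfl le_rfl hV y
  ext c
  constructor
  · rintro ⟨y, i, rfl, hy⟩
    obtain hy | ⟨k, l, hy⟩ := hy
    · obtain ⟨y', hy'⟩ := hb'.2 1
      have h1 := hcc y'
      change comb le_rfl _ y' = 1 at hy'
      rw [hy', map_one, ← hy] at h1
      have h2 : y = fun j => opull g hV (y' j) := hb.1 h1
      refine ⟨(L *ᵥ y') i, ⟨y', i, rfl, Or.inl hy'⟩, ?_⟩
      rw [h2, hL]
    · obtain ⟨y', hy'⟩ := hb'.2 (kernelGen hk k * kernelGen hk l)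
      have h1 := hcc y'
      change comb le_rfl _ y' = _ at hy'
      rw [hy', map_mul, compare_kernelGen g h ha hW hk hV hU,
        compare_kernelGen g h ha hW hk hV hU, ← hy] at h1
      have h2 : y = fun j => opull g hV (y' j) := hb.1 h1
      refine ⟨(L *ᵥ y') i, ⟨y', i, rfl, Or.inr ⟨k, l, hy'⟩⟩, ?_⟩
      rw [h2, hL]
  · rintro ⟨_, ⟨y, i, rfl, hy⟩, rfl⟩
    refine ⟨fun j => opull g hV (y j), i, (hL y i).symm, ?_⟩
    rw [← hcc]
    obtain hy | ⟨k, l, hy⟩ := hy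
    · left
      rw [hy, map_one]
    · right
      refine ⟨k, l, ?_⟩
      rw [hy, map_mul, compare_kernelGen g h ha hW hk hV hU, compare_kernelGen g h ha hW hk hV hU]

end PullbackObstruction

/-! ### The ideal of the locus of subalgebras -/

section SubalgebraIdeal

variable {S G : Scheme.{u}} {A : AlgebraSheaf S} {f' : G ⟶ S} {n r : ℕ}

/-- The functions on `U` which vanish on every scheme over `G` on which the pullback of `ℬ` is a
subalgebra. -/
def subalgebraIdeal (B : (A.pullback f').Submod) (U : G.Opens) : Ideal Γ(G, U) where
  carrier := {c | ∀ (T : Scheme.{u}) (g : T ⟶ G), (B.pullback g rfl).IsSubalgebra →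
    ∀ (V : T.Opens) (h : V ≤ g ⁻¹ᵁ U), opull g h c = 0}
  add_mem' := by
    intro c c' hc hc' T g hg V h
    rw [map_add, hc T g hg V h, hc' T g hg V h, add_zero]
  zero_mem' := by
    intro T g hg V h
    exact map_zero _
  smul_mem' := by
    intro c c' hc' T g hg V h
    rw [smul_eq_mul, map_mul, hc' T g hg V h, mul_zero]

variable {B : (A.pullback f').Submod}

theorem ores_mem_subalgebraIdeal {U V : G.Opens} (h : V ≤ U) {c : Γ(G, U)}
    (hc : c ∈ subalgebraIdeal B U) : ores h c ∈ subalgebraIdeal B V := by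
  intro T g hg W hW
  rw [opull_ores g hW h (fun z hz => h (hW hz))]
  exact hc T g hg W _

theorem mem_subalgebraIdeal_of_locally {U : G.Opens} {c : Γ(G, U)}
    (h : ∀ x ∈ U, ∃ (V : G.Opens) (hV : V ≤ U), x ∈ V ∧ ores hV c ∈ subalgebraIdeal B V) :
    c ∈ subalgebraIdeal B U := by
  intro T g hg W hW
  refine ores_eq_zero_of_cover _ fun t ht => ?_
  obtain ⟨V, hV, htV, hc⟩ := h (g t) (hW ht)
  refine ⟨W ⊓ g ⁻¹ᵁ V, inf_le_left, ⟨ht, htV⟩, ?_⟩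
  have h1 : W ⊓ g ⁻¹ᵁ V ≤ g ⁻¹ᵁ V := inf_le_right
  rw [ores_opull, ← opull_ores g h1 hV]
  exact hc T g hg _ h1

theorem isSubalgebra_pullback_iff {T : Scheme.{u}} {f : T ⟶ S} (g : T ⟶ G) (h : g ≫ f' = f) :
    (B.pullback g h).IsSubalgebra ↔ (B.pullback g rfl).IsSubalgebra := by
  subst h
  rfl

section Trivialized

variable {U : S.Opens} {a : Fin n → A.Sec U} {W : G.Opens} {hW : W ≤ f' ⁻¹ᵁ U}
  {L : Matrix (Fin r) (Fin n) Γ(G, W)} {E : Matrix (Fin n) (Fin r) Γ(G, W)}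

theorem obstruction_subset_subalgebraIdeal (ha : A.IsBasisOn a)
    (hk : IsKernelOn B (fun j => A.pullSec f' hW (a j)) L E) :
    obstruction hk ⊆ subalgebraIdeal B W := by
  intro c hc T g hg V hV
  have hU : V ≤ (g ≫ f') ⁻¹ᵁ U := fun z hz => hW (hV hz)
  refine obstruction_eq_zero (hk.pullback g rfl ha hW hV hU) hg ?_
  rw [obstruction_pullback g rfl ha hW hk hV hU]
  exact ⟨c, hc, rfl⟩

/-- A function on an affine open subset, pulled back to the closed subscheme of an ideal `I` of the
ring of functions, vanishes if and only if it lies in `I`. -/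
theorem opull_quotient_eq_zero_iff {V : G.Opens} (hV : IsAffineOpen V) (I : Ideal Γ(G, V))
    (h : (⊤ : (Spec (.of (Γ(G, V) ⧸ I))).Opens) ≤
      (Spec.map (CommRingCat.ofHom (Ideal.Quotient.mk I)) ≫ hV.fromSpec) ⁻¹ᵁ V) (c : Γ(G, V)) :
    opull (Spec.map (CommRingCat.ofHom (Ideal.Quotient.mk I)) ≫ hV.fromSpec) h c = 0 ↔ c ∈ I := by
  have h1 : (⊤ : (Spec Γ(G, V)).Opens) ≤ hV.fromSpec ⁻¹ᵁ V := by
    rw [hV.fromSpec_preimage_self]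
  have h2 : opull hV.fromSpec h1 c = (Scheme.ΓSpecIso Γ(G, V)).inv.hom c := by
    have e : hV.fromSpec.appLE V ⊤ h1 = (Scheme.ΓSpecIso Γ(G, V)).inv := by
      rw [Scheme.Hom.appLE, hV.fromSpec_app_self, Category.assoc, ← Functor.map_comp]
      exact (congrArg _ ((Spec Γ(G, V)).presheaf.map_id _)).trans (Category.comp_id _)
    exact congrArg (fun φ => φ.hom c) e
  have h3 := opull_opull (Spec.map (CommRingCat.ofHom (Ideal.Quotient.mk I))) hV.fromSpec h1 le_rfl
    h c
  have h4 := congrArg (fun φ => φ.hom c)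
    (Scheme.ΓSpecIso_inv_naturality (CommRingCat.ofHom (Ideal.Quotient.mk I)))
  rw [h2] at h3
  have h5 := h3.symm.trans ((opull_top _ le_rfl _).trans h4.symm)
  refine (Eq.congr_left h5).trans ?_
  have hinj := (ConcreteCategory.bijective_of_isIso
    (Scheme.ΓSpecIso (.of (Γ(G, V) ⧸ I))).inv).1
  refine Iff.trans ?_ Ideal.Quotient.eq_zero_iff_mem
  exact map_eq_zero_iff (Scheme.ΓSpecIso (.of (Γ(G, V) ⧸ I))).inv.hom hinj

/-- On an affine open subset over which `ℬ` is the kernel of a split matrix, the functions vanishing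
wherever `ℬ` becomes a subalgebra form the ideal generated by the obstructions. -/
theorem subalgebraIdeal_eq (ha : A.IsBasisOn a)
    (hk : IsKernelOn B (fun j => A.pullSec f' hW (a j)) L E) {V : G.Opens} (hV : IsAffineOpen V)
    (hVW : V ≤ W) :
    subalgebraIdeal B V = (Ideal.span (obstruction hk)).map (ores hVW) := by
  refine le_antisymm ?_ ?_
  · intro c hc
    -- `ℬ` becomes a subalgebra on the closed subscheme of `V` defined by the obstructions
    set I := (Ideal.span (obstruction hk)).map (ores hVW) with hI
    have hle : (⊤ : (Spec (.of (Γ(G, V) ⧸ I))).Opens) ≤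
        (Spec.map (CommRingCat.ofHom (Ideal.Quotient.mk I)) ≫ hV.fromSpec) ⁻¹ᵁ V := by
      rw [Scheme.Hom.comp_preimage, hV.fromSpec_preimage_self]
      exact le_rfl
    refine (opull_quotient_eq_zero_iff hV I hle c).1 (hc _ _ ?_ _ hle)
    generalize hg : Spec.map (CommRingCat.ofHom (Ideal.Quotient.mk I)) ≫ hV.fromSpec = g at hle ⊢
    have hgW : ⊤ ≤ g ⁻¹ᵁ W := fun z hz => hVW (hle hz)
    have hgU : ⊤ ≤ (g ≫ f') ⁻¹ᵁ U := fun z hz => hW (hgW hz)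
    refine isSubalgebra_of_locally (n := n) (r := r) fun x =>
      ⟨⊤, _, _, _, hk.pullback g rfl ha hW hgW hgU, trivial, A.isBasisOn_pullSec _ ha hgU, ?_⟩
    rw [obstruction_pullback g rfl ha hW hk hgW hgU]
    rintro _ ⟨d, hd, rfl⟩
    subst hg
    rw [← opull_ores _ hle hVW, opull_quotient_eq_zero_iff hV I hle]
    exact Ideal.mem_map_of_mem _ (Ideal.subset_span hd)
  · rw [Ideal.map_le_iff_le_comap, Ideal.span_le]
    intro c hc
    exact ores_mem_subalgebraIdeal hVW (obstruction_subset_subalgebraIdeal ha hk hc)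

end Trivialized

theorem exists_pow_mul_mem_subalgebraIdeal (hA : A.IsLocallyFree n)
    (hB : B.QuotientLocallyFree r) {U : G.Opens} (hU : IsAffineOpen U) (f : Γ(G, U))
    (b : Γ(G, U)) (hb : ores (G.basicOpen_le f) b ∈ subalgebraIdeal B (G.basicOpen f)) :
    ∃ k : ℕ, f ^ k * b ∈ subalgebraIdeal B U := by
  -- near every point the ideal is generated by obstructions, hence commutes with localization
  have hloc : ∀ x : U, ∃ g : Γ(G, U), x.1 ∈ G.basicOpen g ∧ ∃ k : ℕ,
      ores (G.basicOpen_le g) (f ^ k * b) ∈ subalgebraIdeal B (G.basicOpen g) := by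
    intro x
    obtain ⟨U', W, hW, hxW, a, ha, L, E, hk⟩ := hB.exists_kernel hA x.1
    obtain ⟨g, hgW, hxg⟩ := hU.exists_basicOpen_le ⟨x.1, hxW⟩ x.2
    refine ⟨g, hxg, ?_⟩
    have hV : IsAffineOpen (G.basicOpen g) := hU.basicOpen g
    have hVU : G.basicOpen g ≤ U := G.basicOpen_le g
    have hDle : G.basicOpen (ores hVU f) ≤ G.basicOpen g := G.basicOpen_le _
    have hDf : G.basicOpen (ores hVU f) ≤ G.basicOpen f := by
      have : G.basicOpen (ores hVU f) = G.basicOpen g ⊓ G.basicOpen f :=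
        G.basicOpen_res f (homOfLE hVU).op
      rw [this]
      exact inf_le_right
    have h1 := ores_mem_subalgebraIdeal hDf hb
    rw [subalgebraIdeal_eq ha hk (hV.basicOpen _) (hDle.trans hgW)] at h1
    have h2 : (ores (hDle.trans hgW) : Γ(G, W) →+* _) =
        (ores hDle).comp (ores hgW) := by
      ext c
      exact (ores_ores _ _ c).symm
    rw [h2, ← Ideal.map_map, ← subalgebraIdeal_eq ha hk hV hgW, ores_ores,
      ← ores_ores hVU hDle] at h1
    have := hV.isLocalization_basicOpen (ores hVU f)
    obtain ⟨_, ⟨k, rfl⟩, hm⟩ := (IsLocalization.algebraMap_mem_map_algebraMap_iff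
      (Submonoid.powers (ores hVU f)) Γ(G, G.basicOpen (ores hVU f))
      (subalgebraIdeal B (G.basicOpen g)) (ores hVU b)).1 h1
    refine ⟨k, ?_⟩
    rw [map_mul, map_pow]
    exact hm
  choose g hxg k hk using hloc
  obtain ⟨t, ht⟩ := hU.isCompact.elim_finite_subcover (fun x : U => (G.basicOpen (g x) : Set G))
    (fun x => (G.basicOpen (g x)).isOpen) fun x hx => Set.mem_iUnion.2 ⟨⟨x, hx⟩, hxg ⟨x, hx⟩⟩
  refine ⟨∑ x ∈ t, k x, mem_subalgebraIdeal_of_locally fun x hx => ?_⟩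
  obtain ⟨y, hyt, hxy⟩ := Set.mem_iUnion₂.1 (ht hx)
  refine ⟨G.basicOpen (g y), G.basicOpen_le _, hxy, ?_⟩
  obtain ⟨m, hm⟩ := Nat.exists_eq_add_of_le (Finset.single_le_sum (f := k)
    (fun _ _ => Nat.zero_le _) hyt)
  rw [hm, pow_add, mul_comm (f ^ k y), mul_assoc, map_mul]
  exact Ideal.mul_mem_left _ _ (hk y)

/-- The ideal sheaf of the locus on which `ℬ` is a subalgebra. -/
def subalgebraIdealSheaf (hA : A.IsLocallyFree n) (hB : B.QuotientLocallyFree r) :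
    G.IdealSheafData where
  ideal U := subalgebraIdeal B U.1
  map_ideal_basicOpen := by
    intro U f
    change (subalgebraIdeal B U.1).map (ores (G.basicOpen_le f)) =
      subalgebraIdeal B (G.basicOpen f)
    refine le_antisymm ?_ ?_
    · rw [Ideal.map_le_iff_le_comap]
      intro c hc
      exact ores_mem_subalgebraIdeal _ hc
    · intro c hc
      have := U.2.isLocalization_basicOpen f
      obtain ⟨⟨b, ⟨_, N, rfl⟩⟩, hb⟩ := IsLocalization.surj (Submonoid.powers f) c
      have hb' : c * ores (G.basicOpen_le f) (f ^ N) = ores (G.basicOpen_le f) b := hb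
      obtain ⟨k, hk⟩ := exists_pow_mul_mem_subalgebraIdeal hA hB U.2 f b (by
        rw [← hb']
        exact Ideal.mul_mem_right _ _ hc)
      have h1 := Ideal.mem_map_of_mem (ores (G.basicOpen_le f)) hk
      have hu : IsUnit (ores (G.basicOpen_le f) f) := RingedSpace.isUnit_res_basicOpen _ _
      rw [map_mul, ← hb', map_pow, map_pow, mul_left_comm, ← mul_assoc] at h1
      have h2 : c * (ores (G.basicOpen_le f) f ^ k * ores (G.basicOpen_le f) f ^ N) ∈
          (subalgebraIdeal B U.1).map (ores (G.basicOpen_le f)) := by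
        rwa [← mul_assoc]
      exact (Ideal.mul_unit_mem_iff_mem _ ((hu.pow k).mul (hu.pow N))).1 h2

/-- On the closed subscheme of the ideal sheaf, `ℬ` is a subalgebra. -/
theorem isSubalgebra_pullback_subschemeι (hA : A.IsLocallyFree n) (hB : B.QuotientLocallyFree r) :
    (B.pullback (subalgebraIdealSheaf hA hB).subschemeι rfl).IsSubalgebra := by
  refine isSubalgebra_of_locally (n := n) (r := r) fun x => ?_
  set ι := (subalgebraIdealSheaf hA hB).subschemeι with hι
  obtain ⟨U, W, hW, hxW, a, ha, L, E, hk⟩ := hB.exists_kernel hA (ι x)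
  obtain ⟨V, hV, hxV, hVW⟩ := Opens.isBasis_iff_nbhd.1 G.isBasis_affineOpens hxW
  have hιW : ι ⁻¹ᵁ V ≤ ι ⁻¹ᵁ W := fun z hz => hVW hz
  have hιU : ι ⁻¹ᵁ V ≤ (ι ≫ f') ⁻¹ᵁ U := fun z hz => hW (hιW hz)
  refine ⟨ι ⁻¹ᵁ V, _, _, _, hk.pullback ι rfl ha hW hιW hιU, hxV, A.isBasisOn_pullSec _ ha hιU, ?_⟩
  rw [obstruction_pullback ι rfl ha hW hk hιW hιU]
  rintro _ ⟨c, hc, rfl⟩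
  have h1 : ores hVW c ∈ (subalgebraIdealSheaf hA hB).ideal ⟨V, hV⟩ :=
    ores_mem_subalgebraIdeal hVW (obstruction_subset_subalgebraIdeal ha hk hc)
  rw [← (subalgebraIdealSheaf hA hB).ker_subschemeι_app ⟨V, hV⟩, RingHom.mem_ker] at h1
  rw [← opull_ores ι le_rfl hVW hιW]
  have h2 : ∀ d : Γ(G, V), opull ι (le_refl (ι ⁻¹ᵁ V)) d = (ι.app V).hom d := by
    intro d
    rw [Scheme.Hom.app_eq_appLE]
    rfl
  exact (h2 _).trans h1

/-- A morphism to `G` factors through the closed subscheme if and only if the pullback of `ℬ` is a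
subalgebra. -/
theorem exists_comp_subschemeι_iff (hA : A.IsLocallyFree n) (hB : B.QuotientLocallyFree r)
    {T : Scheme.{u}} (g : T ⟶ G) :
    (∃ h, h ≫ (subalgebraIdealSheaf hA hB).subschemeι = g) ↔
      (B.pullback g rfl).IsSubalgebra := by
  constructor
  · rintro ⟨h, rfl⟩
    have h1 := (isSubalgebra_pullback_subschemeι hA hB).pullback h rfl
    rw [← Submod.pullback_comp h rfl _ rfl (Category.assoc _ _ _)] at h1
    exact (isSubalgebra_pullback_iff _ _).1 h1
  · intro hg
    have hle : (subalgebraIdealSheaf hA hB).subschemeι.ker ≤ g.ker := by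
      rw [Scheme.IdealSheafData.ker_subschemeι]
      refine Scheme.IdealSheafData.le_ofIdeals_iff.2 fun V c hc => ?_
      rw [RingHom.mem_ker]
      have h1 := hc T g hg (g ⁻¹ᵁ V.1) le_rfl
      rw [← h1, Scheme.Hom.app_eq_appLE]
      rfl
    exact ⟨IsClosedImmersion.lift _ g hle, IsClosedImmersion.lift_fac _ g hle⟩

end SubalgebraIdeal

end AlgebraSheaf
end AlgebraicGeometry
end

/-! ### Representability of the functor of subalgebras -/

theorem mainTheorem5 {S : Scheme.{u}} [IsLocallyNoetherian S] (A : AlgebraSheaf S) (n δ : ℕ)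
    (hA : A.IsLocallyFree n) :
    -- the Grassmannian functor is representable by a locally Noetherian `S`-scheme
    (∃ G : LocNoethOver S, Nonempty
      ((AlgebraSheaf.grassmannianFunctor hA ((n : ℤ) - δ)).RepresentableBy G)) ∧
    -- for every scheme `G` representing it, the functor of subalgebras is represented by a
    -- closed subscheme `i : Ter ⟶ G`
    ∀ (G : LocNoethOver S)
      (ρ : (AlgebraSheaf.grassmannianFunctor hA ((n : ℤ) - δ)).RepresentableBy G),
      ∃ (Ter : LocNoethOver S) (i : Ter ⟶ G)
        (σ : (AlgebraSheaf.territoryFunctor hA δ).RepresentableBy Ter),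
        IsClosedImmersion i.hom.left ∧
        -- composition with `i` corresponds to forgetting that a subalgebra is a subalgebra
        (∀ (T : LocNoethOver S) (h : T ⟶ Ter), (ρ.homEquiv (h ≫ i)).1 = (σ.homEquiv h).1) ∧
        -- the closed subscheme is cut out by multiplicative closure and by containing `1`
        (∀ (T : LocNoethOver S) (g : T ⟶ G), (∃ h : T ⟶ Ter, h ≫ i = g) ↔
          (ρ.homEquiv g).1.MulClosed ∧ (ρ.homEquiv g).1.ContainsOne) := by
  refine ⟨AlgebraSheaf.exists_grassmannianFunctor_representableBy hA δ, fun G ρ => ?_⟩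
  have hG : IsLocallyNoetherian G.obj.left := G.property
  -- the universal submodule
  set B : (A.pullback G.obj.hom).Submod := (ρ.homEquiv (𝟙 G)).1 with hBdef
  have hB : B.QuotientLocallyFree δ :=
    (AlgebraSheaf.isGrassmannianPoint_iff hA).1 (ρ.homEquiv (𝟙 G)).2
  have hρ : ∀ {T : LocNoethOver S} (g : T ⟶ G),
      (ρ.homEquiv g).1 = B.pullback g.hom.left (Over.w g.hom) := by
    intro T g
    have h1 := ρ.homEquiv_comp g (𝟙 G)
    rw [Category.comp_id] at h1
    exact congrArg Subtype.val h1
  let I := AlgebraSheaf.subalgebraIdealSheaf hA hB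
  let Ter : LocNoethOver S := ⟨Over.mk (I.subschemeι ≫ G.obj.hom),
    LocallyOfFiniteType.isLocallyNoetherian I.subschemeι⟩
  let i : Ter ⟶ G := InducedCategory.homMk (Over.homMk I.subschemeι rfl)
  have hfac : ∀ (T : LocNoethOver S) (g : T ⟶ G), (∃ h : T ⟶ Ter, h ≫ i = g) ↔
      (ρ.homEquiv g).1.IsSubalgebra := by
    intro T g
    rw [hρ, AlgebraSheaf.isSubalgebra_pullback_iff, ← AlgebraSheaf.exists_comp_subschemeι_iff hA hB]
    constructor
    · rintro ⟨h, rfl⟩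
      exact ⟨h.hom.left, rfl⟩
    · rintro ⟨h, hh⟩
      refine ⟨InducedCategory.homMk (Over.homMk h ?_), ?_⟩
      · change h ≫ I.subschemeι ≫ G.obj.hom = T.obj.hom
        rw [← Category.assoc, hh]
        exact Over.w g.hom
      · exact InducedCategory.hom_ext (Over.OverMorphism.ext hh)
  let Φ : ∀ T : LocNoethOver S, (T ⟶ Ter) →
      {E : (A.pullback T.obj.hom).Submod // A.IsFamilyOfSubalgebras δ E} := fun T h =>
    ⟨(ρ.homEquiv (h ≫ i)).1, (hfac T (h ≫ i)).1 ⟨h, rfl⟩, (ρ.homEquiv (h ≫ i)).2.1,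
      (AlgebraSheaf.isGrassmannianPoint_iff hA).1 (ρ.homEquiv (h ≫ i)).2⟩
  have hΦ : ∀ T, Function.Bijective (Φ T) := by
    intro T
    constructor
    · intro h h' hh
      have hv : (Φ T h).1 = (Φ T h').1 := congrArg Subtype.val hh
      have h1 : h ≫ i = h' ≫ i := ρ.homEquiv.injective (Subtype.ext hv)
      have h2 : h.hom.left ≫ I.subschemeι = h'.hom.left ≫ I.subschemeι :=
        congrArg (fun k : T ⟶ G => k.hom.left) h1
      exact InducedCategory.hom_ext (Over.OverMorphism.ext ((cancel_mono I.subschemeι).1 h2))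
    · rintro ⟨E, hE⟩
      obtain ⟨g, hg⟩ := ρ.homEquiv.surjective
        ⟨E, (AlgebraSheaf.isGrassmannianPoint_iff hA).2 hE.quotientLocallyFree⟩
      obtain ⟨h, rfl⟩ := (hfac T g).2 (by rw [hg]; exact hE.isSubalgebra)
      have hv : (ρ.homEquiv (h ≫ i)).1 = E := congrArg Subtype.val hg
      exact ⟨h, Subtype.ext hv⟩
  refine ⟨Ter, i, ⟨fun {T} => Equiv.ofBijective (Φ T) (hΦ T), ?_⟩, ?_, fun T h => rfl, ?_⟩
  · intro T T' g h
    refine Subtype.ext ?_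
    have h1 := ρ.homEquiv_comp g (h ≫ i)
    rw [← Category.assoc] at h1
    have hv : (ρ.homEquiv ((g ≫ h) ≫ i)).1 =
        ((AlgebraSheaf.grassmannianFunctor hA _).map g.op (ρ.homEquiv (h ≫ i))).1 :=
      congrArg Subtype.val h1
    exact hv
  · exact inferInstanceAs (IsClosedImmersion I.subschemeι)
  · intro T g
    exact (hfac T g).trans and_comm
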